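/- Let $Y^a_1,Y^a_2,\dots$ be iid with law $P^a$ and, independently of them, $Y^b_1,Y^b_2,\dots$ iid with law $P^b$, with values in a measurable space. Samples of sizes $n_a,n_b\to\infty$ are observed, with $\sqrt{n_a/n_b}\to\lambda\in\mathbb R$. Write $Pf=\int f\,dP$, and let $P^a_n,P^b_n$ be the empirical measures of the two samples. Let $\mathcal F$ be a class of (utility) functions that is $P^a$-Donsker and $P^b$-Donsker: it consists of measurable square integrable functions, $\sup_{f\in\mathcal F}|f(y)-Pf|<\infty$ for $P$-almost every $y$, and the empirical process converges weakly, in the sense of outer expectations, in $\ell^\infty(\mathcal F)$ to a tight Borel limit, for $P=P^a$ and $P=P^b$. Assume: 1. $\sigma_f^2=\operatorname{Var}_{P^a}(f)+\lambda^2\operatorname{Var}_{P^b}(f)$ is bounded away from $0$ uniformly over $f\in\mathcal F$, and $\hat\sigma_f$ are estimators with $\sup_{f\in\mathcal F}|\hat\sigma_f-\sigma_f|\to0$ in (outer) probability. 2. For $P=P^a$ and $P=P^b$ and every $\delta>0$ the class $\mathcal F_\delta=\{f-g: f,g\in\mathcal F,\ \sqrt{P(f-g-P(f-g))^2}<\delta\}$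 is $P$-measurable, i.e. for all $n$ and $e\in\mathbb R^n$ the map $x\mapsto\sup_{h\in\mathcal F_\delta}|\sum_{i\le n}e_ih(x_i)|$ is measurable for the completion of $P^n$. 3. For each of the two samples, and each sample size $n$, the bootstrap weights $(\tilde W_{n1},\dots,\tilde W_{nn})$ are nonnegative and exchangeable, and with $\bar W_n=n^{-1}\sum_i\tilde W_{ni}$ and a constant $c>0$ common to both samples, $$\sup_n\int_0^\infty\sqrt{\Pr(|\tilde W_{n1}-\bar W_n|>x)}\,dx<\infty,\quad n^{-1/2}\,\mathrm E\max_i|\tilde W_{ni}-\bar W_n|\to0,\quad n^{-1}\sum_i(\tilde W_{ni}-\bar W_n)^2\to c^2\ \text{in probability}.$$ The weights $\tilde W^a$, $\tilde W^b$ of the two samples are independent of each other and of the data. Let $$\hat T_f=\frac{\sqrt{n_a}\,[(P^a_n-P^b_n)f-(P^a-P^b)f]}{\hat\sigma_f},\qquad \tilde T_f=\frac{\sqrt{n_a}\,\big[n_a^{-1}\sum_i(\tilde W^a_i-\bar W^a)f(Y^a_i)-n_b^{-1}\sum_i(\tilde W^b_i-\bar W^b)f(Y^b_i)\big]}{c\,\hat\sigma_f},$$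 let $\alpha\in(0,1)$, and let $\tilde T^{\mathcal F\vee}_{1-\alpha}$ be the $(1-\alpha)$-quantile of $\sup_{f\in\mathcal F}\tilde T_f$ over the weights, given the data and $\hat\sigma$. Consider the multiple testing procedure for the hypotheses $H_{0f}: P^af-P^bf\le0$, $f\in\mathcal F$, that rejects $H_{0f}$ when $\hat T_f>\tilde T^{\mathcal F\vee}_{1-\alpha}$. It has strong control of the asymptotic familywise error rate at level $\alpha$: whatever the set $\mathcal F_T=\{f\in\mathcal F: P^af-P^bf\le0\}$ of true hypotheses, $$\limsup_{n_a,n_b\to\infty}\Pr\big(\hat T_f>\tilde T^{\mathcal F\vee}_{1-\alpha}\ \text{for some } f\in\mathcal F_T\big)\le\alpha$$ (outer probability if the event is not measurable). The same holds with the zero-centered statistic $\sqrt{n_a}(P^a_n-P^b_n)f/\hat\sigma_f$ in place of $\hat T_f$. Both statements also hold if the critical value is replaced by the sample $(1-\alpha)$-quantile of $\sup_{f\in\mathcal F}\tilde T_f$ over $R$ independent draws of the weights, with $R\to\infty$; here $\hat\sigma_f$ may depend on the draws. -/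

import Mathlib

open MeasureTheory ProbabilityTheory Filter Topology
open scoped ENNReal NNReal BoundedContinuousFunction

noncomputable section

namespace UtilityMTP

/-! ### Weak convergence in the space of bounded functions, and Donsker classes -/

/-- The space of bounded real functions on `ι` with the supremum norm. -/
abbrev LInf (ι : Type*) : Type _ := lp (fun _ : ι => ℝ) ∞

instance instMeasurableSpaceLInf (ι : Type*) : MeasurableSpace (LInf ι) := borel _

instance instBorelSpaceLInf (ι : Type*) : BorelSpace (LInf ι) := ⟨rfl⟩

open Classical in
/-- A bounded function seen as a point of `LInf ι`. Unbounded functions are sent to `0`; in the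
definition of a Donsker class this concerns a null set only. -/
def toLInf {ι : Type*} (g : ι → ℝ) : LInf ι :=
  if h : Memℓp (E := fun _ : ι => ℝ) g ∞ then ⟨g, h⟩ else 0

/-- Outer expectation of a nonnegative function that need not be measurable. -/
def outerExpectation {S : Type*} [MeasurableSpace S] (μ : Measure S) (h : S → ℝ≥0∞) : ℝ≥0∞ :=
  ⨅ (u : S → ℝ≥0∞) (_ : Measurable u) (_ : ∀ s, h s ≤ u s), ∫⁻ s, u s ∂μ

/-- Weak convergence (in the sense of outer expectations) of maps `Z n`, defined on probability
spaces `(S n, μ n)` and not necessarily measurable, to a Borel law `Γ`. Testing with nonnegative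
bounded continuous functions is the same as testing with all of them, since constants can be
added to a test function. -/
def WeaklyConverges {S : ℕ → Type*} [∀ n, MeasurableSpace (S n)] (μ : ∀ n, Measure (S n))
    {D : Type*} [TopologicalSpace D] [MeasurableSpace D] (Z : ∀ n, S n → D) (Γ : Measure D) :
    Prop :=
  ∀ h : D →ᵇ ℝ≥0, Tendsto (fun n => outerExpectation (μ n) (fun s => (h (Z n s) : ℝ≥0∞)))
    atTop (𝓝 (∫⁻ z, (h z : ℝ≥0∞) ∂Γ))

variable {𝒳 : Type*}

/-- The empirical mean of `f` over the sample `x`. -/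
def empMean {n : ℕ} (x : Fin n → 𝒳) (f : 𝒳 → ℝ) : ℝ := (n : ℝ)⁻¹ * ∑ i, f (x i)

/-- The one-sample empirical process `√n (P_n - P) f`. -/
def empProcess [MeasurableSpace 𝒳] (P : Measure 𝒳) {n : ℕ} (x : Fin n → 𝒳) (f : 𝒳 → ℝ) : ℝ :=
  Real.sqrt n * (empMean x f - ∫ y, f y ∂P)

/-- `F` is a `P`-Donsker class: a class of measurable, square integrable functions for which the
empirical process, as a map into the bounded functions on `F`, converges weakly to a tight
Borel limit. -/
structure IsDonsker [MeasurableSpace 𝒳] (P : Measure 𝒳) (F : Set (𝒳 → ℝ)) : Prop where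
  measurable : ∀ f ∈ F, Measurable f
  sq_integrable : ∀ f ∈ F, MemLp f 2 P
  bounded_paths : ∀ᵐ y ∂P, BddAbove (Set.range fun f : F => |f.1 y - ∫ z, f.1 z ∂P|)
  weak_limit : ∃ Γ : Measure (LInf F), IsProbabilityMeasure Γ ∧ IsTightMeasureSet {Γ} ∧
    WeaklyConverges (fun n => Measure.pi fun _ : Fin n => P)
      (fun _ x => toLInf fun f : F => empProcess P x f.1) Γ

/-- `G` is a `P`-measurable class: every supremum over `g` in `G` of `|∑ e i g (x i)|` is measurable for the
completion of the product measure. -/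
def IsMeasurableClass [MeasurableSpace 𝒳] (P : Measure 𝒳) (G : Set (𝒳 → ℝ)) : Prop :=
  ∀ (n : ℕ) (e : Fin n → ℝ),
    AEMeasurable (fun x : Fin n → 𝒳 => ⨆ g ∈ G, ‖∑ i, e i * g (x i)‖ₑ)
      (Measure.pi fun _ => P)

/-- The class of differences `f - g` of members of `F` with variance seminorm below `δ`. -/
def diffClass [MeasurableSpace 𝒳] (P : Measure 𝒳) (F : Set (𝒳 → ℝ)) (δ : ℝ) : Set (𝒳 → ℝ) :=
  {h | ∃ f ∈ F, ∃ g ∈ F, h = f - g ∧ Real.sqrt (Var[f - g; P]) < δ}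

/-! ### Exchangeable bootstrap weights -/

/-- The average weight. -/
def wBar {n : ℕ} (w : Fin n → ℝ) : ℝ := (n : ℝ)⁻¹ * ∑ i, w i

/-- `ν n` is the law of the vector of `n` bootstrap weights: exchangeable and nonnegative, with
bounded `L_{2,1}` norms, negligible maximum, and sample variance tending to `c ^ 2` in probability. -/
structure IsWeightLaw (ν : ∀ n : ℕ, Measure (Fin n → ℝ)) (c : ℝ) : Prop where
  prob : ∀ n, IsProbabilityMeasure (ν n)
  exchangeable : ∀ (n : ℕ) (π : Equiv.Perm (Fin n)), (ν n).map (fun w i => w (π i)) = ν n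
  nonneg : ∀ n, ∀ᵐ w ∂(ν n), ∀ i, 0 ≤ w i
  norm_two_one : ∃ C : ℝ≥0, ∀ (n : ℕ) (i : Fin n),
    ∫⁻ t in Set.Ioi (0 : ℝ), (ν n {w | t < |w i - wBar w|}) ^ (1 / 2 : ℝ) ≤ C
  max_negligible : Tendsto
    (fun n : ℕ => ENNReal.ofReal (Real.sqrt n)⁻¹ * ∫⁻ w, (⨆ i, ‖w i - wBar w‖ₑ) ∂(ν n))
    atTop (𝓝 0)
  variance_tendsto : ∀ ε : ℝ, 0 < ε → Tendsto
    (fun n : ℕ => ν n {w | ε ≤ |(n : ℝ)⁻¹ * ∑ i, (w i - wBar w) ^ 2 - c ^ 2|}) atTop (𝓝 0)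

/-- The weighted empirical mean `n⁻¹ ∑ w i f (x i)`. -/
def bootMean {n : ℕ} (w : Fin n → ℝ) (x : Fin n → 𝒳) (f : 𝒳 → ℝ) : ℝ :=
  (n : ℝ)⁻¹ * ∑ i, w i * f (x i)

/-! ### Two-sample statistics -/

/-- The variance `σ_f²` of the limit of the two-sample process at `f`, where `lam` is the limit
of `√(n_a / n_b)`. -/
def sigmaSq [MeasurableSpace 𝒳] (Pa Pb : Measure 𝒳) (lam : ℝ) (f : 𝒳 → ℝ) : ℝ :=
  Var[f; Pa] + lam ^ 2 * Var[f; Pb]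

/-- The indices of the true null hypotheses `P^a f - P^b f ≤ 0`. -/
def trueNulls [MeasurableSpace 𝒳] (Pa Pb : Measure 𝒳) (F : Set (𝒳 → ℝ)) : Set (𝒳 → ℝ) :=
  {f | f ∈ F ∧ ∫ y, f y ∂Pa - ∫ y, f y ∂Pb ≤ 0}

variable {na nb : ℕ}

/-- The `t`-statistic at `f`, centered at the true difference; `s` is the value at `f` of the
estimator of `σ_f`. -/
def tStat [MeasurableSpace 𝒳] (Pa Pb : Measure 𝒳) (xa : Fin na → 𝒳) (xb : Fin nb → 𝒳)
    (s : ℝ) (f : 𝒳 → ℝ) : ℝ :=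
  Real.sqrt na * ((empMean xa f - empMean xb f) - (∫ y, f y ∂Pa - ∫ y, f y ∂Pb)) / s

/-- The `t`-statistic at `f`, centered at zero. -/
def tStatZero (xa : Fin na → 𝒳) (xb : Fin nb → 𝒳) (s : ℝ) (f : 𝒳 → ℝ) : ℝ :=
  Real.sqrt na * (empMean xa f - empMean xb f) / s

/-- The bootstrap process at `f`, for given data and given weights `w = (w^a, w^b)`. -/
def bootProcess (c : ℝ) (xa : Fin na → 𝒳) (xb : Fin nb → 𝒳)
    (w : (Fin na → ℝ) × (Fin nb → ℝ)) (f : 𝒳 → ℝ) : ℝ :=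
  Real.sqrt na * ((bootMean w.1 xa f - bootMean w.2 xb f)
    - (wBar w.1 * empMean xa f - wBar w.2 * empMean xb f)) / c

/-- The supremum over `F` of the bootstrap `t`-statistics, in the extended reals; `s f` is the
estimate of `σ_f`. -/
def bootSup (F : Set (𝒳 → ℝ)) (c : ℝ) (s : (𝒳 → ℝ) → ℝ) (xa : Fin na → 𝒳) (xb : Fin nb → 𝒳)
    (w : (Fin na → ℝ) × (Fin nb → ℝ)) : EReal :=
  ⨆ f ∈ F, ((bootProcess c xa xb w f / s f : ℝ) : EReal)

/-- The `p`-quantile of an extended real random variable. -/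
def quantile {S : Type*} [MeasurableSpace S] (ν : Measure S) (X : S → EReal) (p : ℝ) : EReal :=
  sInf {t | ENNReal.ofReal p ≤ ν {s | X s ≤ t}}

/-- The sample `p`-quantile of finitely many extended reals. -/
def sampleQuantile {R : ℕ} (X : Fin R → EReal) (p : ℝ) : EReal :=
  sInf {t | p * R ≤ ({r | X r ≤ t} : Set (Fin R)).ncard}

/-- The bootstrap critical value: the `p`-quantile of the bootstrap supremum given the data, the
two weight vectors being independent of each other and of the data. -/
def bootCrit (νa νb : ∀ n : ℕ, Measure (Fin n → ℝ)) (F : Set (𝒳 → ℝ)) (c : ℝ)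
    (s : (𝒳 → ℝ) → ℝ) (xa : Fin na → 𝒳) (xb : Fin nb → 𝒳) (p : ℝ) : EReal :=
  quantile ((νa na).prod (νb nb)) (bootSup F c s xa xb) p

/-- The simulated critical value: the sample `p`-quantile of the bootstrap suprema over `R` draws
of the weights. -/
def simCrit {R : ℕ} (F : Set (𝒳 → ℝ)) (c : ℝ) (s : (𝒳 → ℝ) → ℝ)
    (xa : Fin na → 𝒳) (xb : Fin nb → 𝒳)
    (w : Fin R → (Fin na → ℝ) × (Fin nb → ℝ)) (p : ℝ) : EReal :=
  sampleQuantile (fun r => bootSup F c s xa xb (w r)) p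

/-- The first `n` observations. -/
def sample {Ω : Type*} (Y : ℕ → Ω → 𝒳) (n : ℕ) (ω : Ω) : Fin n → 𝒳 := fun i => Y i ω

/-- The familywise error rate: the (outer) probability that the procedure rejecting when
`T f > crit` rejects some hypothesis with index in `FT`. -/
def fwer {Ω : Type*} [MeasurableSpace Ω] (μ : Measure Ω) (FT : Set (𝒳 → ℝ))
    (T : Ω → (𝒳 → ℝ) → ℝ) (crit : Ω → EReal) : ℝ≥0∞ :=
  μ {ω | ∃ f ∈ FT, crit ω < (T ω f : EReal)}

end UtilityMTP

end

noncomputable section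

namespace UtilityMTP

section

/-! ### A Lindeberg bound for characteristic functions of weighted sums -/

/-! A false rejection forces the two-sample process, divided by the estimated standard deviations,
above the critical value at some member of `F`; at a true null the zero-centered statistic is only
smaller. So it suffices to bound the probability that this happens anywhere in `F`, whatever the set
of true nulls.

The two sides of the comparison are treated asymmetrically. The process has to be bounded above over
all of `F`, and here the Donsker property enters: tightness of the limit yields a finite partition
of `F` on whose cells the empirical process is nearly constant (`IsDonsker.exists_partition`), so
the supremum is nearly a maximum over representatives. The critical value has to be bounded only
from below. Since the bootstrap supremum over `F` dominates the maximum over every finite subclass,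
finite-dimensional limits of the bootstrap process are enough for that.

The link is a number `τ` that plays the role of the `(1 - α)`-quantile of the supremum of the
Gaussian limit but is defined by finite subclasses alone (`TwoSample.exists_threshold`): at each
level below `τ` some finite subclass has its Gaussian maximum below that level with probability less
than `1 - α`, and above `τ` none does. The first half keeps the critical value above `τ` minus a
small number; the second bounds the exceedance probability of the process slightly above `τ`. The
gap between the two levels costs little because distribution functions of the Gaussian maxima are
Lipschitz with one constant for all finite subclasses (`TwoSample.exists_boxProb_le_add`). This
anti-concentration comes from finitely many cells of coordinates with mutual correlation at least `1
/ 2`.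

The finite-dimensional bootstrap limit must hold conditionally on the data. It follows by second
moments (`tendsto_integral_sub_sq`): if two bootstrap copies, drawn independently for the same data,
converge jointly to independent Gaussian vectors, then the conditional mean of a test function has
variance tending to zero. Joint convergence (`tendsto_integral_vecSum_pair`) is a Lindeberg argument
with characteristic functions, applied given the weights: it needs small coefficients, convergent
sums of squares and vanishing cross products. The cross products vanish because exchangeable
coordinates that sum to zero have covariances of order `1 / n` relative to their variances. Averages
over `R` simulated draws add a variance of at most `1 / R`. -/

lemma norm_cexp_sub_taylor_le (x : ℝ) :
    ‖Complex.exp (x * Complex.I) - (1 + x * Complex.I - (x : ℂ) ^ 2 / 2)‖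
      ≤ 4 * (x ^ 2 * min 1 |x|) := by
  -- Third-order remainder for small `x`, crude second-order bound for large `x`; this is the form
  -- of the error that needs only two moments. The constant `4` covers `exp 1` in the first case and
  -- `1 + 1 + |x| + x ^ 2 / 2` in the second.
  rcases le_total |x| 1 with h | h
  · have h1 := Complex.norm_exp_sub_sum_le_norm_mul_exp (x * Complex.I) 3
    have h2 : ∑ m ∈ Finset.range 3, ((x : ℂ) * Complex.I) ^ m / (m.factorial : ℂ)
        = 1 + x * Complex.I - (x : ℂ) ^ 2 / 2 := by
      simp only [Finset.sum_range_succ, Finset.sum_range_zero, mul_pow, Complex.I_sq]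
      simp [Nat.factorial]
      ring
    rw [h2] at h1
    refine h1.trans ?_
    have h3 : ‖(x : ℂ) * Complex.I‖ = |x| := by simp
    rw [h3, min_eq_right h]
    have h4 : Real.exp |x| ≤ 4 := by
      calc Real.exp |x| ≤ Real.exp 1 := Real.exp_le_exp.2 h
        _ ≤ 4 := by linarith [Real.exp_one_lt_d9]
    have h5 : |x| ^ 3 = x ^ 2 * |x| := by rw [pow_succ, sq_abs]
    rw [h5]
    nlinarith [mul_nonneg (sq_nonneg x) (abs_nonneg x)]
  · rw [min_eq_left h, mul_one]
    have h1 : ‖Complex.exp (x * Complex.I)‖ = 1 := Complex.norm_exp_ofReal_mul_I x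
    have h2 : ‖(1 + x * Complex.I - (x : ℂ) ^ 2 / 2 : ℂ)‖ ≤ 1 + |x| + x ^ 2 / 2 := by
      refine (norm_sub_le _ _).trans ?_
      refine add_le_add ((norm_add_le _ _).trans ?_) ?_
      · simp
      · simp
    have h3 := norm_sub_le (Complex.exp (x * Complex.I)) (1 + x * Complex.I - (x : ℂ) ^ 2 / 2)
    have h4 : |x| ^ 2 = x ^ 2 := sq_abs x
    nlinarith

lemma abs_exp_neg_sub_le {y : ℝ} (hy : 0 ≤ y) : |Real.exp (-y) - (1 - y)| ≤ y ^ 2 := by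
  rcases le_total y 1 with h | h
  · have := Real.norm_exp_sub_one_sub_id_le (x := -y) (by simpa [abs_of_nonneg hy] using h)
    simp only [Real.norm_eq_abs, abs_neg, sq_abs] at this
    convert this using 2
    ring
  · have h1 := Real.add_one_le_exp (-y)
    have h2 : Real.exp (-y) ≤ 1 := Real.exp_le_one_iff.2 (by linarith)
    rw [abs_of_nonneg (by linarith)]
    nlinarith

/-- Telescoping: factors are exchanged one at a time, and the remaining ones have norm at most one.
-/
lemma norm_prod_sub_prod_le_sum {ι : Type*} (s : Finset ι) (a b : ι → ℂ)
    (ha : ∀ i ∈ s, ‖a i‖ ≤ 1) (hb : ∀ i ∈ s, ‖b i‖ ≤ 1) :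
    ‖∏ i ∈ s, a i - ∏ i ∈ s, b i‖ ≤ ∑ i ∈ s, ‖a i - b i‖ := by
  classical
  induction s using Finset.induction_on with
  | empty => simp
  | insert j s hj ih =>
    rw [Finset.prod_insert hj, Finset.prod_insert hj, Finset.sum_insert hj]
    have h1 : a j * ∏ i ∈ s, a i - b j * ∏ i ∈ s, b i
        = (a j - b j) * ∏ i ∈ s, a i + b j * (∏ i ∈ s, a i - ∏ i ∈ s, b i) := by ring
    have h2 : ‖∏ i ∈ s, a i‖ ≤ 1 := by
      rw [norm_prod]
      exact Finset.prod_le_one (fun _ _ => norm_nonneg _)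
        fun i hi => ha i (Finset.mem_insert_of_mem hi)
    have h3 := ih (fun i hi => ha i (Finset.mem_insert_of_mem hi))
      fun i hi => hb i (Finset.mem_insert_of_mem hi)
    rw [h1]
    refine (norm_add_le _ _).trans (add_le_add ?_ ?_)
    · rw [norm_mul]
      exact mul_le_of_le_one_right (norm_nonneg _) h2
    · rw [norm_mul]
      exact (mul_le_of_le_one_left (norm_nonneg _) (hb j (Finset.mem_insert_self _ _))).trans h3

variable {𝒳 : Type*} [MeasurableSpace 𝒳]

lemma integrable_sq_mul_min {P : Measure 𝒳} {V : 𝒳 → ℝ} (hV : MemLp V 2 P) {W : 𝒳 → ℝ}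
    (hW : AEStronglyMeasurable W P) :
    Integrable (fun y => V y ^ 2 * min 1 |W y|) P := by
  refine hV.integrable_sq.mul_bdd (c := 1)
    ((aestronglyMeasurable_const.inf hW.norm)) (.of_forall fun y => ?_)
  rw [Real.norm_eq_abs, abs_of_nonneg (le_min zero_le_one (abs_nonneg _))]
  exact min_le_left _ _

/-- Both terms are compared with `1 - s / 2`, where `s` is the variance: the linear Taylor term
integrates to zero by centering, the truncated moment is the Lindeberg term, and `s ^ 2` is the
error of the Gaussian factor. -/
lemma norm_charFun_sub_exp_le {P : Measure 𝒳} [IsProbabilityMeasure P] {V : 𝒳 → ℝ}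
    (hV : MemLp V 2 P) (h0 : ∫ y, V y ∂P = 0) :
    ‖∫ y, Complex.exp (V y * Complex.I) ∂P - Complex.exp (-((∫ y, V y ^ 2 ∂P : ℝ) : ℂ) / 2)‖
      ≤ 4 * (∫ y, V y ^ 2 * min 1 |V y| ∂P) + (∫ y, V y ^ 2 ∂P) ^ 2 := by
  set s := ∫ y, V y ^ 2 ∂P with hs
  have hs0 : 0 ≤ s := integral_nonneg fun y => sq_nonneg _
  have hi1 : Integrable V P := hV.integrable (by norm_num)
  have hi2 : Integrable (fun y => V y ^ 2) P := hV.integrable_sq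
  have hie : Integrable (fun y => Complex.exp (V y * Complex.I)) P := by
    refine Integrable.of_bound (C := 1) ?_ (.of_forall fun y => ?_)
    · exact Complex.continuous_exp.comp_aestronglyMeasurable
        ((Complex.continuous_ofReal.comp_aestronglyMeasurable hV.1).mul_const _)
    · rw [Complex.norm_exp_ofReal_mul_I]
  have hit : Integrable (fun y => (1 + V y * Complex.I - (V y : ℂ) ^ 2 / 2 : ℂ)) P := by
    refine ((integrable_const _).add (hi1.ofReal.mul_const _)).sub ?_
    have := (hi2.ofReal (𝕜 := ℂ)).div_const 2
    simpa using this
  have e1 : ∫ y, (1 + V y * Complex.I - (V y : ℂ) ^ 2 / 2 : ℂ) ∂P = 1 - (s : ℂ) / 2 := by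
    have hA : Integrable (fun y => (V y : ℂ) * Complex.I) P := hi1.ofReal.mul_const _
    have hB : Integrable (fun y => (V y : ℂ) ^ 2 / 2) P := by
      have := (hi2.ofReal (𝕜 := ℂ)).div_const 2
      simpa using this
    have hC : Integrable (fun y => 1 + (V y : ℂ) * Complex.I) P := (integrable_const _).add hA
    rw [integral_sub hC hB, integral_add (integrable_const _) hA,
      integral_mul_const, integral_div, integral_complex_ofReal, h0]
    have : ∫ y, (V y : ℂ) ^ 2 ∂P = (s : ℂ) := by
      rw [hs, ← integral_complex_ofReal]
      simp
    simp [this]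
  have e2 : ‖∫ y, Complex.exp (V y * Complex.I) ∂P - (1 - (s : ℂ) / 2)‖
      ≤ 4 * (∫ y, V y ^ 2 * min 1 |V y| ∂P) := by
    rw [← e1, ← integral_sub hie hit, ← integral_const_mul]
    exact norm_integral_le_of_norm_le ((integrable_sq_mul_min hV hV.1).const_mul _)
      (.of_forall fun y => norm_cexp_sub_taylor_le (V y))
  have e3 : ‖(1 - (s : ℂ) / 2) - Complex.exp (-(s : ℂ) / 2)‖ ≤ s ^ 2 := by
    have h1 := abs_exp_neg_sub_le (y := s / 2) (by positivity)
    have h2 : (1 - (s : ℂ) / 2) - Complex.exp (-(s : ℂ) / 2)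
        = ((-(Real.exp (-(s / 2)) - (1 - s / 2)) : ℝ) : ℂ) := by
      push_cast
      rw [neg_div]
      ring
    rw [h2, Complex.norm_real, Real.norm_eq_abs, abs_neg]
    nlinarith
  calc _ = ‖(∫ y, Complex.exp (V y * Complex.I) ∂P - (1 - (s : ℂ) / 2))
        + ((1 - (s : ℂ) / 2) - Complex.exp (-(s : ℂ) / 2))‖ := by congr 1; ring
    _ ≤ _ := (norm_add_le _ _).trans (add_le_add e2 e3)

/-- The sum `∑ u j * g (x j)`. -/
def wSum {n : ℕ} (u : Fin n → ℝ) (x : Fin n → 𝒳) (g : 𝒳 → ℝ) : ℝ := ∑ j, u j * g (x j)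

lemma tendsto_integral_sq_mul_min {P : Measure 𝒳} {h : 𝒳 → ℝ} (hh : MemLp h 2 P) :
    Tendsto (fun m : ℝ => ∫ y, h y ^ 2 * min 1 |m * h y| ∂P) (𝓝 0) (𝓝 0) := by
  have h0 : (0 : ℝ) = ∫ y, h y ^ 2 * min 1 |0 * h y| ∂P := by simp
  conv_rhs => rw [h0]
  refine tendsto_integral_filter_of_dominated_convergence (fun y => h y ^ 2)
    (.of_forall fun m => (integrable_sq_mul_min hh (hh.1.const_mul m)).1)
    (.of_forall fun m => .of_forall fun y => ?_) hh.integrable_sq (.of_forall fun y => ?_)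
  · rw [Real.norm_eq_abs, abs_of_nonneg (mul_nonneg (sq_nonneg _) (le_min zero_le_one (abs_nonneg _)))]
    exact mul_le_of_le_one_right (sq_nonneg _) (min_le_left _ _)
  · have : Continuous fun m : ℝ => h y ^ 2 * min 1 |m * h y| := by fun_prop
    exact this.tendsto 0

/-- Independence splits both expressions into products over the observations, which are compared
factor by factor. The bracket depends on the weights only through their common bound `m`, so it is
small for uniformly small weights, while the prefactor stays bounded. -/
lemma charFun_pair_bound {P : Measure 𝒳} [IsProbabilityMeasure P] {g₁ g₂ : 𝒳 → ℝ}
    (h₁ : MemLp g₁ 2 P) (h₂ : MemLp g₂ 2 P) (z₁ : ∫ y, g₁ y ∂P = 0) (z₂ : ∫ y, g₂ y ∂P = 0)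
    {n : ℕ} (u v : Fin n → ℝ) {m : ℝ} (hu : ∀ j, |u j| ≤ m) (hv : ∀ j, |v j| ≤ m) :
    ‖∫ x, Complex.exp (((wSum u x g₁ + wSum v x g₂ : ℝ) : ℂ) * Complex.I)
          ∂(Measure.pi fun _ : Fin n => P)
      - Complex.exp (-(((∫ y, g₁ y ^ 2 ∂P) * ∑ j, u j ^ 2
          + 2 * (∫ y, g₁ y * g₂ y ∂P) * ∑ j, u j * v j
          + (∫ y, g₂ y ^ 2 ∂P) * ∑ j, v j ^ 2 : ℝ) : ℂ) / 2)‖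
      ≤ 2 * (∑ j, (u j ^ 2 + v j ^ 2)) *
        (4 * (∫ y, (|g₁ y| + |g₂ y|) ^ 2 * min 1 |m * (|g₁ y| + |g₂ y|)| ∂P)
          + m ^ 2 * (∫ y, (|g₁ y| + |g₂ y|) ^ 2 ∂P) ^ 2) := by
  set h : 𝒳 → ℝ := fun y => |g₁ y| + |g₂ y| with hh
  have hL : MemLp h 2 P := h₁.abs.add h₂.abs
  set V : Fin n → 𝒳 → ℝ := fun j y => u j * g₁ y + v j * g₂ y with hV
  have hVL : ∀ j, MemLp (V j) 2 P := fun j => (h₁.const_mul _).add (h₂.const_mul _)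
  have i₁ := h₁.integrable (q := 2) (by norm_num)
  have i₂ := h₂.integrable (q := 2) (by norm_num)
  have hV0 : ∀ j, ∫ y, V j y ∂P = 0 := fun j => by
    simp only [hV]
    rw [integral_add (i₁.const_mul _) (i₂.const_mul _), integral_const_mul, integral_const_mul,
      z₁, z₂]
    simp
  have hVs : ∀ j, ∫ y, V j y ^ 2 ∂P = (∫ y, g₁ y ^ 2 ∂P) * u j ^ 2
          + 2 * (∫ y, g₁ y * g₂ y ∂P) * (u j * v j) + (∫ y, g₂ y ^ 2 ∂P) * v j ^ 2 := fun j => by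
    have : ∀ y, V j y ^ 2 = u j ^ 2 * g₁ y ^ 2 + (2 * (u j * v j)) * (g₁ y * g₂ y)
        + v j ^ 2 * g₂ y ^ 2 := fun y => by simp only [hV]; ring
    have i12 : Integrable (fun y => g₁ y * g₂ y) P := h₁.integrable_mul h₂
    have i112 : Integrable (fun y => u j ^ 2 * g₁ y ^ 2 + (2 * (u j * v j)) * (g₁ y * g₂ y)) P :=
      (h₁.integrable_sq.const_mul _).add (i12.const_mul _)
    simp_rw [this]
    rw [integral_add i112
      (h₂.integrable_sq.const_mul _), integral_add (h₁.integrable_sq.const_mul _)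
      (i12.const_mul _), integral_const_mul, integral_const_mul, integral_const_mul]
    ring
  have e1 : ∫ x, Complex.exp (((wSum u x g₁ + wSum v x g₂ : ℝ) : ℂ) * Complex.I)
          ∂(Measure.pi fun _ : Fin n => P)
      = ∏ j, ∫ y, Complex.exp (V j y * Complex.I) ∂P := by
    rw [← integral_fintype_prod_eq_prod]
    congr 1
    ext x
    rw [← Complex.exp_sum, ← Finset.sum_mul, wSum, wSum, ← Finset.sum_add_distrib]
    push_cast
    simp [hV]
  have e2 : Complex.exp (-(((∫ y, g₁ y ^ 2 ∂P) * ∑ j, u j ^ 2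
          + 2 * (∫ y, g₁ y * g₂ y ∂P) * ∑ j, u j * v j
          + (∫ y, g₂ y ^ 2 ∂P) * ∑ j, v j ^ 2 : ℝ) : ℂ) / 2)
      = ∏ j, Complex.exp (-((∫ y, V j y ^ 2 ∂P : ℝ) : ℂ) / 2) := by
    rw [← Complex.exp_sum, ← Finset.sum_div, Finset.sum_neg_distrib, ← Complex.ofReal_sum]
    simp_rw [hVs]
    rw [Finset.sum_add_distrib, Finset.sum_add_distrib, Finset.mul_sum, Finset.mul_sum,
      Finset.mul_sum]
  rw [e1, e2]
  refine (norm_prod_sub_prod_le_sum _ _ _ (fun j _ => ?_) fun j _ => ?_).trans ?_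
  · refine (norm_integral_le_of_norm_le_const (C := 1) (.of_forall fun y => ?_)).trans ?_
    · rw [Complex.norm_exp_ofReal_mul_I]
    · simp
  · rw [Complex.norm_exp]
    have : 0 ≤ ∫ y, V j y ^ 2 ∂P := integral_nonneg fun y => sq_nonneg _
    refine Real.exp_le_one_iff.2 ?_
    rw [← Complex.ofReal_neg, Complex.div_ofNat_re, Complex.ofReal_re]
    linarith
  · rw [Finset.mul_sum, Finset.sum_mul]
    refine Finset.sum_le_sum fun j _ => (norm_charFun_sub_exp_le (hVL j) (hV0 j)).trans ?_
    -- The `j`-th summand is dominated by `r` times the envelope `h`. Each error term carries a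
    -- factor `r ^ 2`, which is summable over `j`, and what is left is controlled by `r ≤ m`.
    set r := max |u j| |v j| with hr
    have hr0 : 0 ≤ r := le_max_of_le_left (abs_nonneg _)
    have hrm : r ≤ m := max_le (hu j) (hv j)
    have hr2 : r ^ 2 ≤ u j ^ 2 + v j ^ 2 := by
      rcases max_choice |u j| |v j| with h' | h' <;> rw [hr, h', sq_abs] <;> nlinarith [sq_nonneg (u j), sq_nonneg (v j)]
    have hVh : ∀ y, |V j y| ≤ r * h y := fun y => by
      calc |V j y| ≤ |u j * g₁ y| + |v j * g₂ y| := abs_add_le _ _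
        _ = |u j| * |g₁ y| + |v j| * |g₂ y| := by rw [abs_mul, abs_mul]
        _ ≤ r * |g₁ y| + r * |g₂ y| := by
          gcongr
          · exact le_max_left _ _
          · exact le_max_right _ _
        _ = r * h y := by simp only [hh]; ring
    have hh0 : ∀ y, 0 ≤ h y := fun y => add_nonneg (abs_nonneg _) (abs_nonneg _)
    have hsq : ∀ y, V j y ^ 2 ≤ r ^ 2 * h y ^ 2 := fun y => by
      rw [← sq_abs, ← mul_pow]
      exact pow_le_pow_left₀ (abs_nonneg _) (hVh y) 2
    have b1 : ∫ y, V j y ^ 2 * min 1 |V j y| ∂P ≤ r ^ 2 * ∫ y, h y ^ 2 * min 1 |m * h y| ∂P := by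
      rw [← integral_const_mul]
      refine integral_mono (integrable_sq_mul_min (hVL j) (hVL j).1)
        ((integrable_sq_mul_min hL (hL.1.const_mul m)).const_mul _) fun y => ?_
      simp only
      rw [← mul_assoc]
      refine mul_le_mul (hsq y) (min_le_min le_rfl ?_) (le_min zero_le_one (abs_nonneg _))
        (by positivity)
      rw [abs_of_nonneg (mul_nonneg (hr0.trans hrm) (hh0 y))]
      exact (hVh y).trans (mul_le_mul_of_nonneg_right hrm (hh0 y))
    have b2 : ∫ y, V j y ^ 2 ∂P ≤ r ^ 2 * ∫ y, h y ^ 2 ∂P := by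
      rw [← integral_const_mul]
      exact integral_mono (hVL j).integrable_sq (hL.integrable_sq.const_mul _) hsq
    have n1 : 0 ≤ ∫ y, h y ^ 2 * min 1 |m * h y| ∂P :=
      integral_nonneg fun y => mul_nonneg (sq_nonneg _) (le_min zero_le_one (abs_nonneg _))
    have n2 : 0 ≤ ∫ y, V j y ^ 2 ∂P := integral_nonneg fun y => sq_nonneg _
    set A := ∫ y, h y ^ 2 * min 1 |m * h y| ∂P
    set B := ∫ y, h y ^ 2 ∂P
    have b3 : (∫ y, V j y ^ 2 ∂P) ^ 2 ≤ r ^ 2 * (m ^ 2 * B ^ 2) := by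
      calc _ ≤ (r ^ 2 * B) ^ 2 := pow_le_pow_left₀ n2 b2 2
        _ = r ^ 2 * (r ^ 2 * B ^ 2) := by ring
        _ ≤ _ := by gcongr
    have b4 : 0 ≤ 4 * A + m ^ 2 * B ^ 2 := by positivity
    have b5 := mul_le_mul_of_nonneg_right hr2 b4
    have b6 : 0 ≤ (u j ^ 2 + v j ^ 2) * (4 * A + m ^ 2 * B ^ 2) := by positivity
    nlinarith

/-- Weighted sums of a centered pair of functions have nearly Gaussian characteristic functions,
uniformly over small weights with bounded sum of squares. -/
lemma exists_charFun_pair_le {P : Measure 𝒳} [IsProbabilityMeasure P] {g₁ g₂ : 𝒳 → ℝ}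
    (h₁ : MemLp g₁ 2 P) (h₂ : MemLp g₂ 2 P) (z₁ : ∫ y, g₁ y ∂P = 0) (z₂ : ∫ y, g₂ y ∂P = 0)
    (p p' : ℝ) {ε : ℝ} (hε : 0 < ε) :
    ∃ δ : ℝ, 0 < δ ∧ ∀ (n : ℕ) (u v : Fin n → ℝ), (∀ j, |u j| ≤ δ) → (∀ j, |v j| ≤ δ) →
      |∑ j, u j ^ 2 - p| ≤ δ → |∑ j, v j ^ 2 - p'| ≤ δ → |∑ j, u j * v j| ≤ δ →
      ‖∫ x, Complex.exp (((wSum u x g₁ + wSum v x g₂ : ℝ) : ℂ) * Complex.I)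
          ∂(Measure.pi fun _ : Fin n => P)
      - Complex.exp (-(((∫ y, g₁ y ^ 2 ∂P) * p + (∫ y, g₂ y ^ 2 ∂P) * p' : ℝ) : ℂ) / 2)‖ ≤ ε := by
  set A₁ := ∫ y, g₁ y ^ 2 ∂P
  set A₂ := ∫ y, g₂ y ^ 2 ∂P
  set A₃ := ∫ y, g₁ y * g₂ y ∂P
  have hL : MemLp (fun y => |g₁ y| + |g₂ y|) 2 P := h₁.abs.add h₂.abs
  set B := ∫ y, (|g₁ y| + |g₂ y|) ^ 2 ∂P
  -- The constant `|p| + |p'| + 2` bounds both sums of squares together once `δ ≤ 1`.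
  have hc1 : Tendsto (fun m : ℝ => 2 * (|p| + |p'| + 2) *
        (4 * (∫ y, (|g₁ y| + |g₂ y|) ^ 2 * min 1 |m * (|g₁ y| + |g₂ y|)| ∂P)
          + m ^ 2 * B ^ 2)) (𝓝 0) (𝓝 0) := by
    have := ((tendsto_integral_sq_mul_min hL).const_mul 4).add
      (((continuous_pow 2).tendsto (0 : ℝ)).mul_const (B ^ 2))
    have := this.const_mul (2 * (|p| + |p'| + 2))
    simpa using this
  obtain ⟨δ₁, hδ₁, H₁⟩ := Metric.tendsto_nhds_nhds.1 hc1 (ε / 2) (by positivity)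
  -- Continuity is used at cross product `0`: there the covariance term disappears, which decouples
  -- the two sums in the limit.
  have hc2 : ContinuousAt (fun q : ℝ × ℝ × ℝ =>
      Complex.exp (-((A₁ * q.1 + 2 * A₃ * q.2.1 + A₂ * q.2.2 : ℝ) : ℂ) / 2)) (p, 0, p') := by
    refine Continuous.continuousAt ?_
    fun_prop
  obtain ⟨δ₂, hδ₂, H₂⟩ := Metric.continuousAt_iff.1 hc2 (ε / 2) (by positivity)
  set δ := min (min (δ₁ / 2) (δ₂ / 2)) 1 with hδ
  have hδ0 : 0 < δ := by positivity
  refine ⟨δ, hδ0, fun n u v hu hv hp hp' hx => ?_⟩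
  have k1 : δ < δ₁ := by
    have : δ ≤ δ₁ / 2 := (min_le_left _ _).trans (min_le_left _ _)
    linarith
  have k2 : δ < δ₂ := by
    have : δ ≤ δ₂ / 2 := (min_le_left _ _).trans (min_le_right _ _)
    linarith
  have k3 : δ ≤ 1 := min_le_right _ _
  have b1 := charFun_pair_bound h₁ h₂ z₁ z₂ u v hu hv
  have b2 := H₁ (x := δ) (by simpa [abs_of_pos hδ0] using k1)
  rw [Real.dist_0_eq_abs] at b2
  have b2' := (le_abs_self _).trans b2.le
  have b3 := H₂ (x := (∑ j, u j ^ 2, ∑ j, u j * v j, ∑ j, v j ^ 2)) (by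
    rw [Prod.dist_eq, Prod.dist_eq]
    refine max_lt ?_ (max_lt ?_ ?_) <;> rw [Real.dist_eq]
    · exact hp.trans_lt k2
    · simpa using hx.trans_lt k2
    · exact hp'.trans_lt k2)
  simp only [dist_eq_norm, mul_zero, add_zero] at b3
  have b4 : ∑ j, (u j ^ 2 + v j ^ 2) ≤ |p| + |p'| + 2 := by
    rw [Finset.sum_add_distrib]
    have := (abs_le.1 hp).2
    have := (abs_le.1 hp').2
    have := le_abs_self p
    have := le_abs_self p'
    linarith
  have n1 : 0 ≤ ∫ y, (|g₁ y| + |g₂ y|) ^ 2 * min 1 |δ * (|g₁ y| + |g₂ y|)| ∂P :=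
    integral_nonneg fun y => mul_nonneg (sq_nonneg _) (le_min zero_le_one (abs_nonneg _))
  have b5 := (b1.trans (mul_le_mul_of_nonneg_right (mul_le_mul_of_nonneg_left b4 zero_le_two)
    (by positivity))).trans b2'
  calc _ ≤ _ := norm_sub_le_norm_sub_add_norm_sub _ _ _
    _ ≤ ε / 2 + ε / 2 := add_le_add b5 b3.le
    _ = ε := by ring

end

section

/-! ### Pairs of independent exchangeable weights -/

/-- The coefficients `u`, `v` are uniformly small and nearly orthogonal, with sums of squares close
to `p` and `p'`. -/
def NearlyOrthogonal (δ p p' : ℝ) {n : ℕ} (u v : Fin n → ℝ) : Prop :=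
  (∀ j, |u j| ≤ δ) ∧ (∀ j, |v j| ≤ δ) ∧ |∑ j, u j ^ 2 - p| ≤ δ ∧ |∑ j, v j ^ 2 - p'| ≤ δ ∧
    |∑ j, u j * v j| ≤ δ

/-- The centered weights, scaled to have a sum of squares near `1`. -/
def wDev (c : ℝ) {n : ℕ} (w : Fin n → ℝ) (j : Fin n) : ℝ := (w j - wBar w) / (c * Real.sqrt n)

lemma measurable_wDev (c : ℝ) {n : ℕ} : Measurable (wDev c (n := n)) := by
  unfold wDev wBar
  fun_prop

lemma wBar_comp_perm {n : ℕ} (w : Fin n → ℝ) (π : Equiv.Perm (Fin n)) :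
    wBar (fun i => w (π i)) = wBar w := by
  simp only [wBar]
  rw [Equiv.sum_comp π w]

lemma sum_wDev (c : ℝ) {n : ℕ} (w : Fin n → ℝ) : ∑ j, wDev c w j = 0 := by
  simp only [wDev]
  rw [← Finset.sum_div, Finset.sum_sub_distrib]
  rcases Nat.eq_zero_or_pos n with rfl | hn
  · simp
  · have : (n : ℝ) ≠ 0 := by positivity
    simp only [wBar, Finset.sum_const, Finset.card_univ, Fintype.card_fin, nsmul_eq_mul]
    field_simp
    simp

lemma sum_wDev_sq (c : ℝ) {n : ℕ} (w : Fin n → ℝ) :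
    ∑ j, wDev c w j ^ 2 = ((n : ℝ)⁻¹ * ∑ j, (w j - wBar w) ^ 2) / c ^ 2 := by
  simp only [wDev, div_pow, mul_pow, Real.sq_sqrt (Nat.cast_nonneg n)]
  rw [← Finset.sum_div, mul_comm (c ^ 2), ← div_div, div_eq_inv_mul (∑ j, (w j - wBar w) ^ 2)]

/-- The second moment of a linear form in exchangeable variables that sum to zero. -/
lemma integral_sum_mul_sq_le {n : ℕ} (hn : 2 ≤ n) {ν : Measure (Fin n → ℝ)}
    [IsProbabilityMeasure ν] (hex : ∀ π : Equiv.Perm (Fin n), ν.map (fun w i => w (π i)) = ν)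
    (φ : (Fin n → ℝ) → Fin n → ℝ) (hφ : Measurable φ)
    (heq : ∀ (π : Equiv.Perm (Fin n)) w i, φ (fun j => w (π j)) i = φ w (π i))
    (hsum : ∀ w, ∑ i, φ w i = 0) {K : ℝ} (hK : ∀ w, ∑ i, φ w i ^ 2 ≤ K)
    (v : Fin n → ℝ) (hv : ∑ i, v i = 0) :
    ∫ w, (∑ i, φ w i * v i) ^ 2 ∂ν ≤ 2 * K / n * ∑ i, v i ^ 2 := by
  have hφi : ∀ i, Measurable fun w => φ w i := fun i => (measurable_pi_apply i).comp hφ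
  have hK0 : 0 ≤ K := (Finset.sum_nonneg fun i _ => sq_nonneg (φ 0 i)).trans (hK 0)
  have hb : ∀ w i, |φ w i| ≤ Real.sqrt K := fun w i => by
    rw [← Real.sqrt_sq_eq_abs]
    exact Real.sqrt_le_sqrt ((Finset.single_le_sum (f := fun i => φ w i ^ 2)
      (fun j _ => sq_nonneg _) (Finset.mem_univ i)).trans (hK w))
  have hint : ∀ i j, Integrable (fun w => φ w i * φ w j) ν := fun i j => by
    refine Integrable.of_bound (C := K) ((hφi i).mul (hφi j)).aestronglyMeasurable
      (.of_forall fun w => ?_)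
    rw [Real.norm_eq_abs, abs_mul]
    calc _ ≤ Real.sqrt K * Real.sqrt K := mul_le_mul (hb w i) (hb w j) (abs_nonneg _)
          (Real.sqrt_nonneg _)
      _ = K := Real.mul_self_sqrt hK0
  set a : Fin n → Fin n → ℝ := fun i j => ∫ w, φ w i * φ w j ∂ν with ha
  have hperm : ∀ (π : Equiv.Perm (Fin n)) i j, a (π i) (π j) = a i j := fun π i j => by
    have hm : Measurable fun (w : Fin n → ℝ) i => w (π i) :=
      measurable_pi_lambda _ fun i => measurable_pi_apply _
    simp only [ha]
    conv_rhs => rw [← hex π]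
    have hij : Measurable fun w => φ w i * φ w j := (hφi i).mul (hφi j)
    rw [integral_map hm.aemeasurable hij.aestronglyMeasurable]
    simp_rw [heq]
  have hrow : ∀ i, ∑ j, a i j = 0 := fun i => by
    simp only [ha]
    rw [← integral_finsetSum _ fun j _ => hint i j]
    simp_rw [← Finset.mul_sum, hsum]
    simp
  have i₀ : Fin n := ⟨0, by omega⟩
  set A := a i₀ i₀ with hA
  have hdiag : ∀ i, a i i = A := fun i => by
    simpa using hperm (Equiv.swap i₀ i) i₀ i₀
  have hn1 : (0 : ℝ) < (n : ℝ) - 1 := by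
    have : (2 : ℝ) ≤ n := by exact_mod_cast hn
    linarith
  -- Exchangeability makes all off-diagonal moments equal, and the vanishing row sums then determine
  -- them. Since `v` also sums to zero, the quadratic form reduces to a multiple of `∑ v i ^ 2`,
  -- with `A + A / (n - 1) ≤ 2 * A`.
  have hoff : ∀ i j, j ≠ i → a i j = -A / (n - 1) := fun i j hj => by
    have h1 : ∀ l ∈ Finset.univ.erase i, a i l = a i j := fun l hl => by
      have hl' := Finset.ne_of_mem_erase hl
      have := hperm (Equiv.swap j l) i j
      rwa [Equiv.swap_apply_left, Equiv.swap_apply_of_ne_of_ne hj.symm hl'.symm] at this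
    have h2 := hrow i
    rw [← Finset.add_sum_erase _ _ (Finset.mem_univ i), Finset.sum_congr rfl h1, hdiag,
      Finset.sum_const, Finset.card_erase_of_mem (Finset.mem_univ i), Finset.card_univ,
      Fintype.card_fin, nsmul_eq_mul, Nat.cast_sub (by omega)] at h2
    rw [eq_div_iff hn1.ne']
    push_cast at h2
    linarith
  have hA0 : 0 ≤ A := integral_nonneg fun w => mul_self_nonneg _
  have hAn : (n : ℝ) * A ≤ K := by
    have h1 : ∑ i, a i i = n * A := by
      simp [hdiag]
    rw [← h1]
    simp only [ha]
    rw [← integral_finsetSum _ fun j _ => hint j j]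
    calc _ ≤ ∫ _, K ∂ν := integral_mono (integrable_finsetSum _ fun j _ => hint j j)
            (integrable_const _) fun w => by simpa [← sq] using hK w
      _ = K := by simp
  have e1 : ∫ w, (∑ i, φ w i * v i) ^ 2 ∂ν = ∑ i, ∑ j, v i * v j * a i j := by
    have h1 : ∀ w, (∑ i, φ w i * v i) ^ 2 = ∑ i, ∑ j, v i * v j * (φ w i * φ w j) := fun w => by
      rw [sq, Finset.sum_mul_sum]
      exact Finset.sum_congr rfl fun i _ => Finset.sum_congr rfl fun j _ => by ring
    simp_rw [h1]
    rw [integral_finsetSum _ fun i _ => integrable_finsetSum _ fun j _ => (hint i j).const_mul _]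
    refine Finset.sum_congr rfl fun i _ => ?_
    rw [integral_finsetSum _ fun j _ => (hint i j).const_mul _]
    exact Finset.sum_congr rfl fun j _ => integral_const_mul _ _
  have e2 : ∀ i, ∑ j, v i * v j * a i j = (A + A / (n - 1)) * v i ^ 2 := fun i => by
    rw [← Finset.add_sum_erase _ _ (Finset.mem_univ i), hdiag,
      Finset.sum_congr rfl fun j hj => by rw [hoff i j (Finset.ne_of_mem_erase hj)]]
    have h3 : ∑ j ∈ Finset.univ.erase i, v j = - v i := by
      have := Finset.add_sum_erase _ v (Finset.mem_univ i)
      rw [hv] at this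
      linarith
    rw [← Finset.sum_mul, ← Finset.mul_sum, h3]
    ring
  rw [e1]
  simp_rw [e2]
  rw [← Finset.mul_sum]
  refine mul_le_mul_of_nonneg_right ?_ (Finset.sum_nonneg fun i _ => sq_nonneg _)
  have h4 : A / (n - 1) ≤ A := by
    rw [div_le_iff₀ hn1]
    have : (2 : ℝ) ≤ n := by exact_mod_cast hn
    nlinarith
  rw [le_div_iff₀ (by linarith)]
  nlinarith

/-- Markov's inequality turns the negligible expected maximum into uniform smallness; the sum of
squares is the empirical weight variance divided by `c ^ 2`. -/
lemma tendsto_measure_wDev {ν : ∀ n : ℕ, Measure (Fin n → ℝ)} {c : ℝ} (hc : 0 < c)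
    (hν : IsWeightLaw ν c) {δ : ℝ} (hδ : 0 < δ) :
    Tendsto (fun n => ν n {w | ¬ ((∀ j, |wDev c w j| ≤ δ) ∧ |∑ j, wDev c w j ^ 2 - 1| ≤ δ)})
      atTop (𝓝 0) := by
  have h1 : Tendsto (fun n => ν n {w | ¬ ∀ j, |wDev c w j| ≤ δ}) atTop (𝓝 0) := by
    have hne : ENNReal.ofReal (c * δ) ≠ 0 := by
      rw [Ne, ENNReal.ofReal_eq_zero, not_le]
      positivity
    have ht := ENNReal.Tendsto.const_mul (a := (ENNReal.ofReal (c * δ))⁻¹) hν.max_negligible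
      (Or.inr (ENNReal.inv_ne_top.2 hne))
    rw [mul_zero] at ht
    refine tendsto_of_tendsto_of_tendsto_of_le_of_le' tendsto_const_nhds ht
      (.of_forall fun _ => zero_le) ?_
    filter_upwards [eventually_gt_atTop 0] with n hn
    have hsn : 0 < Real.sqrt n := Real.sqrt_pos.2 (by exact_mod_cast hn)
    have hm : Measurable fun w : Fin n → ℝ =>
        ENNReal.ofReal (Real.sqrt n)⁻¹ * ⨆ i, ‖w i - wBar w‖ₑ := by
      unfold wBar
      fun_prop
    have hmark := mul_meas_ge_le_lintegral (μ := ν n) hm (ENNReal.ofReal (c * δ))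
    rw [lintegral_const_mul _ (by unfold wBar; fun_prop)] at hmark
    rw [← ENNReal.div_eq_inv_mul, ENNReal.le_div_iff_mul_le (Or.inl hne)
      (Or.inl ENNReal.ofReal_ne_top), mul_comm]
    refine le_trans (mul_le_mul_right (measure_mono ?_) _) hmark
    intro w hw
    simp only [Set.mem_ofPred_eq, not_forall, not_le] at hw ⊢
    obtain ⟨j, hj⟩ := hw
    calc ENNReal.ofReal (c * δ) ≤ ENNReal.ofReal ((Real.sqrt n)⁻¹ * ‖w j - wBar w‖) := by
          refine ENNReal.ofReal_le_ofReal ?_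
          rw [wDev, abs_div, abs_of_pos (mul_pos hc hsn), lt_div_iff₀ (mul_pos hc hsn)] at hj
          rw [Real.norm_eq_abs, inv_mul_eq_div, le_div_iff₀ hsn]
          linarith
      _ = ENNReal.ofReal (Real.sqrt n)⁻¹ * ‖w j - wBar w‖ₑ := by
          rw [ENNReal.ofReal_mul (by positivity), ofReal_norm]
      _ ≤ _ := mul_le_mul_right (le_iSup (fun i => ‖w i - wBar w‖ₑ) j) _
  have h2 : Tendsto (fun n => ν n {w | ¬ |∑ j, wDev c w j ^ 2 - 1| ≤ δ}) atTop (𝓝 0) := by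
    refine tendsto_of_tendsto_of_tendsto_of_le_of_le tendsto_const_nhds
      (hν.variance_tendsto (c ^ 2 * δ) (by positivity)) (fun _ => zero_le) fun n => ?_
    refine measure_mono fun w hw => ?_
    simp only [Set.mem_ofPred_eq, not_le] at hw ⊢
    rw [sum_wDev_sq, div_sub_one (by positivity), abs_div, abs_of_pos (by positivity : 0 < c ^ 2),
      lt_div_iff₀ (by positivity)] at hw
    linarith
  have h3 := h1.add h2
  rw [add_zero] at h3
  refine tendsto_of_tendsto_of_tendsto_of_le_of_le tendsto_const_nhds h3 (fun _ => zero_le)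
    fun n => ?_
  refine (measure_mono fun w hw => ?_).trans (measure_union_le _ _)
  simp only [Set.mem_ofPred_eq, not_and_or, Set.mem_union] at hw ⊢
  exact hw

lemma wDev_comp_perm (c : ℝ) {n : ℕ} (w : Fin n → ℝ) (π : Equiv.Perm (Fin n)) (i : Fin n) :
    wDev c (fun j => w (π j)) i = wDev c w (π i) := by
  simp only [wDev, wBar_comp_perm]

-- Chebyshev's inequality with the second-moment bound for exchangeable coordinates. The `8` is `2 *
-- K * ∑ v i ^ 2` with both `K` and the sum of squares at most `2`.
open Classical in
lemma measure_cross_le {n : ℕ} (hn : 2 ≤ n) {ν : Measure (Fin n → ℝ)}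
    [IsProbabilityMeasure ν] (hex : ∀ π : Equiv.Perm (Fin n), ν.map (fun w i => w (π i)) = ν)
    (c : ℝ) {δ : ℝ} (hδ : 0 < δ) (v : Fin n → ℝ) (hv : ∑ i, v i = 0) (hv2 : ∑ i, v i ^ 2 ≤ 2) :
    ν {w | |∑ j, wDev c w j ^ 2 - 1| ≤ 1 ∧ δ < |∑ j, wDev c w j * v j|}
      ≤ ENNReal.ofReal (8 / n / δ ^ 2) := by
  set A : Set (Fin n → ℝ) := {w | |∑ j, wDev c w j ^ 2 - 1| ≤ 1} with hA
  have hmw : ∀ j, Measurable fun w : Fin n → ℝ => wDev c w j := fun j =>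
    (measurable_pi_apply j).comp (measurable_wDev c)
  have hAm : MeasurableSet A := by
    refine measurableSet_le ?_ measurable_const
    exact continuous_abs.measurable.comp
      ((Finset.measurable_sum _ fun j _ => (hmw j).pow_const 2).sub_const 1)
  -- Truncation to an event invariant under permutations bounds the sum of squares and preserves
  -- both equivariance and the zero sum.
  set φ : (Fin n → ℝ) → Fin n → ℝ := fun w i => if w ∈ A then wDev c w i else 0 with hφ
  have hφm : Measurable φ := measurable_pi_lambda _ fun i => (hmw i).ite hAm measurable_const
  have hAp : ∀ (π : Equiv.Perm (Fin n)) (w : Fin n → ℝ), (fun j => w (π j)) ∈ A ↔ w ∈ A :=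
    fun π w => by
      simp only [hA, Set.mem_ofPred_eq, wDev_comp_perm]
      rw [Equiv.sum_comp π fun i => wDev c w i ^ 2]
  have key := integral_sum_mul_sq_le hn hex φ hφm
    (fun π w i => by simp only [hφ, hAp, wDev_comp_perm])
    (fun w => by
      by_cases h : w ∈ A
      · simp [hφ, h, sum_wDev]
      · simp [hφ, h]) (K := 2)
    (fun w => by
      by_cases h : w ∈ A
      · simp only [hφ, h, if_true]
        have := (abs_le.1 (show |∑ j, wDev c w j ^ 2 - 1| ≤ 1 from h)).2
        linarith
      · simp [hφ, h]) v hv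
  have hsm : Measurable fun w => ∑ i, φ w i * v i :=
    Finset.measurable_sum _ fun i _ => ((measurable_pi_apply i).comp hφm).mul_const _
  have hcs : ∀ w, (∑ i, φ w i * v i) ^ 2 ≤ 4 := fun w => by
    refine (Finset.sum_mul_sq_le_sq_mul_sq _ _ _).trans ?_
    have h1 : ∑ i, φ w i ^ 2 ≤ 2 := by
      by_cases h : w ∈ A
      · simp only [hφ, h, if_true]
        have := (abs_le.1 (show |∑ j, wDev c w j ^ 2 - 1| ≤ 1 from h)).2
        linarith
      · simp [hφ, h]
    have h0 : 0 ≤ ∑ i, φ w i ^ 2 := Finset.sum_nonneg fun i _ => sq_nonneg _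
    have h0' : 0 ≤ ∑ i, v i ^ 2 := Finset.sum_nonneg fun i _ => sq_nonneg _
    nlinarith
  have hint : Integrable (fun w => (∑ i, φ w i * v i) ^ 2) ν :=
    Integrable.of_bound (C := 4) (hsm.pow_const 2).aestronglyMeasurable
      (.of_forall fun w => by
        rw [Real.norm_eq_abs, abs_of_nonneg (sq_nonneg _)]
        exact hcs w)
  have hm := mul_meas_ge_le_integral_of_nonneg (μ := ν)
    (f := fun w => (∑ i, φ w i * v i) ^ 2) (.of_forall fun w => sq_nonneg _) hint (δ ^ 2)
  have hle : ν.real {w | δ ^ 2 ≤ (∑ i, φ w i * v i) ^ 2} ≤ 8 / n / δ ^ 2 := by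
    rw [le_div_iff₀ (by positivity), mul_comm]
    refine hm.trans (key.trans ?_)
    have : (0 : ℝ) < n := by
      have : 0 < n := by omega
      exact_mod_cast this
    rw [div_mul_eq_mul_div]
    gcongr
    linarith
  refine (measure_mono fun w hw => ?_).trans (ENNReal.le_ofReal_iff_toReal_le
    (measure_ne_top _ _) (by positivity) |>.2 hle)
  have hwA : w ∈ A := hw.1
  simp only [Set.mem_ofPred_eq, hφ, hwA, if_true]
  rw [← sq_abs (∑ i, wDev c w i * v i)]
  exact pow_le_pow_left₀ hδ.le hw.2.le 2

/-- Two independent copies of the scaled centered weights are nearly orthonormal, with probability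
tending to one. -/
lemma tendsto_nearlyOrthogonal_wDev {ν : ∀ n : ℕ, Measure (Fin n → ℝ)} {c : ℝ} (hc : 0 < c)
    (hν : IsWeightLaw ν c) {δ : ℝ} (hδ : 0 < δ) :
    Tendsto (fun n => ((ν n).prod (ν n))
      {q | ¬ NearlyOrthogonal δ 1 1 (wDev c q.1) (wDev c q.2)}) atTop (𝓝 0) := by
  have := hν.prob
  -- The cap at `1` keeps the sums of squares below `2`, as the cross-product bound requires.
  set δ' := min δ 1 with hδ'
  have hδ0 : 0 < δ' := by positivity
  set E : ∀ n, Set (Fin n → ℝ) :=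
    fun n => {w | ¬ ((∀ j, |wDev c w j| ≤ δ') ∧ |∑ j, wDev c w j ^ 2 - 1| ≤ δ')} with hE
  have hE0 : Tendsto (fun n => ν n (E n)) atTop (𝓝 0) := tendsto_measure_wDev hc hν hδ0
  set G : ∀ n, Set ((Fin n → ℝ) × (Fin n → ℝ)) := fun n =>
    {q | |∑ j, wDev c q.1 j ^ 2 - 1| ≤ 1 ∧ |∑ j, wDev c q.2 j ^ 2 - 1| ≤ 1 ∧
      δ < |∑ j, wDev c q.1 j * wDev c q.2 j|} with hG
  have hmw : ∀ n (j : Fin n), Measurable fun w : Fin n → ℝ => wDev c w j := fun n j =>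
    (measurable_pi_apply j).comp (measurable_wDev c)
  have hGm : ∀ n, MeasurableSet (G n) := fun n => by
    have m1 : Measurable fun q : (Fin n → ℝ) × (Fin n → ℝ) => |∑ j, wDev c q.1 j ^ 2 - 1| :=
      continuous_abs.measurable.comp ((Finset.measurable_sum _ fun j _ =>
        ((hmw n j).comp measurable_fst).pow_const 2).sub_const 1)
    have m2 : Measurable fun q : (Fin n → ℝ) × (Fin n → ℝ) => |∑ j, wDev c q.2 j ^ 2 - 1| :=
      continuous_abs.measurable.comp ((Finset.measurable_sum _ fun j _ =>
        ((hmw n j).comp measurable_snd).pow_const 2).sub_const 1)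
    have m3 : Measurable fun q : (Fin n → ℝ) × (Fin n → ℝ) =>
        |∑ j, wDev c q.1 j * wDev c q.2 j| :=
      continuous_abs.measurable.comp (Finset.measurable_sum _ fun j _ =>
        ((hmw n j).comp measurable_fst).mul ((hmw n j).comp measurable_snd))
    exact (measurableSet_le m1 measurable_const).inter
      ((measurableSet_le m2 measurable_const).inter (measurableSet_lt measurable_const m3))
  have hGle : ∀ n, 2 ≤ n → ((ν n).prod (ν n)) (G n) ≤ ENNReal.ofReal (8 / n / δ ^ 2) :=
    fun n hn => by
      -- With the second copy frozen, its scaled deviations serve as the deterministic vector that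
      -- sums to zero.
      rw [Measure.prod_apply_symm (hGm n)]
      calc _ ≤ ∫⁻ _, ENNReal.ofReal (8 / n / δ ^ 2) ∂(ν n) := by
            refine lintegral_mono fun w' => ?_
            by_cases h : |∑ j, wDev c w' j ^ 2 - 1| ≤ 1
            · refine le_trans (measure_mono ?_) (measure_cross_le hn (hν.exchangeable n) c hδ
                (wDev c w') (sum_wDev c w') ?_)
              · exact fun w hw => ⟨hw.1, hw.2.2⟩
              · linarith [(abs_le.1 h).2]
            · have : (fun w => (w, w')) ⁻¹' G n = ∅ := by
                ext w
                simp [hG, h]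
              rw [this]
              simp
        _ = _ := by simp
  have hG0 : Tendsto (fun n => ((ν n).prod (ν n)) (G n)) atTop (𝓝 0) := by
    have ht : Tendsto (fun n : ℕ => ENNReal.ofReal (8 / n / δ ^ 2)) atTop (𝓝 0) := by
      rw [← ENNReal.ofReal_zero]
      refine ENNReal.tendsto_ofReal ?_
      simpa using (tendsto_const_div_atTop_nhds_zero_nat 8).div_const (δ ^ 2)
    refine tendsto_of_tendsto_of_tendsto_of_le_of_le' tendsto_const_nhds ht
      (.of_forall fun _ => zero_le) ?_
    filter_upwards [eventually_ge_atTop 2] with n hn using hGle n hn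
  have hsum := (hE0.add hE0).add hG0
  simp only [add_zero] at hsum
  refine tendsto_of_tendsto_of_tendsto_of_le_of_le tendsto_const_nhds hsum (fun _ => zero_le)
    fun n => ?_
  have hsub : {q : (Fin n → ℝ) × (Fin n → ℝ) |
      ¬ NearlyOrthogonal δ 1 1 (wDev c q.1) (wDev c q.2)}
      ⊆ ((E n) ×ˢ Set.univ ∪ Set.univ ×ˢ (E n)) ∪ G n := by
    intro q hq
    by_contra hcon
    simp only [Set.mem_union, Set.mem_prod, Set.mem_univ, and_true, true_and, not_or] at hcon
    obtain ⟨⟨h1, h2⟩, h3⟩ := hcon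
    simp only [hE, Set.mem_ofPred_eq, not_not] at h1 h2
    refine hq ⟨fun j => (h1.1 j).trans (min_le_left _ _), fun j => (h2.1 j).trans (min_le_left _ _),
      h1.2.trans (min_le_left _ _), h2.2.trans (min_le_left _ _), ?_⟩
    by_contra h4
    exact h3 ⟨h1.2.trans (min_le_right _ _), h2.2.trans (min_le_right _ _), not_le.1 h4⟩
  refine (measure_mono hsub).trans ((measure_union_le _ _).trans (add_le_add ?_ le_rfl))
  refine (measure_union_le _ _).trans (add_le_add ?_ ?_)
  · rw [Measure.prod_prod]; simp
  · rw [Measure.prod_prod]; simp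

lemma tendsto_nearlyOrthogonal_smul_wDev {ν : ∀ n : ℕ, Measure (Fin n → ℝ)} {c : ℝ} (hc : 0 < c)
    (hν : IsWeightLaw ν c) {N : ℕ → ℕ} (hN : Tendsto N atTop atTop) {s : ℕ → ℝ} {s₀ : ℝ}
    (hs : Tendsto s atTop (𝓝 s₀)) {δ : ℝ} (hδ : 0 < δ) :
    Tendsto (fun k => ((ν (N k)).prod (ν (N k)))
      {q | ¬ NearlyOrthogonal δ (s₀ ^ 2) (s₀ ^ 2) (s k • wDev c q.1) (s k • wDev c q.2)})
      atTop (𝓝 0) := by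
  set B := |s₀| + 1 with hB
  have hB1 : 1 ≤ B := by
    have := abs_nonneg s₀
    linarith
  -- Half of `δ` pays for the scaled deviations from orthonormality, the other half for `s k ^ 2 -
  -- s₀ ^ 2`.
  set δ₀ := δ / (2 * B ^ 2) with hδ₀
  have hδ₀pos : 0 < δ₀ := by positivity
  refine tendsto_of_tendsto_of_tendsto_of_le_of_le' tendsto_const_nhds
    ((tendsto_nearlyOrthogonal_wDev hc hν hδ₀pos).comp hN) (.of_forall fun _ => zero_le) ?_
  have e1 : ∀ᶠ k in atTop, |s k| < B :=
    (continuous_abs.tendsto s₀ |>.comp hs).eventually (gt_mem_nhds (by linarith))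
  have e2 : ∀ᶠ k in atTop, |s k ^ 2 - s₀ ^ 2| < δ / 2 := by
    have := (hs.pow 2)
    simpa [Real.dist_eq] using (Metric.tendsto_nhds.1 this) (δ / 2) (by positivity)
  filter_upwards [e1, e2] with k h1 h2
  refine measure_mono fun q hq => ?_
  contrapose! hq
  simp only [Set.mem_ofPred_eq, not_not] at hq ⊢
  obtain ⟨a1, a2, a3, a4, a5⟩ := hq
  have hBδ : B ^ 2 * δ₀ = δ / 2 := by rw [hδ₀]; field_simp
  have hs2 : s k ^ 2 ≤ B ^ 2 := by rw [← sq_abs]; exact pow_le_pow_left₀ (abs_nonneg _) h1.le 2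
  have k1 : ∀ x : ℝ, |x| ≤ δ₀ → |s k * x| ≤ δ := fun x hx => by
    rw [abs_mul]
    have : |s k| * |x| ≤ B ^ 2 * δ₀ :=
      mul_le_mul (h1.le.trans (by nlinarith)) hx (abs_nonneg _) (by positivity)
    linarith
  have k2 : ∀ x : ℝ, |x| ≤ δ₀ → |s k ^ 2 * x| ≤ δ / 2 := fun x hx => by
    rw [abs_mul, abs_of_nonneg (sq_nonneg _), ← hBδ]
    exact mul_le_mul hs2 hx (abs_nonneg _) (by positivity)
  have k3 : ∀ x : ℝ, |x - 1| ≤ δ₀ → |s k ^ 2 * x - s₀ ^ 2| ≤ δ := fun x hx => by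
    have h3 := k2 _ hx
    have : s k ^ 2 * x - s₀ ^ 2 = s k ^ 2 * (x - 1) + (s k ^ 2 - s₀ ^ 2) := by ring
    rw [this]
    exact (abs_add_le _ _).trans (by linarith)
  refine ⟨fun j => k1 _ (a1 j), fun j => k1 _ (a2 j), ?_, ?_, ?_⟩
  · simp only [Pi.smul_apply, smul_eq_mul, mul_pow, ← Finset.mul_sum]
    exact k3 _ a3
  · simp only [Pi.smul_apply, smul_eq_mul, mul_pow, ← Finset.mul_sum]
    exact k3 _ a4
  · have : ∀ j, (s k • wDev c q.1) j * (s k • wDev c q.2) j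
        = s k ^ 2 * (wDev c q.1 j * wDev c q.2 j) := fun j => by
      simp only [Pi.smul_apply, smul_eq_mul]; ring
    simp_rw [this, ← Finset.mul_sum]
    exact (k2 _ a5).trans (by linarith)

end

section

/-! ### A two-sample central limit theorem for pairs of randomly weighted sums -/

/-- Bounded convergence in probability on changing spaces; a measurable hull of the exceptional
event makes it integrable. -/
lemma tendsto_integral_of_tendsto_measure {T : ℕ → Type*} [∀ k, MeasurableSpace (T k)]
    (Q : ∀ k, Measure (T k)) [∀ k, IsProbabilityMeasure (Q k)] (f : ∀ k, T k → ℂ) (L : ℂ)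
    (hf : ∀ k, AEStronglyMeasurable (f k) (Q k)) (hf1 : ∀ k t, ‖f k t‖ ≤ 1) (hL : ‖L‖ ≤ 1)
    (h : ∀ ε : ℝ, 0 < ε → Tendsto (fun k => Q k {t | ε < ‖f k t - L‖}) atTop (𝓝 0)) :
    Tendsto (fun k => ∫ t, f k t ∂(Q k)) atTop (𝓝 L) := by
  rw [Metric.tendsto_nhds]
  intro ε hε
  have h1 := (ENNReal.tendsto_nhds_zero.1 (h (ε / 4) (by positivity)))
    (ENNReal.ofReal (ε / 8)) (by simpa using hε)
  filter_upwards [h1] with k hk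
  set B := toMeasurable (Q k) {t | ε / 4 < ‖f k t - L‖} with hB
  have hBm : MeasurableSet B := measurableSet_toMeasurable _ _
  have hBr : (Q k).real B ≤ ε / 8 := by
    rw [Measure.real, hB, measure_toMeasurable]
    exact ENNReal.toReal_le_of_le_ofReal (by positivity) hk
  have hi : Integrable (f k) (Q k) := Integrable.of_bound (hf k) 1 (.of_forall (hf1 k))
  have e1 : ∫ t, f k t ∂(Q k) - L = ∫ t, (f k t - L) ∂(Q k) := by
    rw [integral_sub hi (integrable_const _)]
    simp
  have e2 : ∀ t, ‖f k t - L‖ ≤ ε / 4 + B.indicator (fun _ => (2 : ℝ)) t := fun t => by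
    by_cases ht : t ∈ B
    · rw [Set.indicator_of_mem ht]
      have := (norm_sub_le (f k t) L).trans (add_le_add (hf1 k t) hL)
      linarith
    · rw [Set.indicator_of_notMem ht, add_zero]
      by_contra hcon
      exact ht (subset_toMeasurable _ _ (not_le.1 hcon))
  have hint : Integrable (fun t => ε / 4 + B.indicator (fun _ => (2 : ℝ)) t) (Q k) :=
    (integrable_const _).add ((integrable_const _).indicator hBm)
  rw [dist_eq_norm, e1]
  refine (norm_integral_le_of_norm_le hint (.of_forall e2)).trans_lt ?_
  rw [integral_add (integrable_const _) ((integrable_const _).indicator hBm),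
    integral_indicator_const _ hBm]
  simp only [integral_const, probReal_univ, smul_eq_mul, one_mul]
  linarith

/-! ### Gram matrices, vectors of weighted sums and their Gaussian limit law. -/

variable {𝒳 : Type*} [MeasurableSpace 𝒳] {ι : Type*} [Fintype ι]

/-- The Gram matrix of a family of functions. -/
def gramMat (P : Measure 𝒳) (g : ι → 𝒳 → ℝ) : Matrix ι ι ℝ :=
  Matrix.of fun i j => ∫ y, g i y * g j y ∂P

/-- The linear combination of a family of functions. -/
def linComb (g : ι → 𝒳 → ℝ) (θ : ι → ℝ) (y : 𝒳) : ℝ := ∑ i, θ i * g i y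

lemma memLp_linComb {P : Measure 𝒳} {g : ι → 𝒳 → ℝ} (hg : ∀ i, MemLp (g i) 2 P) (θ : ι → ℝ) :
    MemLp (linComb g θ) 2 P :=
  memLp_finsetSum _ fun i _ => (hg i).const_mul (θ i)

lemma integral_linComb {P : Measure 𝒳} [IsProbabilityMeasure P] {g : ι → 𝒳 → ℝ}
    (hg : ∀ i, MemLp (g i) 2 P) (h0 : ∀ i, ∫ y, g i y ∂P = 0) (θ : ι → ℝ) :
    ∫ y, linComb g θ y ∂P = 0 := by
  simp only [linComb]
  rw [integral_finsetSum _ fun i _ => ((hg i).integrable (by norm_num)).const_mul _]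
  simp [integral_const_mul, h0]

lemma dotProduct_gramMat {P : Measure 𝒳} {g : ι → 𝒳 → ℝ} (hg : ∀ i, MemLp (g i) 2 P)
    (θ : ι → ℝ) : θ ⬝ᵥ (gramMat P g).mulVec θ = ∫ y, linComb g θ y ^ 2 ∂P := by
  have h1 : ∀ y, linComb g θ y ^ 2 = ∑ i, ∑ j, θ i * θ j * (g i y * g j y) := fun y => by
    rw [linComb, sq, Finset.sum_mul_sum]
    exact Finset.sum_congr rfl fun i _ => Finset.sum_congr rfl fun j _ => by ring
  have hi : ∀ i j, Integrable (fun y => g i y * g j y) P := fun i j => (hg i).integrable_mul (hg j)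
  simp_rw [h1]
  rw [integral_finsetSum _ fun i _ => integrable_finsetSum _ fun j _ => (hi i j).const_mul _]
  simp only [dotProduct, Matrix.mulVec, gramMat, Matrix.of_apply, Finset.mul_sum]
  refine Finset.sum_congr rfl fun i _ => ?_
  rw [integral_finsetSum _ fun j _ => (hi i j).const_mul _]
  refine Finset.sum_congr rfl fun j _ => ?_
  rw [integral_const_mul]
  ring

lemma posSemidef_gramMat {P : Measure 𝒳} {g : ι → 𝒳 → ℝ} (hg : ∀ i, MemLp (g i) 2 P) :
    (gramMat P g).PosSemidef := by
  refine Matrix.PosSemidef.of_dotProduct_mulVec_nonneg ?_ fun θ => ?_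
  · ext i j
    simp [gramMat, Matrix.conjTranspose_apply, mul_comm]
  · rw [star_trivial, dotProduct_gramMat hg]
    exact integral_nonneg fun y => sq_nonneg _

/-- The covariance matrix of the two-sample limit. -/
def limCov (Pa Pb : Measure 𝒳) (ga gb : ι → 𝒳 → ℝ) (p q : ℝ) : Matrix ι ι ℝ :=
  p • gramMat Pa ga + q • gramMat Pb gb

lemma posSemidef_limCov {Pa Pb : Measure 𝒳} {ga gb : ι → 𝒳 → ℝ}
    (hga : ∀ i, MemLp (ga i) 2 Pa) (hgb : ∀ i, MemLp (gb i) 2 Pb) {p q : ℝ} (hp : 0 ≤ p)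
    (hq : 0 ≤ q) : (limCov Pa Pb ga gb p q).PosSemidef :=
  ((posSemidef_gramMat hga).smul hp).add ((posSemidef_gramMat hgb).smul hq)

/-- The vector of two-sample weighted sums. -/
def vecSum {n m : ℕ} (ga gb : ι → 𝒳 → ℝ) (ua : Fin n → ℝ) (ub : Fin m → ℝ) (xa : Fin n → 𝒳)
    (xb : Fin m → 𝒳) : EuclideanSpace ℝ ι :=
  WithLp.toLp 2 fun i => wSum ua xa (ga i) + wSum ub xb (gb i)

lemma sum_mul_wSum {𝒳 : Type*} {n : ℕ} (g : ι → 𝒳 → ℝ) (u : Fin n → ℝ) (x : Fin n → 𝒳) (θ : ι → ℝ) :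
    ∑ i, θ i * wSum u x (g i) = wSum u x (linComb g θ) := by
  simp only [wSum, linComb, Finset.mul_sum]
  rw [Finset.sum_comm]
  exact Finset.sum_congr rfl fun j _ => Finset.sum_congr rfl fun i _ => by ring

lemma inner_vecSum {𝒳 : Type*} {n m : ℕ} (ga gb : ι → 𝒳 → ℝ) (ua : Fin n → ℝ) (ub : Fin m → ℝ)
    (xa : Fin n → 𝒳) (xb : Fin m → 𝒳) (θ : EuclideanSpace ℝ ι) :
    inner ℝ (vecSum ga gb ua ub xa xb) θ = wSum ua xa (linComb ga θ) + wSum ub xb (linComb gb θ) := by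
  rw [← sum_mul_wSum, ← sum_mul_wSum, ← Finset.sum_add_distrib]
  simp [vecSum, PiLp.inner_apply, mul_add]

lemma measurable_vecSum {ι : Type*} {S : Type*} [MeasurableSpace S] {n m : ℕ} {ga gb : ι → 𝒳 → ℝ}
    (hga : ∀ i, Measurable (ga i)) (hgb : ∀ i, Measurable (gb i)) {ua : S → Fin n → ℝ}
    {ub : S → Fin m → ℝ} {xa : S → Fin n → 𝒳} {xb : S → Fin m → 𝒳} (hua : Measurable ua)
    (hub : Measurable ub) (hxa : Measurable xa) (hxb : Measurable xb) :
    Measurable fun s => vecSum ga gb (ua s) (ub s) (xa s) (xb s) := by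
  unfold vecSum wSum
  refine (WithLp.measurable_toLp 2 _).comp (measurable_pi_lambda _ fun i => ?_)
  refine Measurable.add ?_ ?_
  · exact Finset.measurable_sum _ fun j _ => ((measurable_pi_apply j).comp hua).mul
      ((hga i).comp ((measurable_pi_apply j).comp hxa))
  · exact Finset.measurable_sum _ fun j _ => ((measurable_pi_apply j).comp hub).mul
      ((hgb i).comp ((measurable_pi_apply j).comp hxb))

variable [DecidableEq ι]

/-- The Gaussian limit law of the two-sample weighted sums. -/
def limLaw (Pa Pb : Measure 𝒳) (ga gb : ι → 𝒳 → ℝ) (p q : ℝ) : Measure (EuclideanSpace ℝ ι) :=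
  multivariateGaussian 0 (limCov Pa Pb ga gb p q)

instance (Pa Pb : Measure 𝒳) (ga gb : ι → 𝒳 → ℝ) (p q : ℝ) :
    IsProbabilityMeasure (limLaw Pa Pb ga gb p q) := by
  unfold limLaw
  infer_instance

lemma charFun_limLaw {Pa Pb : Measure 𝒳} {ga gb : ι → 𝒳 → ℝ}
    (hga : ∀ i, MemLp (ga i) 2 Pa) (hgb : ∀ i, MemLp (gb i) 2 Pb) {p q : ℝ} (hp : 0 ≤ p)
    (hq : 0 ≤ q) (θ : EuclideanSpace ℝ ι) :
    charFun (limLaw Pa Pb ga gb p q) θ = Complex.exp (-(((∫ y, linComb ga θ y ^ 2 ∂Pa) * p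
      + (∫ y, linComb gb θ y ^ 2 ∂Pb) * q : ℝ) : ℂ) / 2) := by
  rw [limLaw, charFun_multivariateGaussian (posSemidef_limCov hga hgb hp hq)]
  congr 1
  have : (θ.ofLp ⬝ᵥ (limCov Pa Pb ga gb p q).mulVec θ.ofLp)
      = (∫ y, linComb ga θ y ^ 2 ∂Pa) * p + (∫ y, linComb gb θ y ^ 2 ∂Pb) * q := by
    rw [limCov, Matrix.add_mulVec, dotProduct_add, Matrix.smul_mulVec, Matrix.smul_mulVec,
      dotProduct_smul, dotProduct_smul, dotProduct_gramMat hga, dotProduct_gramMat hgb]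
    simp [mul_comm]
  rw [← this]
  simp [neg_div]

lemma norm_integral_exp_mul_I_le_one {S : Type*} [MeasurableSpace S] (μ : Measure S)
    [IsProbabilityMeasure μ] (f : S → ℝ) : ‖∫ s, Complex.exp (f s * Complex.I) ∂μ‖ ≤ 1 := by
  refine (norm_integral_le_of_norm_le_const (C := 1) (.of_forall fun y => ?_)).trans (by simp)
  rw [Complex.norm_exp_ofReal_mul_I]

lemma norm_exp_neg_half_le_one {s : ℝ} (hs : 0 ≤ s) : ‖Complex.exp (-(s : ℂ) / 2)‖ ≤ 1 := by
  rw [Complex.norm_exp]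
  refine Real.exp_le_one_iff.2 ?_
  rw [← Complex.ofReal_neg, Complex.div_ofNat_re, Complex.ofReal_re]
  linarith

/-- Two-sample sums with two nearly orthogonal systems of random weights converge jointly to
independent Gaussian vectors. -/
theorem tendsto_integral_vecSum_pair (Pa Pb : Measure 𝒳) [IsProbabilityMeasure Pa]
    [IsProbabilityMeasure Pb] {ga gb : ι → 𝒳 → ℝ}
    (mga : ∀ i, Measurable (ga i)) (mgb : ∀ i, Measurable (gb i))
    (hga : ∀ i, MemLp (ga i) 2 Pa) (hgb : ∀ i, MemLp (gb i) 2 Pb)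
    (h0a : ∀ i, ∫ y, ga i y ∂Pa = 0) (h0b : ∀ i, ∫ y, gb i y ∂Pb = 0)
    {na nb : ℕ → ℕ} {T : ℕ → Type*} [∀ k, MeasurableSpace (T k)]
    (Q : ∀ k, Measure (T k)) [∀ k, IsProbabilityMeasure (Q k)]
    (ua ua' : ∀ k, T k → Fin (na k) → ℝ) (ub ub' : ∀ k, T k → Fin (nb k) → ℝ)
    (mua : ∀ k, Measurable (ua k)) (mua' : ∀ k, Measurable (ua' k))
    (mub : ∀ k, Measurable (ub k)) (mub' : ∀ k, Measurable (ub' k))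
    {p p' q q' : ℝ} (hp : 0 ≤ p) (hp' : 0 ≤ p') (hq : 0 ≤ q) (hq' : 0 ≤ q')
    (ha : ∀ δ : ℝ, 0 < δ → Tendsto
      (fun k => Q k {t | ¬ NearlyOrthogonal δ p p' (ua k t) (ua' k t)}) atTop (𝓝 0))
    (hb : ∀ δ : ℝ, 0 < δ → Tendsto
      (fun k => Q k {t | ¬ NearlyOrthogonal δ q q' (ub k t) (ub' k t)}) atTop (𝓝 0))
    (φ φ' : EuclideanSpace ℝ ι →ᵇ ℝ) :
    Tendsto (fun k => ∫ z : ((Fin (na k) → 𝒳) × (Fin (nb k) → 𝒳)) × T k,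
        φ (vecSum ga gb (ua k z.2) (ub k z.2) z.1.1 z.1.2)
          * φ' (vecSum ga gb (ua' k z.2) (ub' k z.2) z.1.1 z.1.2)
        ∂(((Measure.pi fun _ => Pa).prod (Measure.pi fun _ => Pb)).prod (Q k))) atTop
      (𝓝 ((∫ z, φ z ∂(limLaw Pa Pb ga gb p q)) * ∫ z, φ' z ∂(limLaw Pa Pb ga gb p' q'))) := by
  set X : ∀ k, Measure ((Fin (na k) → 𝒳) × (Fin (nb k) → 𝒳)) :=
    fun k => (Measure.pi fun _ => Pa).prod (Measure.pi fun _ => Pb) with hX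
  set V : ∀ k, ((Fin (na k) → 𝒳) × (Fin (nb k) → 𝒳)) × T k → EuclideanSpace ℝ ι :=
    fun k z => vecSum ga gb (ua k z.2) (ub k z.2) z.1.1 z.1.2 with hV
  set V' : ∀ k, ((Fin (na k) → 𝒳) × (Fin (nb k) → 𝒳)) × T k → EuclideanSpace ℝ ι :=
    fun k z => vecSum ga gb (ua' k z.2) (ub' k z.2) z.1.1 z.1.2 with hV'
  have mV : ∀ k, Measurable (V k) := fun k =>
    measurable_vecSum mga mgb ((mua k).comp measurable_snd) ((mub k).comp measurable_snd)
      (measurable_fst.comp measurable_fst) (measurable_snd.comp measurable_fst)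
  have mV' : ∀ k, Measurable (V' k) := fun k =>
    measurable_vecSum mga mgb ((mua' k).comp measurable_snd) ((mub' k).comp measurable_snd)
      (measurable_fst.comp measurable_fst) (measurable_snd.comp measurable_fst)
  set J : ∀ k, ((Fin (na k) → 𝒳) × (Fin (nb k) → 𝒳)) × T k →
      WithLp 2 (EuclideanSpace ℝ ι × EuclideanSpace ℝ ι) :=
    fun k z => WithLp.toLp 2 (V k z, V' k z) with hJ
  have mJ : ∀ k, Measurable (J k) := fun k =>
    (WithLp.measurable_toLp 2 _).comp ((mV k).prodMk (mV' k))
  let ρ : ℕ → ProbabilityMeasure (WithLp 2 (EuclideanSpace ℝ ι × EuclideanSpace ℝ ι)) :=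
    fun k => ⟨((X k).prod (Q k)).map (J k), Measure.isProbabilityMeasure_map (mJ k).aemeasurable⟩
  let ρ₀ : ProbabilityMeasure (WithLp 2 (EuclideanSpace ℝ ι × EuclideanSpace ℝ ι)) :=
    ⟨((limLaw Pa Pb ga gb p q).prod (limLaw Pa Pb ga gb p' q')).map (WithLp.toLp 2),
      Measure.isProbabilityMeasure_map (WithLp.measurable_toLp 2 _).aemeasurable⟩
  -- Lévy's continuity theorem for the pair of vectors.
  have hconv : Tendsto ρ atTop (𝓝 ρ₀) := by
    refine ProbabilityMeasure.tendsto_of_tendsto_charFun fun τ => ?_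
    obtain ⟨θ, θ'⟩ := τ
    have hρ₀ : charFun (ρ₀ : Measure _) (WithLp.toLp 2 (θ, θ'))
        = Complex.exp (-(((∫ y, linComb ga θ y ^ 2 ∂Pa) * p
            + (∫ y, linComb ga θ' y ^ 2 ∂Pa) * p' : ℝ) : ℂ) / 2)
          * Complex.exp (-(((∫ y, linComb gb θ y ^ 2 ∂Pb) * q
            + (∫ y, linComb gb θ' y ^ 2 ∂Pb) * q' : ℝ) : ℂ) / 2) := by
      change charFun (((limLaw Pa Pb ga gb p q).prod (limLaw Pa Pb ga gb p' q')).map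
        (WithLp.toLp 2)) (WithLp.toLp 2 (θ, θ')) = _
      rw [charFun_prod, charFun_limLaw hga hgb hp hq, charFun_limLaw hga hgb hp' hq',
        ← Complex.exp_add, ← Complex.exp_add]
      congr 1
      push_cast
      ring
    set Fa : ∀ k, T k → ℂ := fun k t =>
      ∫ x, Complex.exp (((wSum (ua k t) x (linComb ga θ) + wSum (ua' k t) x (linComb ga θ') : ℝ)
        : ℂ) * Complex.I) ∂(Measure.pi fun _ : Fin (na k) => Pa) with hFa
    set Fb : ∀ k, T k → ℂ := fun k t =>
      ∫ x, Complex.exp (((wSum (ub k t) x (linComb gb θ) + wSum (ub' k t) x (linComb gb θ') : ℝ)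
        : ℂ) * Complex.I) ∂(Measure.pi fun _ : Fin (nb k) => Pb) with hFb
    set F : ∀ k, ((Fin (na k) → 𝒳) × (Fin (nb k) → 𝒳)) × T k → ℂ := fun k z =>
      Complex.exp (((inner ℝ (V k z) θ + inner ℝ (V' k z) θ' : ℝ) : ℂ) * Complex.I) with hF
    have mF : ∀ k, Measurable (F k) := fun k => by
      have h1 : Measurable fun z => inner ℝ (V k z) θ := (mV k).inner_const
      have h2 : Measurable fun z => inner ℝ (V' k z) θ' := (mV' k).inner_const
      simp only [hF]
      fun_prop
    have iF : ∀ k, Integrable (F k) ((X k).prod (Q k)) := fun k =>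
      Integrable.of_bound (mF k).aestronglyMeasurable 1
        (.of_forall fun z => by simp only [hF]; rw [Complex.norm_exp_ofReal_mul_I])
    -- Given the weights, the samples are independent, so the one-sample bounds apply to each
    -- factor; they hold for every weight realization in the nearly orthogonal event.
    have hFab : ∀ k t, ∫ x, F k (x, t) ∂(X k) = Fa k t * Fb k t := fun k t => by
      simp only [hFa, hFb, hX]
      rw [← integral_prod_mul]
      congr 1
      ext x
      simp only [hF, hV, hV', inner_vecSum]
      rw [← Complex.exp_add]
      congr 1
      push_cast
      ring
    have hρ : ∀ k, charFun (ρ k : Measure _) (WithLp.toLp 2 (θ, θ'))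
        = ∫ t, Fa k t * Fb k t ∂(Q k) := fun k => by
      change charFun (((X k).prod (Q k)).map (J k)) _ = _
      rw [charFun_apply, integral_map (mJ k).aemeasurable (by fun_prop)]
      simp only [hJ, WithLp.prod_inner_apply]
      rw [integral_prod_symm _ (iF k)]
      exact integral_congr_ae (.of_forall fun t => hFab k t)
    simp_rw [hρ, hρ₀]
    have nA : 0 ≤ (∫ y, linComb ga θ y ^ 2 ∂Pa) * p + (∫ y, linComb ga θ' y ^ 2 ∂Pa) * p' :=
      add_nonneg (mul_nonneg (integral_nonneg fun y => sq_nonneg _) hp)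
        (mul_nonneg (integral_nonneg fun y => sq_nonneg _) hp')
    have nB : 0 ≤ (∫ y, linComb gb θ y ^ 2 ∂Pb) * q + (∫ y, linComb gb θ' y ^ 2 ∂Pb) * q' :=
      add_nonneg (mul_nonneg (integral_nonneg fun y => sq_nonneg _) hq)
        (mul_nonneg (integral_nonneg fun y => sq_nonneg _) hq')
    set La := Complex.exp (-(((∫ y, linComb ga θ y ^ 2 ∂Pa) * p
            + (∫ y, linComb ga θ' y ^ 2 ∂Pa) * p' : ℝ) : ℂ) / 2)
    set Lb := Complex.exp (-(((∫ y, linComb gb θ y ^ 2 ∂Pb) * q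
            + (∫ y, linComb gb θ' y ^ 2 ∂Pb) * q' : ℝ) : ℂ) / 2)
    have nLa : ‖La‖ ≤ 1 := norm_exp_neg_half_le_one nA
    have nLb : ‖Lb‖ ≤ 1 := norm_exp_neg_half_le_one nB
    have nFa : ∀ k t, ‖Fa k t‖ ≤ 1 := fun k t => norm_integral_exp_mul_I_le_one _ _
    have nFb : ∀ k t, ‖Fb k t‖ ≤ 1 := fun k t => norm_integral_exp_mul_I_le_one _ _
    refine tendsto_integral_of_tendsto_measure Q _ _ (fun k => ?_) (fun k t => ?_) ?_ fun ε hε => ?_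
    · have := (iF k).integral_prod_right.1
      simpa only [hFab] using this
    · rw [norm_mul]
      exact mul_le_one₀ (nFa k t) (norm_nonneg _) (nFb k t)
    · rw [norm_mul]
      exact mul_le_one₀ nLa (norm_nonneg _) nLb
    · obtain ⟨δa, hδa, Ha⟩ := exists_charFun_pair_le (memLp_linComb hga θ) (memLp_linComb hga θ')
        (integral_linComb hga h0a θ) (integral_linComb hga h0a θ') p p' (half_pos hε)
      obtain ⟨δb, hδb, Hb⟩ := exists_charFun_pair_le (memLp_linComb hgb θ) (memLp_linComb hgb θ')
        (integral_linComb hgb h0b θ) (integral_linComb hgb h0b θ') q q' (half_pos hε)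
      have hsum := (ha δa hδa).add (hb δb hδb)
      rw [add_zero] at hsum
      refine tendsto_of_tendsto_of_tendsto_of_le_of_le tendsto_const_nhds hsum (fun _ => zero_le)
        fun k => (measure_mono fun t ht => ?_).trans (measure_union_le _ _)
      by_contra hcon
      simp only [Set.mem_union, Set.mem_ofPred_eq, not_or, not_not] at hcon
      have b1 : ‖Fa k t - La‖ ≤ ε / 2 := Ha _ _ _ hcon.1.1 hcon.1.2.1 hcon.1.2.2.1
        hcon.1.2.2.2.1 hcon.1.2.2.2.2
      have b2 : ‖Fb k t - Lb‖ ≤ ε / 2 := Hb _ _ _ hcon.2.1 hcon.2.2.1 hcon.2.2.2.1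
        hcon.2.2.2.2.1 hcon.2.2.2.2.2
      have b3 : Fa k t * Fb k t - La * Lb = (Fa k t - La) * Fb k t + La * (Fb k t - Lb) := by ring
      have b4 : ‖Fa k t * Fb k t - La * Lb‖ ≤ ε := by
        rw [b3]
        refine (norm_add_le _ _).trans ?_
        rw [norm_mul, norm_mul]
        have := mul_le_of_le_one_right (norm_nonneg (Fa k t - La)) (nFb k t)
        have := mul_le_of_le_one_left (norm_nonneg (Fb k t - Lb)) nLa
        linarith
      exact absurd ht (not_lt.2 b4)
  let Φ : WithLp 2 (EuclideanSpace ℝ ι × EuclideanSpace ℝ ι) →ᵇ ℝ :=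
    (φ.compContinuous ⟨fun z => z.fst, by fun_prop⟩)
      * (φ'.compContinuous ⟨fun z => z.snd, by fun_prop⟩)
  have hΦ := (ProbabilityMeasure.tendsto_iff_forall_integral_tendsto.1 hconv) Φ
  have e1 : ∫ z, Φ z ∂(ρ₀ : Measure _)
      = (∫ z, φ z ∂(limLaw Pa Pb ga gb p q)) * ∫ z, φ' z ∂(limLaw Pa Pb ga gb p' q') := by
    change ∫ z, Φ z ∂(((limLaw Pa Pb ga gb p q).prod (limLaw Pa Pb ga gb p' q')).map
        (WithLp.toLp 2)) = _
    rw [integral_map (WithLp.measurable_toLp 2 _).aemeasurable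
      Φ.continuous.measurable.aestronglyMeasurable, ← integral_prod_mul]
    rfl
  have e2 : ∀ k, ∫ z, Φ z ∂(ρ k : Measure _) = ∫ z, φ (V k z) * φ' (V' k z)
      ∂((X k).prod (Q k)) := fun k => by
    change ∫ z, Φ z ∂(((X k).prod (Q k)).map (J k)) = _
    rw [integral_map (mJ k).aemeasurable Φ.continuous.measurable.aestronglyMeasurable]
    rfl
  rw [e1] at hΦ
  simp_rw [e2] at hΦ
  exact hΦ

end

section

/-! ### Anti-concentration of maxima of correlated Gaussian vectors -/

lemma gaussianReal_le_volume (s : Set ℝ) : gaussianReal 0 1 s ≤ volume s := by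
  rw [gaussianReal_apply _ one_ne_zero]
  calc _ ≤ ∫⁻ _ in s, 1 := by
        refine lintegral_mono fun x => ?_
        rw [gaussianPDF, ← ENNReal.ofReal_one]
        refine ENNReal.ofReal_le_ofReal ?_
        rw [gaussianPDFReal]
        refine mul_le_one₀ (inv_le_one_of_one_le₀ ?_) (Real.exp_pos _).le
          (Real.exp_le_one_iff.2 ?_)
        · rw [Real.one_le_sqrt]
          simp only [NNReal.coe_one, mul_one]
          nlinarith [Real.pi_gt_three]
        · have : 0 ≤ (x - 0) ^ 2 / (2 * ((1 : ℝ≥0) : ℝ)) := by positivity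
          rw [neg_div]
          linarith
    _ = volume s := by simp

variable {ι : Type*} [Fintype ι] [DecidableEq ι]

/-- A Gaussian vector is the sum of its regression on a standardized coordinate and of an
independent remainder. -/
lemma multivariateGaussian_eq_map_prod {S : Matrix ι ι ℝ} (hS : S.PosSemidef) (i₀ : ι)
    (h1 : S i₀ i₀ = 1) :
    ((gaussianReal 0 1).prod ((multivariateGaussian 0 S).map
      fun z : EuclideanSpace ℝ ι => z - z i₀ • WithLp.toLp 2 fun i => S i i₀)).map
        (fun q : ℝ × EuclideanSpace ℝ ι => (q.1 • WithLp.toLp 2 fun i => S i i₀) + q.2)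
      = multivariateGaussian 0 S := by
  set v : EuclideanSpace ℝ ι := WithLp.toLp 2 fun i => S i i₀ with hv
  set γ := multivariateGaussian 0 S with hγ
  have mR : Measurable fun z : EuclideanSpace ℝ ι => z - z i₀ • v := by fun_prop
  have mq : Measurable fun q : ℝ × EuclideanSpace ℝ ι => q.1 • v + q.2 := by fun_prop
  have : IsProbabilityMeasure (γ.map fun z : EuclideanSpace ℝ ι => z - z i₀ • v) :=
    Measure.isProbabilityMeasure_map mR.aemeasurable
  have : IsProbabilityMeasure (((gaussianReal 0 1).prod (γ.map
      fun z : EuclideanSpace ℝ ι => z - z i₀ • v)).map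
        fun q : ℝ × EuclideanSpace ℝ ι => q.1 • v + q.2) :=
    Measure.isProbabilityMeasure_map mq.aemeasurable
  refine Measure.ext_of_charFun (funext fun θ => ?_)
  set r : ℝ := inner ℝ v θ with hr
  set θ' : EuclideanSpace ℝ ι := θ - r • EuclideanSpace.single i₀ (1 : ℝ) with hθ'
  have e1 : charFun (((gaussianReal 0 1).prod (γ.map
      fun z : EuclideanSpace ℝ ι => z - z i₀ • v)).map
        fun q : ℝ × EuclideanSpace ℝ ι => q.1 • v + q.2) θ
      = charFun (gaussianReal 0 1) r * charFun γ θ' := by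
    rw [charFun_apply, integral_map mq.aemeasurable (by fun_prop), charFun_apply_real,
      charFun_apply]
    have h2 : ∫ z, Complex.exp (((inner ℝ z θ' : ℝ) : ℂ) * Complex.I) ∂γ
        = ∫ z, Complex.exp (((inner ℝ z θ : ℝ) : ℂ) * Complex.I)
          ∂(γ.map fun z : EuclideanSpace ℝ ι => z - z i₀ • v) := by
      rw [integral_map mR.aemeasurable (by fun_prop)]
      congr 1
      ext z
      congr 3
      rw [hθ', inner_sub_right, inner_sub_left, inner_smul_left, inner_smul_right,
        EuclideanSpace.inner_single_right]
      simp [hr, mul_comm]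
    rw [h2, ← integral_prod_mul]
    congr 1
    ext q
    rw [← Complex.exp_add, inner_add_left, inner_smul_left]
    congr 1
    simp only [hr]
    push_cast
    simp
    ring
  have hsymm : ∀ i j, S i j = S j i := fun i j => by
    have := hS.1.apply j i
    simpa using this
  have hr1 : ∑ j, S i₀ j * θ j = r := by
    simp only [hr, hv, PiLp.inner_apply]
    exact Finset.sum_congr rfl fun j _ => by simp [hsymm i₀ j, mul_comm]
  -- The missing `r ^ 2` is exactly the exponent contributed by the standard normal factor.
  have hquad : θ'.ofLp ⬝ᵥ S.mulVec θ'.ofLp = θ.ofLp ⬝ᵥ S.mulVec θ.ofLp - r ^ 2 := by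
    have hs : θ'.ofLp = θ.ofLp - r • Pi.single i₀ 1 := by
      ext i
      simp [hθ', Pi.single_apply]
    have m1 : S.mulVec θ.ofLp i₀ = r := by
      rw [← hr1]; rfl
    have m2 : θ.ofLp ⬝ᵥ S.mulVec (Pi.single i₀ 1) = r := by
      rw [Matrix.mulVec_single_one, ← hr1, dotProduct]
      exact Finset.sum_congr rfl fun j _ => by simp [hsymm j i₀, mul_comm]
    rw [hs, Matrix.mulVec_sub, sub_dotProduct, dotProduct_sub, dotProduct_sub,
      Matrix.mulVec_smul, dotProduct_smul, smul_dotProduct, smul_dotProduct, dotProduct_smul,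
      single_dotProduct, single_dotProduct, m1, m2, Matrix.mulVec_single_one]
    simp [h1]
    ring
  rw [e1, charFun_gaussianReal, hγ, charFun_multivariateGaussian hS,
    charFun_multivariateGaussian hS, ← Complex.exp_add, hquad]
  congr 1
  push_cast
  simp
  ring

/-- Regress on one coordinate of the cell. Given the remainder, every coordinate of the cell is
affine in a standard normal variable with slope at least `1 / 2`, hence so steep that the maximum
lies between `a` and `b` only on a set of diameter at most `2 * (b - a)`. The normal density is at
most `1`. -/
lemma measure_cell_max_le {S : Matrix ι ι ℝ} (hS : S.PosSemidef) (s : Set ι)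
    (h1 : ∀ i ∈ s, S i i = 1) (h2 : ∀ i ∈ s, ∀ j ∈ s, 1 / 2 ≤ S i j) (a b : ℝ) :
    multivariateGaussian 0 S {z : EuclideanSpace ℝ ι | (∀ i ∈ s, z i ≤ b) ∧ ∃ i ∈ s, a < z i}
      ≤ ENNReal.ofReal (2 * (b - a)) := by
  rcases s.eq_empty_or_nonempty with rfl | ⟨i₀, hi₀⟩
  · simp
  set D : Set (EuclideanSpace ℝ ι) := {z | (∀ i ∈ s, z i ≤ b) ∧ ∃ i ∈ s, a < z i} with hD
  have mi : ∀ i, Measurable fun z : EuclideanSpace ℝ ι => z i := fun i => by fun_prop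
  have mD : MeasurableSet D := by
    have : D = (⋂ i ∈ s, {z : EuclideanSpace ℝ ι | z i ≤ b})
        ∩ ⋃ i ∈ s, {z : EuclideanSpace ℝ ι | a < z i} := by
      ext z
      simp [hD]
    rw [this]
    exact (MeasurableSet.biInter s.to_countable fun i _ =>
      measurableSet_le (mi i) measurable_const).inter
        (MeasurableSet.biUnion s.to_countable fun i _ => measurableSet_lt measurable_const (mi i))
  rw [← multivariateGaussian_eq_map_prod hS i₀ (h1 i₀ hi₀)]
  set v : EuclideanSpace ℝ ι := WithLp.toLp 2 fun i => S i i₀ with hv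
  have mR : Measurable fun z : EuclideanSpace ℝ ι => z - z i₀ • v := by fun_prop
  have mq : Measurable fun q : ℝ × EuclideanSpace ℝ ι => q.1 • v + q.2 := by fun_prop
  have : IsProbabilityMeasure ((multivariateGaussian 0 S).map
      fun z : EuclideanSpace ℝ ι => z - z i₀ • v) :=
    Measure.isProbabilityMeasure_map mR.aemeasurable
  rw [Measure.map_apply mq mD, Measure.prod_apply_symm (mq mD)]
  calc _ ≤ ∫⁻ _, ENNReal.ofReal (2 * (b - a)) ∂((multivariateGaussian 0 S).map
      fun z : EuclideanSpace ℝ ι => z - z i₀ • v) := by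
        refine lintegral_mono fun r => ?_
        refine (gaussianReal_le_volume _).trans ((Real.volume_le_diam _).trans ?_)
        refine Metric.ediam_le_of_forall_dist_le fun x hx y hy => ?_
        have key : ∀ x y : ℝ, x • v + r ∈ D → y • v + r ∈ D → y - x ≤ 2 * (b - a) := by
          intro x y hx hy
          obtain ⟨i, hi, hai⟩ := hx.2
          have hbi := hy.1 i hi
          have hvi : 1 / 2 ≤ v i := h2 i hi i₀ hi₀
          simp only [PiLp.add_apply, PiLp.smul_apply, smul_eq_mul] at hai hbi
          rcases le_total y x with h | h
          · have hbx := hx.1 i hi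
            simp only [PiLp.add_apply, PiLp.smul_apply, smul_eq_mul] at hbx
            linarith
          · nlinarith
        rw [Real.dist_eq, abs_le]
        have h3 := key x y hx hy
        have h4 := key y x hy hx
        constructor <;> linarith
    _ = _ := by simp

/-- The distribution function of the maximum of a standardized Gaussian vector is Lipschitz, with a
constant that depends only on the number of groups of correlated coordinates. -/
theorem measure_max_le_add {S : Matrix ι ι ℝ} (hS : S.PosSemidef) {N : ℕ} (κ : ι → Fin N)
    (h1 : ∀ i, S i i = 1) (h2 : ∀ i j, κ i = κ j → 1 / 2 ≤ S i j) (a b : ℝ) :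
    multivariateGaussian 0 S {z : EuclideanSpace ℝ ι | ∀ i, z i ≤ b}
      ≤ multivariateGaussian 0 S {z : EuclideanSpace ℝ ι | ∀ i, z i ≤ a}
        + N * ENNReal.ofReal (2 * (b - a)) := by
  have hsub : {z : EuclideanSpace ℝ ι | ∀ i, z i ≤ b} ⊆ {z : EuclideanSpace ℝ ι | ∀ i, z i ≤ a}
      ∪ ⋃ c : Fin N, {z : EuclideanSpace ℝ ι | (∀ i ∈ {i | κ i = c}, z i ≤ b) ∧
        ∃ i ∈ {i | κ i = c}, a < z i} := by
    intro z hz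
    by_cases h : ∀ i, z i ≤ a
    · exact Or.inl h
    · push Not at h
      obtain ⟨i, hi⟩ := h
      exact Or.inr (Set.mem_iUnion.2 ⟨κ i, fun j _ => hz j, i, rfl, hi⟩)
  refine (measure_mono hsub).trans ((measure_union_le _ _).trans (add_le_add le_rfl ?_))
  refine (measure_iUnion_fintype_le _ _).trans ?_
  -- The union bound runs over cells, not coordinates, so the constant is independent of the
  -- dimension.
  calc _ ≤ ∑ _ : Fin N, ENNReal.ofReal (2 * (b - a)) :=
        Finset.sum_le_sum fun c _ => measure_cell_max_le hS _ (fun i _ => h1 i)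
          (fun i hi j hj => h2 i j (hi.trans hj.symm)) a b
    _ = _ := by simp

end

section

/-! ### Asymptotic tightness of the empirical process of a Donsker class -/

/-- One half of the portmanteau theorem for nonmeasurable maps. A continuous bump equal to `1` at
distance at least `ε` from `K` vanishes on `K`; the measurable majorant supplied by the outer
expectation makes Markov's inequality available. -/
lemma WeaklyConverges.eventually_measure_infDist_le {S : ℕ → Type*} [∀ n, MeasurableSpace (S n)]
    {μ : ∀ n, Measure (S n)} {D : Type*} [PseudoMetricSpace D] [MeasurableSpace D] [BorelSpace D]
    {Z : ∀ n, S n → D} {Γ : Measure D} (h : WeaklyConverges μ Z Γ) {K : Set D} (hK : IsClosed K)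
    {η : ℝ≥0∞} (hη : Γ Kᶜ < η) {ε : ℝ} (hε : 0 < ε) :
    ∀ᶠ n in atTop, μ n {s | ε ≤ Metric.infDist (Z n s) K} ≤ η := by
  set E : Set D := {z | ε ≤ Metric.infDist z K} with hE
  have h1 : ∫⁻ z, (thickenedIndicator hε E z : ℝ≥0∞) ∂Γ ≤ Γ Kᶜ := by
    rw [← lintegral_indicator_one hK.measurableSet.compl]
    refine lintegral_mono fun z => ?_
    by_cases hz : z ∈ K
    · have : z ∉ Metric.thickening ε E := by
        rw [Metric.mem_thickening_iff]
        rintro ⟨y, hy, hd⟩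
        rw [dist_comm] at hd
        exact absurd (Metric.infDist_le_dist_of_mem hz) (not_le.2 (hd.trans_le hy))
      rw [thickenedIndicator_zero hε E this]
      simp
    · rw [Set.indicator_of_mem (show z ∈ Kᶜ from hz)]
      simpa using thickenedIndicator_le_one hε E z
  filter_upwards [(h (thickenedIndicator hε E)).eventually (gt_mem_nhds (h1.trans_lt hη))]
    with n hn
  simp only [outerExpectation, iInf_lt_iff] at hn
  obtain ⟨u, hu, hle, hlt⟩ := hn
  have h2 := mul_meas_ge_le_lintegral (μ := μ n) hu 1
  rw [one_mul] at h2
  refine (measure_mono fun s hs => ?_).trans (h2.trans hlt.le)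
  have h3 := hle s
  rw [thickenedIndicator_one hε E (show Z n s ∈ E from hs)] at h3
  simpa using h3

variable {𝒳 : Type*} [MeasurableSpace 𝒳]

lemma wSum_const_eq_empProcess (P : Measure 𝒳) {n : ℕ} (x : Fin n → 𝒳) (f : 𝒳 → ℝ) :
    wSum (fun _ => (Real.sqrt n)⁻¹) x (fun y => f y - ∫ z, f z ∂P) = empProcess P x f := by
  rcases Nat.eq_zero_or_pos n with rfl | hn
  · simp [wSum, empProcess]
  have hn' : (0 : ℝ) < n := by exact_mod_cast hn
  rw [wSum, ← Finset.mul_sum, Finset.sum_sub_distrib, empProcess, empMean]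
  simp only [Finset.sum_const, Finset.card_univ, Fintype.card_fin, nsmul_eq_mul]
  have h1 : (Real.sqrt n)⁻¹ = Real.sqrt n * (n : ℝ)⁻¹ := by
    rw [inv_eq_iff_eq_inv, mul_inv, inv_inv, inv_mul_eq_div, Real.div_sqrt]
  rw [h1]
  field_simp

variable {P : Measure 𝒳} [IsProbabilityMeasure P]
  {F : Set (𝒳 → ℝ)}

/-- Almost surely every observation has a bounded centered path over `F`, so the empirical process
is bounded and the default value `0` of `toLInf` does not occur. -/
lemma IsDonsker.ae_toLInf_eq (hF : IsDonsker P F) (n : ℕ) :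
    ∀ᵐ x ∂(Measure.pi fun _ : Fin n => P), ∀ f : F,
      (toLInf fun f : F => empProcess P x f.1 : F → ℝ) f = empProcess P x f.1 := by
  have h1 : ∀ j : Fin n, ∀ᵐ x ∂(Measure.pi fun _ : Fin n => P),
      BddAbove (Set.range fun f : F => |f.1 (x j) - ∫ z, f.1 z ∂P|) := fun j =>
    (Measure.tendsto_eval_ae_ae (μ := fun _ : Fin n => P) (i := j)).eventually hF.bounded_paths
  filter_upwards [ae_all_iff.2 h1] with x hx f
  have hmem : Memℓp (E := fun _ : F => ℝ) (fun f : F => empProcess P x f.1) ∞ := by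
    rw [memℓp_infty_iff]
    choose B hB using hx
    refine ⟨Real.sqrt n * ((n : ℝ)⁻¹ * ∑ j, B j), ?_⟩
    rintro _ ⟨f, rfl⟩
    simp only [Real.norm_eq_abs, empProcess, abs_mul, abs_of_nonneg (Real.sqrt_nonneg _)]
    rcases Nat.eq_zero_or_pos n with rfl | hn
    · simp
    have hn' : (n : ℝ) ≠ 0 := by positivity
    refine mul_le_mul_of_nonneg_left ?_ (Real.sqrt_nonneg _)
    have e : empMean x f.1 - ∫ y, f.1 y ∂P = (n : ℝ)⁻¹ * ∑ j, (f.1 (x j) - ∫ y, f.1 y ∂P) := by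
      rw [empMean, Finset.sum_sub_distrib, mul_sub]
      simp only [Finset.sum_const, Finset.card_univ, Fintype.card_fin, nsmul_eq_mul]
      rw [inv_mul_cancel_left₀ hn']
    rw [e, abs_mul, abs_of_nonneg (by positivity)]
    refine mul_le_mul_of_nonneg_left ((Finset.abs_sum_le_sum_abs _ _).trans ?_) (by positivity)
    exact Finset.sum_le_sum fun j _ => hB j ⟨f, rfl⟩
  rw [toLInf, dif_pos hmem]

/-- Outside an event of small probability, the empirical process is close to a compact set. -/
lemma IsDonsker.exists_compact (hF : IsDonsker P F) {η : ℝ≥0∞} (hη : 0 < η) :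
    ∃ K : Set (LInf F), IsCompact K ∧ K.Nonempty ∧ ∀ ε : ℝ, 0 < ε → ∀ᶠ n in atTop,
      (Measure.pi fun _ : Fin n => P)
        {x | ¬ ∃ z ∈ K, ∀ f : F, |(empProcess P x f.1) - z f| < ε} ≤ η := by
  obtain ⟨Γ, hΓ, ht, hw⟩ := hF.weak_limit
  obtain ⟨η', hη', hlt⟩ := exists_between hη
  obtain ⟨K, hK, hKη⟩ := isTightMeasureSet_iff_exists_isCompact_measure_compl_le.1 ht η' hη'
  -- Adjoining `0` avoids the empty set, for which `Metric.infDist` would be `0`.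
  refine ⟨K ∪ {0}, hK.union isCompact_singleton, ⟨0, Or.inr rfl⟩, fun ε hε => ?_⟩
  have hK' : IsCompact (K ∪ {0}) := hK.union isCompact_singleton
  have h1 : Γ (K ∪ {0})ᶜ < η :=
    (measure_mono (Set.compl_subset_compl.2 Set.subset_union_left)).trans_lt
      ((hKη Γ rfl).trans_lt hlt)
  filter_upwards [hw.eventually_measure_infDist_le hK'.isClosed h1 hε] with n hn
  refine le_trans (measure_mono_ae ?_) hn
  filter_upwards [hF.ae_toLInf_eq n] with x hx hmem
  change ε ≤ _
  by_contra hcon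
  have hne : (K ∪ {0}).Nonempty := ⟨0, Or.inr rfl⟩
  rw [not_le, Metric.infDist_lt_iff hne] at hcon
  obtain ⟨z, hz, hd⟩ := hcon
  refine hmem ⟨z, hz, fun f => ?_⟩
  rw [← hx f]
  rw [dist_eq_norm] at hd
  exact (lp.norm_apply_le_norm ENNReal.top_ne_zero
    ((toLInf fun f : F => empProcess P x f.1) - z) f).trans_lt hd

lemma IsDonsker.exists_bound (hF : IsDonsker P F) {η : ℝ≥0∞} (hη : 0 < η) :
    ∃ M : ℝ, ∀ᶠ n in atTop, (Measure.pi fun _ : Fin n => P)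
      {x | ∃ f ∈ F, M < |(empProcess P x f)|} ≤ η := by
  obtain ⟨K, hK, -, h⟩ := hF.exists_compact hη
  obtain ⟨B, hB⟩ := hK.isBounded.exists_norm_le
  refine ⟨B + 1, ?_⟩
  filter_upwards [h 1 one_pos] with n hn
  refine (measure_mono ?_).trans hn
  rintro x ⟨f, hf, hM⟩ ⟨z, hz, hzf⟩
  have h1 := hzf ⟨f, hf⟩
  have h2 := (lp.norm_apply_le_norm ENNReal.top_ne_zero z ⟨f, hf⟩).trans (hB z hz)
  rw [Real.norm_eq_abs] at h2
  have h3 := abs_sub_abs_le_abs_sub (empProcess P x f) (z ⟨f, hf⟩)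
  linarith

/-- The empirical process is asymptotically nearly constant on the cells of a finite partition. -/
lemma IsDonsker.exists_partition (hF : IsDonsker P F) {η : ℝ≥0∞} (hη : 0 < η) {ε : ℝ}
    (hε : 0 < ε) :
    ∃ (N : ℕ) (κ : F → Fin N), ∀ᶠ n in atTop, (Measure.pi fun _ : Fin n => P)
      {x | ∃ f g : F, κ f = κ g ∧ ε < |(empProcess P x f.1) - empProcess P x g.1|} ≤ η := by
  obtain ⟨K, hK, -, h⟩ := hF.exists_compact hη
  obtain ⟨t, ht, hKt⟩ := Metric.totallyBounded_iff.1 hK.totallyBounded (ε / 8) (by positivity)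
  have := ht.fintype
  obtain ⟨B, hB⟩ := ht.isBounded.exists_norm_le
  -- Each `f` is encoded by its values at the finitely many net points of `K`. These vectors form a
  -- bounded set in finite dimension, and a net of it gives the cells. Two members of a cell then
  -- differ by six errors of size `ε / 8`.
  let e : F → t → ℝ := fun f z => z.1 f
  have hB' : Set.range e ⊆ Metric.closedBall 0 (max B 0) := by
    rintro _ ⟨f, rfl⟩
    rw [mem_closedBall_zero_iff, pi_norm_le_iff_of_nonneg (le_max_right _ _)]
    exact fun z => ((lp.norm_apply_le_norm ENNReal.top_ne_zero z.1 f).trans (hB z.1 z.2)).trans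
      (le_max_left _ _)
  obtain ⟨s, hs, hcov⟩ := Metric.totallyBounded_iff.1
    ((isCompact_closedBall _ _).totallyBounded.subset hB') (ε / 8) (by positivity)
  have : ∀ f : F, ∃ y : s, dist (e f) y.1 < ε / 8 := fun f => by
    have := hcov ⟨f, rfl⟩
    simp only [Set.mem_iUnion, Metric.mem_ball] at this
    obtain ⟨y, hy, hd⟩ := this
    exact ⟨⟨y, hy⟩, hd⟩
  choose c hc using this
  have := hs.fintype
  refine ⟨_, fun f => Fintype.equivFin s (c f), ?_⟩
  filter_upwards [h (ε / 8) (by positivity)] with n hn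
  refine (measure_mono ?_).trans hn
  rintro x ⟨f, g, hfg, hlt⟩ ⟨z, hz, hzf⟩
  have hcfg : c f = c g := (Fintype.equivFin s).injective hfg
  obtain ⟨y, hy, hyz⟩ : ∃ y ∈ t, dist z y < ε / 8 := by
    have := hKt hz
    simpa only [Set.mem_iUnion, Metric.mem_ball, exists_prop] using this
  have k1 : ∀ f : F, |z f - y f| < ε / 8 := fun f => by
    rw [dist_eq_norm] at hyz
    exact (lp.norm_apply_le_norm ENNReal.top_ne_zero (z - y) f).trans_lt hyz
  have k2 : ∀ f : F, |y f - (c f).1 ⟨y, hy⟩| < ε / 8 := fun f =>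
    (dist_le_pi_dist (e f) (c f).1 ⟨y, hy⟩).trans_lt (hc f)
  have a1 := abs_lt.1 (hzf f)
  have a2 := abs_lt.1 (hzf g)
  have a3 := abs_lt.1 (k1 f)
  have a4 := abs_lt.1 (k1 g)
  have a5 := abs_lt.1 (k2 f)
  have a6 := abs_lt.1 (k2 g)
  rw [hcfg] at a5
  rcases lt_abs.1 hlt with h | h <;> linarith

/-! ### Closeness in variance of functions with close empirical processes -/

lemma eventually_nearlyOrthogonal_const {N : ℕ → ℕ} (hN : Tendsto N atTop atTop) {s : ℕ → ℝ}
    {s₀ : ℝ} (hs : Tendsto s atTop (𝓝 s₀)) {δ : ℝ} (hδ : 0 < δ) :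
    ∀ᶠ k in atTop, NearlyOrthogonal (n := N k) δ (s₀ ^ 2) 0
      (fun _ => s k * (Real.sqrt (N k))⁻¹) 0 := by
  have h1 : Tendsto (fun k => s k * (Real.sqrt (N k))⁻¹) atTop (𝓝 0) := by
    have := hs.mul (tendsto_inv_atTop_zero.comp
      (Real.tendsto_sqrt_atTop.comp (tendsto_natCast_atTop_atTop.comp hN)))
    rw [mul_zero] at this
    exact this
  have h2 : ∀ᶠ k in atTop, |s k ^ 2 - s₀ ^ 2| < δ := by
    have := hs.pow 2
    simpa [Real.dist_eq] using Metric.tendsto_nhds.1 this δ hδ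
  have h3 : ∀ᶠ k in atTop, |s k * (Real.sqrt (N k))⁻¹| < δ := by
    simpa [Real.dist_eq] using Metric.tendsto_nhds.1 h1 δ hδ
  filter_upwards [h2, h3, hN.eventually_gt_atTop 0] with k k2 k3 k4
  have hNk : (N k : ℝ) ≠ 0 := by positivity
  refine ⟨fun j => k3.le, fun j => by simpa using hδ.le, ?_, by simpa using hδ.le,
    by simpa using hδ.le⟩
  simp only [Finset.sum_const, Finset.card_univ, Fintype.card_fin, nsmul_eq_mul]
  rw [mul_pow, inv_pow, Real.sq_sqrt (Nat.cast_nonneg _), mul_left_comm, mul_inv_cancel₀ hNk,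
    mul_one]
  exact k2.le

/-- A normal limit that lies within `ε` of zero with probability at least `7 / 8` cannot have a
large variance. Quantitatively, the characteristic function at frequency `1 / ε` gives `exp (-s / 2)
≥ 1 / 2 - (3 / 2) * (1 / 8) = 5 / 16` for `s` the variance over `ε ^ 2`, whence `s ≤ 5`. Thus cells
on which the process is nearly constant are also small in variance. -/
lemma variance_sub_le_of_eventually {f g : 𝒳 → ℝ} (mf : Measurable f) (mg : Measurable g)
    (hf : MemLp f 2 P) (hg : MemLp g 2 P) {ε : ℝ} (hε : 0 < ε)
    (h : ∀ᶠ n in atTop, (Measure.pi fun _ : Fin n => P)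
      {x | ε < |(empProcess P x f) - empProcess P x g|} ≤ ENNReal.ofReal (1 / 8)) :
    Var[f - g; P] ≤ 5 * ε ^ 2 := by
  set m := ∫ y, f y ∂P - ∫ y, g y ∂P with hm
  have hfg : MemLp (f - g) 2 P := hf.sub hg
  have hmfg : ∫ y, (f - g) y ∂P = m := integral_sub (hf.integrable (by norm_num))
    (hg.integrable (by norm_num))
  set g₁ : 𝒳 → ℝ := fun y => ε⁻¹ * ((f - g) y - m) with hg₁
  have mg₁ : Measurable g₁ := ((mf.sub mg).sub_const m).const_mul _
  have L₁ : MemLp g₁ 2 P := (hfg.sub (memLp_const m)).const_mul ε⁻¹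
  have z₁ : ∫ y, g₁ y ∂P = 0 := by
    simp only [hg₁]
    rw [integral_const_mul, integral_sub (hfg.integrable (by norm_num)) (integrable_const _), hmfg]
    simp
  have hs : ∫ y, g₁ y ^ 2 ∂P = Var[f - g; P] / ε ^ 2 := by
    rw [variance_eq_integral hfg.1.aemeasurable, hmfg]
    simp only [hg₁, mul_pow]
    rw [integral_const_mul, inv_pow, inv_mul_eq_div]
  set s := ∫ y, g₁ y ^ 2 ∂P
  have hs0 : 0 ≤ s := integral_nonneg fun y => sq_nonneg _
  have hX : ∀ n (x : Fin n → 𝒳), wSum (fun _ => (Real.sqrt n)⁻¹) x g₁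
      = ε⁻¹ * (empProcess P x f - empProcess P x g) := fun n x => by
    rw [← wSum_const_eq_empProcess P, ← wSum_const_eq_empProcess P]
    simp only [wSum, hg₁, hm]
    rw [← Finset.sum_sub_distrib, Finset.mul_sum]
    exact Finset.sum_congr rfl fun j _ => by simp only [Pi.sub_apply]; ring
  have hconv : Real.exp (-s / 2) ≥ 5 / 16 := by
    refine le_of_forall_pos_le_add fun ε' hε' => ?_
    obtain ⟨δ, hδ, H⟩ := exists_charFun_pair_le L₁ (MemLp.zero (p := 2) (μ := P) (ε := ℝ)) z₁
      (by simp) 1 0 hε'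
    have hev := eventually_nearlyOrthogonal_const tendsto_id
      (tendsto_const_nhds (x := (1 : ℝ))) hδ
    obtain ⟨n, hn, hn2⟩ := (h.and hev).exists
    rw [one_pow] at hn2
    have h1 := H n _ _ hn2.1 hn2.2.1 hn2.2.2.1 hn2.2.2.2.1 hn2.2.2.2.2
    simp only [mul_one, mul_zero, add_zero, one_mul] at h1
    have hw0 : ∀ x : Fin n → 𝒳, wSum (0 : Fin n → ℝ) x (0 : 𝒳 → ℝ) = 0 := fun x => by simp [wSum]
    simp only [hw0, add_zero, id] at h1
    set W : (Fin n → 𝒳) → ℝ := fun x => wSum (fun _ => (Real.sqrt n)⁻¹) x g₁ with hW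
    have mW : Measurable W := by
      simp only [hW, wSum]
      exact Finset.measurable_sum _ fun j _ =>
        (mg₁.comp (measurable_pi_apply j)).const_mul _
    have h2 : (∫ x, Complex.exp ((W x : ℂ) * Complex.I) ∂(Measure.pi fun _ : Fin n => P)).re
        = ∫ x, Real.cos (W x) ∂(Measure.pi fun _ : Fin n => P) := by
      have hi : Integrable (fun x => Complex.exp ((W x : ℂ) * Complex.I))
          (Measure.pi fun _ : Fin n => P) :=
        Integrable.of_bound (by fun_prop) 1 (.of_forall fun x => by
          rw [Complex.norm_exp_ofReal_mul_I])
      have := integral_re hi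
      simp only [RCLike.re_to_complex, Complex.exp_ofReal_mul_I_re] at this
      exact this.symm
    have h3 : ∫ x, Real.cos (W x) ∂(Measure.pi fun _ : Fin n => P) ≤ Real.exp (-s / 2) + ε' := by
      have := (Complex.abs_re_le_norm _).trans h1
      rw [Complex.sub_re, h2] at this
      have h4 : (Complex.exp (-(s : ℂ) / 2)).re = Real.exp (-s / 2) := by
        have : (-(s : ℂ) / 2) = ((-s / 2 : ℝ) : ℂ) := by push_cast; ring
        rw [this, Complex.exp_ofReal_re]
      rw [h4] at this
      linarith [(abs_le.1 this).2]
    refine le_trans ?_ h3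
    set Bd : Set (Fin n → 𝒳) := {x | 1 < |W x|} with hBd
    have mB : MeasurableSet Bd := measurableSet_lt measurable_const (by fun_prop)
    have hB : (Measure.pi fun _ : Fin n => P).real Bd ≤ 1 / 8 := by
      refine ENNReal.toReal_le_of_le_ofReal (by norm_num) (le_trans (measure_mono ?_) hn)
      intro x hx
      simp only [hBd, Set.mem_ofPred_eq, hW, hX, abs_mul, abs_inv, abs_of_pos hε] at hx ⊢
      rwa [inv_mul_eq_div, one_lt_div hε] at hx
    -- The cosine is at least `1 / 2` where `|W| ≤ 1` and at least `-1` elsewhere.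
    have hc : ∀ x, 1 / 2 - Bd.indicator (fun _ => (3 / 2 : ℝ)) x ≤ Real.cos (W x) := fun x => by
      by_cases hx : x ∈ Bd
      · rw [Set.indicator_of_mem hx]
        linarith [Real.neg_one_le_cos (W x)]
      · rw [Set.indicator_of_notMem hx]
        have h5 : |W x| ≤ 1 := not_lt.1 hx
        have h6 := Real.one_sub_sq_div_two_le_cos (x := W x)
        have h7 : W x ^ 2 ≤ 1 := by rw [← sq_abs]; exact pow_le_one₀ (abs_nonneg _) h5
        linarith
    have hiB : Integrable (Bd.indicator (fun _ => (3 / 2 : ℝ)))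
        (Measure.pi fun _ : Fin n => P) := (integrable_const _).indicator mB
    have h8 := integral_mono (μ := Measure.pi fun _ : Fin n => P)
      ((integrable_const (1 / 2 : ℝ)).sub hiB)
      (Integrable.of_bound (C := 1) (by fun_prop) (.of_forall fun x => Real.abs_cos_le_one (W x)))
      hc
    rw [integral_sub' (integrable_const _) hiB, integral_indicator_const _ mB] at h8
    simp only [integral_const, probReal_univ, smul_eq_mul, one_mul] at h8
    linarith
  have h9 : 1 + s / 2 ≤ 16 / 5 := by
    have h10 := Real.add_one_le_exp (s / 2)
    have h11 : Real.exp (-s / 2) * Real.exp (s / 2) = 1 := by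
      rw [← Real.exp_add]
      simp [neg_div]
    have h12 := Real.exp_pos (s / 2)
    nlinarith
  have h13 : s ≤ 5 := by linarith
  rw [hs, div_le_iff₀ (by positivity)] at h13
  exact h13

end

section

/-! ### Smooth approximations of lower orthants -/

/-- The continuous function that is `1` below `t`, `0` above `t + ε` and affine in between. -/
def ramp (t ε y : ℝ) : ℝ := max 0 (min 1 (1 - (y - t) / ε))

lemma ramp_nonneg (t ε y : ℝ) : 0 ≤ ramp t ε y := le_max_left _ _

lemma ramp_le_one (t ε y : ℝ) : ramp t ε y ≤ 1 := max_le zero_le_one (min_le_left _ _)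

lemma ramp_eq_one {t ε y : ℝ} (hε : 0 < ε) (h : y ≤ t) : ramp t ε y = 1 := by
  have : (y - t) / ε ≤ 0 := div_nonpos_of_nonpos_of_nonneg (by linarith) hε.le
  rw [ramp, min_eq_left (by linarith), max_eq_right zero_le_one]

lemma ramp_eq_zero {t ε y : ℝ} (hε : 0 < ε) (h : t + ε ≤ y) : ramp t ε y = 0 := by
  have : 1 ≤ (y - t) / ε := by rw [le_div_iff₀ hε]; linarith
  exact max_eq_left ((min_le_right _ _).trans (by linarith))

variable {ι : Type*} [Fintype ι]

/-- A continuous approximation of the indicator of `{z | ∀ i, z i ≤ t}`. -/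
def boxTest (ι : Type*) [Fintype ι] (t ε : ℝ) : EuclideanSpace ℝ ι →ᵇ ℝ :=
  BoundedContinuousFunction.ofNormedAddCommGroup (fun z => ∏ i, ramp t ε (z i))
    (by unfold ramp; fun_prop) 1 fun z => by
      rw [Real.norm_eq_abs, abs_of_nonneg (Finset.prod_nonneg fun _ _ => ramp_nonneg _ _ _)]
      exact Finset.prod_le_one (fun _ _ => ramp_nonneg _ _ _) fun _ _ => ramp_le_one _ _ _

lemma boxTest_nonneg (t ε : ℝ) (z : EuclideanSpace ℝ ι) : 0 ≤ boxTest ι t ε z :=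
  Finset.prod_nonneg fun _ _ => ramp_nonneg _ _ _

lemma boxTest_le_one (t ε : ℝ) (z : EuclideanSpace ℝ ι) : boxTest ι t ε z ≤ 1 :=
  Finset.prod_le_one (fun _ _ => ramp_nonneg _ _ _) fun _ _ => ramp_le_one _ _ _

lemma boxTest_eq_one {t ε : ℝ} (hε : 0 < ε) {z : EuclideanSpace ℝ ι} (h : ∀ i, z i ≤ t) :
    boxTest ι t ε z = 1 :=
  Finset.prod_eq_one fun i _ => ramp_eq_one hε (h i)

lemma boxTest_eq_zero {t ε : ℝ} (hε : 0 < ε) {z : EuclideanSpace ℝ ι} {i : ι}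
    (h : t + ε ≤ z i) : boxTest ι t ε z = 0 :=
  Finset.prod_eq_zero (Finset.mem_univ i) (ramp_eq_zero hε h)

lemma measurableSet_box (t : ℝ) : MeasurableSet {z : EuclideanSpace ℝ ι | ∀ i, z i ≤ t} := by
  have : {z : EuclideanSpace ℝ ι | ∀ i, z i ≤ t} = ⋂ i, {z | z i ≤ t} := by
    ext z
    simp
  rw [this]
  exact MeasurableSet.iInter fun i => measurableSet_le (by fun_prop) measurable_const

lemma integral_boxTest_le (γ : Measure (EuclideanSpace ℝ ι)) [IsProbabilityMeasure γ] (t : ℝ)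
    {ε : ℝ} (hε : 0 < ε) : ∫ z, boxTest ι t ε z ∂γ ≤ γ.real {z | ∀ i, z i ≤ t + ε} := by
  rw [← integral_indicator_one (measurableSet_box _)]
  refine integral_mono ((boxTest ι t ε).integrable γ)
    ((integrable_const (1 : ℝ)).indicator (measurableSet_box _)) fun z => ?_
  by_cases h : ∀ i, z i ≤ t + ε
  · rw [Set.indicator_of_mem (show z ∈ {z : EuclideanSpace ℝ ι | ∀ i, z i ≤ t + ε} from h)]
    exact boxTest_le_one _ _ _
  · rw [Set.indicator_of_notMem (show z ∉ {z : EuclideanSpace ℝ ι | ∀ i, z i ≤ t + ε} from h)]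
    push Not at h
    obtain ⟨i, hi⟩ := h
    exact (boxTest_eq_zero hε hi.le).le

lemma le_integral_boxTest (γ : Measure (EuclideanSpace ℝ ι)) [IsProbabilityMeasure γ] (t : ℝ)
    {ε : ℝ} (hε : 0 < ε) : γ.real {z | ∀ i, z i ≤ t} ≤ ∫ z, boxTest ι t ε z ∂γ := by
  rw [← integral_indicator_one (measurableSet_box _)]
  refine integral_mono ((integrable_const (1 : ℝ)).indicator (measurableSet_box _))
    ((boxTest ι t ε).integrable γ) fun z => ?_
  by_cases h : ∀ i, z i ≤ t
  · rw [Set.indicator_of_mem (show z ∈ {z : EuclideanSpace ℝ ι | ∀ i, z i ≤ t} from h),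
      boxTest_eq_one hε h]
    rfl
  · rw [Set.indicator_of_notMem (show z ∉ {z : EuclideanSpace ℝ ι | ∀ i, z i ≤ t} from h)]
    exact boxTest_nonneg _ _ _

/-! ### Conditional laws of large numbers -/

/-- If the mean of `b` converges to `I`, and the mean of the product of two conditionally
independent copies of `b` to `I ^ 2`, then the conditional mean of `b` tends to `I` in mean
square. -/
lemma tendsto_integral_sub_sq {S T : ℕ → Type*} [∀ k, MeasurableSpace (S k)]
    [∀ k, MeasurableSpace (T k)] (X : ∀ k, Measure (S k)) (ν : ∀ k, Measure (T k))
    [∀ k, IsProbabilityMeasure (X k)] [∀ k, IsProbabilityMeasure (ν k)]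
    (b : ∀ k, S k → T k → ℝ) (mb : ∀ k, Measurable (Function.uncurry (b k))) {C : ℝ}
    (hC : ∀ k x w, ‖b k x w‖ ≤ C) (I : ℝ)
    (h2 : Tendsto (fun k => ∫ z : S k × (T k × T k), b k z.1 z.2.1 * b k z.1 z.2.2
      ∂((X k).prod ((ν k).prod (ν k)))) atTop (𝓝 (I * I)))
    (h1 : Tendsto (fun k => ∫ z : S k × (T k × T k), b k z.1 z.2.1
      ∂((X k).prod ((ν k).prod (ν k)))) atTop (𝓝 I)) :
    Tendsto (fun k => ∫ x, (∫ w, b k x w ∂(ν k) - I) ^ 2 ∂(X k)) atTop (𝓝 0) := by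
  set ψ : ∀ k, S k → ℝ := fun k x => ∫ w, b k x w ∂(ν k) with hψ
  have mψ : ∀ k, StronglyMeasurable (ψ k) := fun k =>
    (mb k).stronglyMeasurable.integral_prod_right
  have bψ : ∀ k x, ‖ψ k x‖ ≤ C := fun k x =>
    (norm_integral_le_of_norm_le_const (.of_forall (hC k x))).trans (by simp)
  have iψ : ∀ k, Integrable (ψ k) (X k) := fun k =>
    Integrable.of_bound (mψ k).aestronglyMeasurable _ (.of_forall (bψ k))
  have iψ2 : ∀ k, Integrable (fun x => ψ k x ^ 2) (X k) := fun k =>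
    Integrable.of_bound ((mψ k).pow 2).aestronglyMeasurable (C ^ 2) (.of_forall fun x => by
      rw [norm_pow]
      exact pow_le_pow_left₀ (norm_nonneg _) (bψ k x) 2)
  have m1 : ∀ k, Measurable fun z : S k × (T k × T k) => b k z.1 z.2.1 := fun k =>
    (mb k).comp (measurable_fst.prodMk (measurable_fst.comp measurable_snd))
  have m2 : ∀ k, Measurable fun z : S k × (T k × T k) => b k z.1 z.2.2 := fun k =>
    (mb k).comp (measurable_fst.prodMk (measurable_snd.comp measurable_snd))
  -- Given the data, the two copies are independent, so the mean of their product is the second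
  -- moment of the conditional mean; the square around `I` then expands to `I ^ 2 - 2 * I * I + I ^
  -- 2` in the limit.
  have e2 : ∀ k, ∫ z : S k × (T k × T k), b k z.1 z.2.1 * b k z.1 z.2.2
      ∂((X k).prod ((ν k).prod (ν k))) = ∫ x, ψ k x ^ 2 ∂(X k) := fun k => by
    rw [integral_prod]
    · refine integral_congr_ae (.of_forall fun x => ?_)
      simp only [hψ, sq]
      exact integral_prod_mul (μ := ν k) (ν := ν k) (b k x) (b k x)
    · refine Integrable.of_bound (C := C * C) ((m1 k).mul (m2 k)).aestronglyMeasurable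
        (.of_forall fun z => ?_)
      rw [norm_mul]
      exact mul_le_mul (hC _ _ _) (hC _ _ _) (norm_nonneg _) ((norm_nonneg _).trans (hC k z.1 z.2.1))
  have e1 : ∀ k, ∫ z : S k × (T k × T k), b k z.1 z.2.1
      ∂((X k).prod ((ν k).prod (ν k))) = ∫ x, ψ k x ∂(X k) := fun k => by
    rw [integral_prod]
    · refine integral_congr_ae (.of_forall fun x => ?_)
      simpa using integral_prod_mul (μ := ν k) (ν := ν k) (b k x) (fun _ => (1 : ℝ))
    · exact Integrable.of_bound (C := C) (m1 k).aestronglyMeasurable (.of_forall fun z => hC _ _ _)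
  replace h2 := h2.congr e2
  replace h1 := h1.congr e1
  have e3 := (h2.sub (h1.const_mul (2 * I))).add_const (I ^ 2)
  have e4 : I * I - 2 * I * I + I ^ 2 = 0 := by ring
  rw [e4] at e3
  refine e3.congr fun k => ?_
  have h3 : ∀ x, (ψ k x - I) ^ 2 = ψ k x ^ 2 - 2 * I * ψ k x + I ^ 2 := fun x => by ring
  have h4 : Integrable (fun x => ψ k x ^ 2 - 2 * I * ψ k x) (X k) :=
    (iψ2 k).sub ((iψ k).const_mul _)
  change _ = ∫ x, (ψ k x - I) ^ 2 ∂(X k)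
  simp_rw [h3]
  rw [integral_add h4 (integrable_const _), integral_sub (iψ2 k) ((iψ k).const_mul _),
    integral_const_mul]
  simp

/-- The mean square error of an average of `R` conditionally independent draws. -/
lemma integral_average_sub_sq_le {S T : Type*} [MeasurableSpace S] [MeasurableSpace T]
    (X : Measure S) (ν : Measure T) [IsProbabilityMeasure X] [IsProbabilityMeasure ν]
    (b : S → T → ℝ) (mb : Measurable (Function.uncurry b)) (hb0 : ∀ x w, 0 ≤ b x w)
    (hb1 : ∀ x w, b x w ≤ 1) (I : ℝ) {R : ℕ} (hR : 0 < R) :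
    ∫ z : S × (Fin R → T), ((R : ℝ)⁻¹ * ∑ r, b z.1 (z.2 r) - I) ^ 2
        ∂(X.prod (Measure.pi fun _ => ν))
      ≤ (R : ℝ)⁻¹ + ∫ x, (∫ w, b x w ∂ν - I) ^ 2 ∂X := by
  have hR' : (0 : ℝ) < R := by exact_mod_cast hR
  have hbn : ∀ x w, ‖b x w‖ ≤ 1 := fun x w => by
    rw [Real.norm_eq_abs, abs_of_nonneg (hb0 x w)]
    exact hb1 x w
  set A : S → (Fin R → T) → ℝ := fun x w => (R : ℝ)⁻¹ * ∑ r, b x (w r) with hA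
  have hA0 : ∀ x w, 0 ≤ A x w := fun x w =>
    mul_nonneg (by positivity) (Finset.sum_nonneg fun r _ => hb0 _ _)
  have hA1 : ∀ x w, A x w ≤ 1 := fun x w => by
    rw [hA, inv_mul_le_one₀ hR']
    calc _ ≤ ∑ _ : Fin R, (1 : ℝ) := Finset.sum_le_sum fun r _ => hb1 _ _
      _ = R := by simp
  have mA : Measurable (Function.uncurry A) := by
    refine Measurable.const_mul (Finset.measurable_sum _ fun r _ => ?_) _
    exact mb.comp (measurable_fst.prodMk ((measurable_pi_apply r).comp measurable_snd))
  have hsq : ∀ y : ℝ, 0 ≤ y → y ≤ 1 → ‖(y - I) ^ 2‖ ≤ (1 + |I|) ^ 2 := fun y h0 h1 => by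
    rw [norm_pow, Real.norm_eq_abs]
    refine pow_le_pow_left₀ (abs_nonneg _) ((abs_sub _ _).trans ?_) 2
    rw [abs_of_nonneg h0]
    linarith
  have iA : Integrable (fun z : S × (Fin R → T) => (A z.1 z.2 - I) ^ 2)
      (X.prod (Measure.pi fun _ => ν)) :=
    Integrable.of_bound ((mA.sub_const I).pow_const 2).aestronglyMeasurable ((1 + |I|) ^ 2)
      (.of_forall fun z => hsq _ (hA0 _ _) (hA1 _ _))
  have mψ : StronglyMeasurable fun x => ∫ w, b x w ∂ν :=
    mb.stronglyMeasurable.integral_prod_right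
  have iψ : Integrable (fun x => (∫ w, b x w ∂ν - I) ^ 2) X := by
    refine Integrable.of_bound (((mψ.measurable.sub_const I).pow_const 2).aestronglyMeasurable)
      ((1 + |I|) ^ 2) (.of_forall fun x => hsq _ (integral_nonneg (hb0 x)) ?_)
    have := integral_mono (μ := ν) (Integrable.of_bound (C := 1)
      (mb.comp measurable_prodMk_left).aestronglyMeasurable (.of_forall (hbn x)))
      (integrable_const (1 : ℝ)) (hb1 x)
    simpa using this
  rw [integral_prod _ iA]
  have hx : ∀ x, ∫ w, (A x w - I) ^ 2 ∂(Measure.pi fun _ : Fin R => ν)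
      ≤ (R : ℝ)⁻¹ + (∫ w, b x w ∂ν - I) ^ 2 := fun x => by
    have mbx : Measurable (b x) := mb.comp measurable_prodMk_left
    have mAx : Measurable (A x) := mA.comp measurable_prodMk_left
    have Lb : MemLp (b x) 2 ν := MemLp.of_bound mbx.aestronglyMeasurable 1 (.of_forall (hbn x))
    have LA : MemLp (A x) 2 (Measure.pi fun _ : Fin R => ν) :=
      MemLp.of_bound mAx.aestronglyMeasurable 1 (.of_forall fun w => by
        rw [Real.norm_eq_abs, abs_of_nonneg (hA0 x w)]
        exact hA1 x w)
    have hAeq : A x = (R : ℝ)⁻¹ • ∑ r : Fin R, fun w : Fin R → T => b x (w r) := by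
      ext w
      simp [hA]
    have hmean : ∫ w, A x w ∂(Measure.pi fun _ : Fin R => ν) = ∫ w, b x w ∂ν := by
      simp only [hA]
      rw [integral_const_mul, integral_finsetSum]
      · have : ∀ r : Fin R, ∫ w : Fin R → T, b x (w r) ∂(Measure.pi fun _ => ν)
            = ∫ w, b x w ∂ν := fun r =>
          integral_comp_eval (μ := fun _ : Fin R => ν) mbx.aestronglyMeasurable
        simp only [this, Finset.sum_const, Finset.card_univ, Fintype.card_fin, nsmul_eq_mul]
        rw [inv_mul_cancel_left₀ hR'.ne']
      · exact fun r _ => Integrable.of_bound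
          (mbx.comp (measurable_pi_apply r)).aestronglyMeasurable 1
          (.of_forall fun w => hbn x _)
    have hvar : Var[A x; Measure.pi fun _ : Fin R => ν] ≤ (R : ℝ)⁻¹ := by
      rw [hAeq, variance_smul, variance_sum_pi (μ := fun _ : Fin R => ν) (X := fun _ => b x)
        fun _ => Lb]
      have hv : Var[b x; ν] ≤ 1 := by
        refine (variance_le_expectation_sq mbx.aestronglyMeasurable).trans ?_
        have := integral_mono (μ := ν) Lb.integrable_sq (integrable_const (1 : ℝ))
          fun w => pow_le_one₀ (hb0 x w) (hb1 x w)
        simpa using this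
      simp only [Finset.sum_const, Finset.card_univ, Fintype.card_fin, nsmul_eq_mul]
      calc ((R : ℝ)⁻¹) ^ 2 * (R * Var[b x; ν]) ≤ ((R : ℝ)⁻¹) ^ 2 * (R * 1) := by gcongr
        _ = (R : ℝ)⁻¹ := by field_simp
    -- Bias-variance decomposition given the data; the conditional variance of the average is at
    -- most `1 / R`.
    have hdec : ∫ w, (A x w - I) ^ 2 ∂(Measure.pi fun _ : Fin R => ν)
        = Var[A x; Measure.pi fun _ : Fin R => ν] + (∫ w, b x w ∂ν - I) ^ 2 := by
      have iA1 := LA.integrable (q := 2) (by norm_num)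
      rw [variance_eq_sub LA, hmean]
      have h3 : ∀ w, (A x w - I) ^ 2 = (A x w ^ 2 - 2 * I * A x w) + I ^ 2 := fun w => by ring
      have h4 : Integrable (fun w => A x w ^ 2 - 2 * I * A x w)
          (Measure.pi fun _ : Fin R => ν) := LA.integrable_sq.sub (iA1.const_mul _)
      simp_rw [h3]
      rw [integral_add h4 (integrable_const _), integral_sub LA.integrable_sq (iA1.const_mul _),
        integral_const_mul, hmean]
      simp only [integral_const, probReal_univ, smul_eq_mul, one_mul, Pi.pow_apply]
      ring
    rw [hdec]
    linarith
  calc _ ≤ ∫ x, ((R : ℝ)⁻¹ + (∫ w, b x w ∂ν - I) ^ 2) ∂X :=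
        integral_mono iA.integral_prod_left ((integrable_const _).add iψ) hx
    _ = _ := by
        rw [integral_add (integrable_const _) iψ]
        simp

/-! ### Limits of the two-sample process and of the bootstrap process on finite sets -/

/-- The joint law of two independent iid samples. -/
abbrev samplesLaw {𝒳 : Type*} [MeasurableSpace 𝒳] (Pa Pb : Measure 𝒳) (n m : ℕ) :
    Measure ((Fin n → 𝒳) × (Fin m → 𝒳)) :=
  (Measure.pi fun _ => Pa).prod (Measure.pi fun _ => Pb)

variable {𝒳 : Type*} [MeasurableSpace 𝒳] [DecidableEq ι] (Pa Pb : Measure 𝒳)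
  [IsProbabilityMeasure Pa] [IsProbabilityMeasure Pb] {ga gb : ι → 𝒳 → ℝ}

/-- The pair theorem with a one-point weight space, a zero second system and a constant second test
function. The minus sign in the second sample produces the difference and disappears in the
variance. -/
theorem tendsto_integral_empirical
    (mga : ∀ i, Measurable (ga i)) (mgb : ∀ i, Measurable (gb i))
    (hga : ∀ i, MemLp (ga i) 2 Pa) (hgb : ∀ i, MemLp (gb i) 2 Pb)
    (h0a : ∀ i, ∫ y, ga i y ∂Pa = 0) (h0b : ∀ i, ∫ y, gb i y ∂Pb = 0)
    {na nb : ℕ → ℕ} (hna : Tendsto na atTop atTop) (hnb : Tendsto nb atTop atTop)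
    {s : ℕ → ℝ} {s₀ : ℝ} (hs : Tendsto s atTop (𝓝 s₀)) (φ : EuclideanSpace ℝ ι →ᵇ ℝ) :
    Tendsto (fun k => ∫ x, φ (vecSum ga gb (fun _ => (Real.sqrt (na k))⁻¹)
        (fun _ => -s k * (Real.sqrt (nb k))⁻¹) x.1 x.2) ∂(samplesLaw Pa Pb (na k) (nb k))) atTop
      (𝓝 (∫ z, φ z ∂(limLaw Pa Pb ga gb 1 (s₀ ^ 2)))) := by
  have key := tendsto_integral_vecSum_pair Pa Pb mga mgb hga hgb h0a h0b (na := na) (nb := nb)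
    (T := fun _ => Unit) (fun _ => Measure.dirac ()) (fun k _ _ => (Real.sqrt (na k))⁻¹)
    (fun k _ => 0) (fun k _ _ => -s k * (Real.sqrt (nb k))⁻¹) (fun k _ => 0)
    (fun _ => measurable_const) (fun _ => measurable_const) (fun _ => measurable_const)
    (fun _ => measurable_const) zero_le_one le_rfl (sq_nonneg s₀) le_rfl
    (fun δ hδ => by
      refine tendsto_const_nhds.congr' ?_
      filter_upwards [eventually_nearlyOrthogonal_const hna
        (tendsto_const_nhds (x := (1 : ℝ))) hδ] with k hk
      simp only [one_pow, one_mul] at hk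
      exact (le_antisymm ((measure_mono (t := ∅) fun _ h => absurd hk h).trans
        measure_empty.le) zero_le).symm)
    (fun δ hδ => by
      refine tendsto_const_nhds.congr' ?_
      filter_upwards [eventually_nearlyOrthogonal_const hnb hs.neg hδ] with k hk
      rw [neg_sq] at hk
      exact (le_antisymm ((measure_mono (t := ∅) fun _ h => absurd hk h).trans
        measure_empty.le) zero_le).symm)
    φ (BoundedContinuousFunction.const _ 1)
  simp only [BoundedContinuousFunction.const_apply, mul_one, integral_const, probReal_univ,
    smul_eq_mul] at key
  refine key.congr fun k => ?_
  rw [Measure.prod_dirac, integral_map (by fun_prop)]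
  exact (φ.continuous.measurable.comp (measurable_vecSum mga mgb measurable_const
    measurable_const (measurable_fst.comp measurable_fst)
    (measurable_snd.comp measurable_fst))).aestronglyMeasurable

variable {νa νb : ∀ n : ℕ, Measure (Fin n → ℝ)} {c : ℝ}

/-- Given the data, the expectation over the weights of a test function of the bootstrap process
converges in mean square. -/
theorem tendsto_integral_bootstrap_sq
    (mga : ∀ i, Measurable (ga i)) (mgb : ∀ i, Measurable (gb i))
    (hga : ∀ i, MemLp (ga i) 2 Pa) (hgb : ∀ i, MemLp (gb i) 2 Pb)
    (h0a : ∀ i, ∫ y, ga i y ∂Pa = 0) (h0b : ∀ i, ∫ y, gb i y ∂Pb = 0)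
    {na nb : ℕ → ℕ} (hna : Tendsto na atTop atTop) (hnb : Tendsto nb atTop atTop)
    {s : ℕ → ℝ} {s₀ : ℝ} (hs : Tendsto s atTop (𝓝 s₀)) (hc : 0 < c)
    (hνa : IsWeightLaw νa c) (hνb : IsWeightLaw νb c) (φ : EuclideanSpace ℝ ι →ᵇ ℝ) :
    Tendsto (fun k => ∫ x, (∫ w, φ (vecSum ga gb (wDev c w.1) (-s k • wDev c w.2) x.1 x.2)
        ∂((νa (na k)).prod (νb (nb k))) - ∫ z, φ z ∂(limLaw Pa Pb ga gb 1 (s₀ ^ 2))) ^ 2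
        ∂(samplesLaw Pa Pb (na k) (nb k))) atTop (𝓝 0) := by
  have := hνa.prob
  have := hνb.prob
  set ν : ∀ k, Measure ((Fin (na k) → ℝ) × (Fin (nb k) → ℝ)) :=
    fun k => (νa (na k)).prod (νb (nb k)) with hν
  set I := ∫ z, φ z ∂(limLaw Pa Pb ga gb 1 (s₀ ^ 2)) with hI
  set b : ∀ k, ((Fin (na k) → 𝒳) × (Fin (nb k) → 𝒳)) → ((Fin (na k) → ℝ) × (Fin (nb k) → ℝ)) → ℝ :=
    fun k x w => φ (vecSum ga gb (wDev c w.1) (-s k • wDev c w.2) x.1 x.2) with hb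
  have mw : ∀ k, Measurable fun w : Fin (nb k) → ℝ => -s k • wDev c w := fun k =>
    (measurable_const_smul (-s k)).comp (measurable_wDev c)
  have mb : ∀ k, Measurable (Function.uncurry (b k)) := fun k =>
    φ.continuous.measurable.comp (measurable_vecSum mga mgb
      ((measurable_wDev c).comp (measurable_fst.comp measurable_snd))
      ((mw k).comp (measurable_snd.comp measurable_snd))
      (measurable_fst.comp measurable_fst) (measurable_snd.comp measurable_fst))
  have hmap1 : ∀ k, ((ν k).prod (ν k)).map (Prod.map Prod.fst Prod.fst)
      = (νa (na k)).prod (νa (na k)) := fun k => by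
    rw [← Measure.map_prod_map _ _ measurable_fst measurable_fst, hν, Measure.map_fst_prod]
    simp
  have hmap2 : ∀ k, ((ν k).prod (ν k)).map (Prod.map Prod.snd Prod.snd)
      = (νb (nb k)).prod (νb (nb k)) := fun k => by
    rw [← Measure.map_prod_map _ _ measurable_snd measurable_snd, hν, Measure.map_snd_prod]
    simp
  have ha : ∀ δ : ℝ, 0 < δ → Tendsto (fun k => ((ν k).prod (ν k))
      {t | ¬ NearlyOrthogonal δ 1 1 (wDev c t.1.1) (wDev c t.2.1)}) atTop (𝓝 0) := fun δ hδ => by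
    refine tendsto_of_tendsto_of_tendsto_of_le_of_le tendsto_const_nhds
      ((tendsto_nearlyOrthogonal_wDev hc hνa hδ).comp hna) (fun _ => zero_le) fun k => ?_
    simp only [Function.comp_apply, ← hmap1]
    exact Measure.le_map_apply (measurable_fst.prodMap measurable_fst).aemeasurable
      {q | ¬ NearlyOrthogonal δ 1 1 (wDev c q.1) (wDev c q.2)}
  have hb' : ∀ δ : ℝ, 0 < δ → Tendsto (fun k => ((ν k).prod (ν k))
      {t | ¬ NearlyOrthogonal δ (s₀ ^ 2) (s₀ ^ 2) (-s k • wDev c t.1.2) (-s k • wDev c t.2.2)})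
      atTop (𝓝 0) := fun δ hδ => by
    have h1 := tendsto_nearlyOrthogonal_smul_wDev hc hνb hnb hs.neg hδ
    rw [neg_sq] at h1
    refine tendsto_of_tendsto_of_tendsto_of_le_of_le tendsto_const_nhds h1 (fun _ => zero_le)
      fun k => ?_
    simp only [← hmap2]
    exact Measure.le_map_apply (measurable_snd.prodMap measurable_snd).aemeasurable
      {q | ¬ NearlyOrthogonal δ (s₀ ^ 2) (s₀ ^ 2) (-s k • wDev c q.1) (-s k • wDev c q.2)}
  -- The random coefficients are two independent draws of the whole weight pair, applied to the same
  -- data. Taking `φ' = φ` gives the second moment and `φ' = 1` the first.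
  have key := fun φ' => tendsto_integral_vecSum_pair Pa Pb mga mgb hga hgb h0a h0b
    (fun k => (ν k).prod (ν k)) (fun k t => wDev c t.1.1) (fun k t => wDev c t.2.1)
    (fun k t => -s k • wDev c t.1.2) (fun k t => -s k • wDev c t.2.2)
    (fun k => (measurable_wDev c).comp (measurable_fst.comp measurable_fst))
    (fun k => (measurable_wDev c).comp (measurable_fst.comp measurable_snd))
    (fun k => (mw k).comp (measurable_snd.comp measurable_fst))
    (fun k => (mw k).comp (measurable_snd.comp measurable_snd))
    zero_le_one zero_le_one (sq_nonneg s₀) (sq_nonneg s₀) ha hb' φ φ'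
  refine tendsto_integral_sub_sq _ ν b mb (C := ‖φ‖) (fun k x w => φ.norm_coe_le_norm _) I
    (key φ) ?_
  have h1 := key (BoundedContinuousFunction.const _ 1)
  simp only [BoundedContinuousFunction.const_apply, integral_const, probReal_univ,
    smul_eq_mul, mul_one] at h1
  exact h1

end

section

variable {𝒳 : Type*} [MeasurableSpace 𝒳] {Pa Pb : Measure 𝒳}

/-! ### The covariance of the two-sample limit -/

/-- The covariance of the limit of the two-sample process. -/
def sigmaCov (Pa Pb : Measure 𝒳) (lam : ℝ) (f g : 𝒳 → ℝ) : ℝ :=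
  cov[f, g; Pa] + lam ^ 2 * cov[f, g; Pb]

lemma sigmaSq_nonneg (Pa Pb : Measure 𝒳) (lam : ℝ) (f : 𝒳 → ℝ) : 0 ≤ sigmaSq Pa Pb lam f :=
  add_nonneg (variance_nonneg _ _) (mul_nonneg (sq_nonneg _) (variance_nonneg _ _))

lemma sigmaSq_sub_smul [IsProbabilityMeasure Pa] [IsProbabilityMeasure Pb] (lam : ℝ)
    {f g : 𝒳 → ℝ} (hfa : MemLp f 2 Pa) (hfb : MemLp f 2 Pb) (hga : MemLp g 2 Pa)
    (hgb : MemLp g 2 Pb) (t : ℝ) :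
    sigmaSq Pa Pb lam (f - t • g)
      = sigmaSq Pa Pb lam f - 2 * t * sigmaCov Pa Pb lam f g + t ^ 2 * sigmaSq Pa Pb lam g := by
  rw [sigmaSq, variance_sub hfa (hga.const_smul t), variance_sub hfb (hgb.const_smul t),
    covariance_smul_right, covariance_smul_right, variance_smul, variance_smul, sigmaSq, sigmaSq,
    sigmaCov]
  ring

lemma sigmaSq_sub [IsProbabilityMeasure Pa] [IsProbabilityMeasure Pb] (lam : ℝ)
    {f g : 𝒳 → ℝ} (hfa : MemLp f 2 Pa) (hfb : MemLp f 2 Pb) (hga : MemLp g 2 Pa)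
    (hgb : MemLp g 2 Pb) :
    sigmaSq Pa Pb lam (f - g)
      = sigmaSq Pa Pb lam f - 2 * sigmaCov Pa Pb lam f g + sigmaSq Pa Pb lam g := by
  have := sigmaSq_sub_smul lam hfa hfb hga hgb 1
  simpa using this

/-- Reverse triangle inequality for a seminorm given by a positive semidefinite form. The required
Cauchy-Schwarz bound comes from nonnegativity of the form at `f - (a / b) • g`. -/
lemma abs_sqrt_sigmaSq_sub_le [IsProbabilityMeasure Pa] [IsProbabilityMeasure Pb] (lam : ℝ)
    {f g : 𝒳 → ℝ} (hfa : MemLp f 2 Pa) (hfb : MemLp f 2 Pb) (hga : MemLp g 2 Pa)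
    (hgb : MemLp g 2 Pb) (hg : 0 < sigmaSq Pa Pb lam g) :
    |Real.sqrt (sigmaSq Pa Pb lam f) - Real.sqrt (sigmaSq Pa Pb lam g)|
      ≤ Real.sqrt (sigmaSq Pa Pb lam (f - g)) := by
  set a := Real.sqrt (sigmaSq Pa Pb lam f) with ha
  set b := Real.sqrt (sigmaSq Pa Pb lam g) with hb
  have ha2 : a ^ 2 = sigmaSq Pa Pb lam f := Real.sq_sqrt (sigmaSq_nonneg _ _ _ _)
  have hb2 : b ^ 2 = sigmaSq Pa Pb lam g := Real.sq_sqrt (sigmaSq_nonneg _ _ _ _)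
  have hb0 : 0 < b := Real.sqrt_pos.2 hg
  have ha0 : 0 ≤ a := Real.sqrt_nonneg _
  have h1 := sigmaSq_nonneg Pa Pb lam (f - (a / b) • g)
  rw [sigmaSq_sub_smul lam hfa hfb hga hgb, ← ha2, ← hb2, div_pow, div_mul_cancel₀ _ (by positivity)]
    at h1
  have h2 : a * sigmaCov Pa Pb lam f g ≤ a * (a * b) := by
    have : 2 * (a / b) * sigmaCov Pa Pb lam f g ≤ 2 * a ^ 2 := by linarith
    have h3 := mul_le_mul_of_nonneg_right this hb0.le
    have h4 : 2 * (a / b) * sigmaCov Pa Pb lam f g * b = 2 * (a * sigmaCov Pa Pb lam f g) := by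
      field_simp
    nlinarith
  refine Real.abs_le_sqrt ?_
  rw [sigmaSq_sub lam hfa hfb hga hgb, ← ha2, ← hb2]
  -- For `a = 0` the choice `t = a / b` carries no information; the minimizing `t`, covariance over
  -- `b ^ 2`, shows that the covariance vanishes.
  rcases ha0.eq_or_lt with h | h
  · have h6 : ∀ t : ℝ, 0 ≤ - 2 * t * sigmaCov Pa Pb lam f g + t ^ 2 * b ^ 2 := fun t => by
      have := sigmaSq_nonneg Pa Pb lam (f - t • g)
      rw [sigmaSq_sub_smul lam hfa hfb hga hgb, ← ha2, ← hb2, ← h] at this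
      linarith
    have h7 := h6 (sigmaCov Pa Pb lam f g / b ^ 2)
    have h8 : - 2 * (sigmaCov Pa Pb lam f g / b ^ 2) * sigmaCov Pa Pb lam f g
        + (sigmaCov Pa Pb lam f g / b ^ 2) ^ 2 * b ^ 2
        = - (sigmaCov Pa Pb lam f g ^ 2 / b ^ 2) := by
      field_simp
      ring
    rw [h8] at h7
    have h9 : sigmaCov Pa Pb lam f g ^ 2 / b ^ 2 = 0 :=
      le_antisymm (by linarith) (by positivity)
    have h10 : sigmaCov Pa Pb lam f g = 0 := by
      rcases div_eq_zero_iff.1 h9 with h' | h'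
      · exact pow_eq_zero_iff two_ne_zero |>.1 h'
      · exact absurd h' (by positivity)
    rw [h10, ← h]
    nlinarith
  · have := le_of_mul_le_mul_left h2 h
    nlinarith

/-! ### Standardized processes -/

/-- The functions of a family, centered under `P` and divided by the standard deviations of the
two-sample limit. -/
def stdFun {ι : Type*} (Pa Pb : Measure 𝒳) (lam : ℝ) (f : ι → 𝒳 → ℝ) (P : Measure 𝒳) (i : ι)
    (y : 𝒳) : ℝ :=
  (f i y - ∫ z, f i z ∂P) / Real.sqrt (sigmaSq Pa Pb lam (f i))

/-- The two-sample empirical process. -/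
def twoProc (Pa Pb : Measure 𝒳) {n m : ℕ} (xa : Fin n → 𝒳) (xb : Fin m → 𝒳) (f : 𝒳 → ℝ) : ℝ :=
  Real.sqrt n * ((empMean xa f - empMean xb f) - (∫ y, f y ∂Pa - ∫ y, f y ∂Pb))

lemma twoProc_eq {n m : ℕ} (hm : 0 < m) (xa : Fin n → 𝒳) (xb : Fin m → 𝒳) (f : 𝒳 → ℝ) :
    twoProc Pa Pb xa xb f
      = empProcess Pa xa f - Real.sqrt ((n : ℝ) / m) * empProcess Pb xb f := by
  have hm' : Real.sqrt m ≠ 0 := (Real.sqrt_pos.2 (by exact_mod_cast hm)).ne'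
  rw [twoProc, empProcess, empProcess, Real.sqrt_div (Nat.cast_nonneg n)]
  field_simp
  ring

/-- The standardized two-sample process on a family of functions. -/
def stdProc {ι : Type*} (Pa Pb : Measure 𝒳) (lam : ℝ) (f : ι → 𝒳 → ℝ) {n m : ℕ}
    (xa : Fin n → 𝒳) (xb : Fin m → 𝒳) : EuclideanSpace ℝ ι :=
  WithLp.toLp 2 fun i => twoProc Pa Pb xa xb (f i) / Real.sqrt (sigmaSq Pa Pb lam (f i))

/-- The standardized bootstrap process on a family of functions. -/
def stdBoot {ι : Type*} (Pa Pb : Measure 𝒳) (lam c : ℝ) (f : ι → 𝒳 → ℝ) {n m : ℕ}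
    (xa : Fin n → 𝒳) (xb : Fin m → 𝒳) (w : (Fin n → ℝ) × (Fin m → ℝ)) : EuclideanSpace ℝ ι :=
  WithLp.toLp 2 fun i => bootProcess c xa xb w (f i) / Real.sqrt (sigmaSq Pa Pb lam (f i))

lemma stdProc_eq_vecSum {ι : Type*} (lam : ℝ) (f : ι → 𝒳 → ℝ) {n m : ℕ} (hm : 0 < m)
    (xa : Fin n → 𝒳) (xb : Fin m → 𝒳) :
    stdProc Pa Pb lam f xa xb = vecSum (stdFun Pa Pb lam f Pa) (stdFun Pa Pb lam f Pb)
      (fun _ => (Real.sqrt n)⁻¹) (fun _ => -Real.sqrt ((n : ℝ) / m) * (Real.sqrt m)⁻¹) xa xb := by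
  ext i
  simp only [stdProc, vecSum]
  rw [twoProc_eq hm, ← wSum_const_eq_empProcess, ← wSum_const_eq_empProcess, sub_div]
  simp only [wSum, stdFun, Finset.mul_sum, Finset.sum_div]
  rw [sub_eq_add_neg, ← Finset.sum_neg_distrib]
  congr 1
  · exact Finset.sum_congr rfl fun j _ => by ring
  · exact Finset.sum_congr rfl fun j _ => by ring

/-- Centered weights sum to zero, so subtracting the unknown mean of `f` changes nothing. This lets
the limit theorem for centered functions apply to the bootstrap process. -/
lemma wSum_wDev (P : Measure 𝒳) (c : ℝ) {n : ℕ} (w : Fin n → ℝ) (x : Fin n → 𝒳) (f : 𝒳 → ℝ)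
    (s : ℝ) : wSum (wDev c w) x (fun y => (f y - ∫ z, f z ∂P) / s)
      = Real.sqrt n * (bootMean w x f - wBar w * empMean x f) / c / s := by
  rcases Nat.eq_zero_or_pos n with rfl | hn
  · simp [wSum]
  have hn' : (0 : ℝ) < n := by exact_mod_cast hn
  have h1 : wSum (wDev c w) x (fun y => (f y - ∫ z, f z ∂P) / s)
      = ((∑ j, wDev c w j * f (x j)) - (∑ j, wDev c w j) * ∫ z, f z ∂P) / s := by
    rw [wSum, Finset.sum_mul, ← Finset.sum_sub_distrib, Finset.sum_div]
    exact Finset.sum_congr rfl fun j _ => by ring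
  have h2 : ∑ j, wDev c w j * f (x j)
      = (∑ j, w j * f (x j) - wBar w * ∑ j, f (x j)) / (c * Real.sqrt n) := by
    rw [Finset.mul_sum, ← Finset.sum_sub_distrib, Finset.sum_div]
    exact Finset.sum_congr rfl fun j _ => by rw [wDev]; ring
  have h3 : (Real.sqrt n)⁻¹ = Real.sqrt n * (n : ℝ)⁻¹ := by
    rw [inv_eq_iff_eq_inv, mul_inv, inv_inv, inv_mul_eq_div, Real.div_sqrt]
  rw [h1, sum_wDev, zero_mul, sub_zero, h2, bootMean, empMean, div_eq_mul_inv _ (c * Real.sqrt n),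
    mul_inv, h3]
  ring

lemma stdBoot_eq_vecSum {ι : Type*} (lam c : ℝ) (f : ι → 𝒳 → ℝ) {n m : ℕ} (hm : 0 < m)
    (xa : Fin n → 𝒳) (xb : Fin m → 𝒳) (w : (Fin n → ℝ) × (Fin m → ℝ)) :
    stdBoot Pa Pb lam c f xa xb w = vecSum (stdFun Pa Pb lam f Pa) (stdFun Pa Pb lam f Pb)
      (wDev c w.1) (-Real.sqrt ((n : ℝ) / m) • wDev c w.2) xa xb := by
  ext i
  have h1 : wSum (-Real.sqrt ((n : ℝ) / m) • wDev c w.2) xb (stdFun Pa Pb lam f Pb i)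
      = -Real.sqrt ((n : ℝ) / m) * wSum (wDev c w.2) xb (stdFun Pa Pb lam f Pb i) := by
    simp only [wSum, Finset.mul_sum, Pi.smul_apply, smul_eq_mul]
    exact Finset.sum_congr rfl fun j _ => by ring
  have hm' : Real.sqrt m ≠ 0 := (Real.sqrt_pos.2 (by exact_mod_cast hm)).ne'
  simp only [stdBoot, vecSum]
  rw [h1]
  unfold stdFun
  rw [wSum_wDev, wSum_wDev, bootProcess, Real.sqrt_div (Nat.cast_nonneg n)]
  field_simp
  ring

/-- The distribution function of the maximum of the standardized two-sample limit. -/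
def boxProb {ι : Type*} [Fintype ι] [DecidableEq ι] (Pa Pb : Measure 𝒳) (lam : ℝ)
    (f : ι → 𝒳 → ℝ) (t : ℝ) : ℝ :=
  (limLaw Pa Pb (stdFun Pa Pb lam f Pa) (stdFun Pa Pb lam f Pb) 1 (lam ^ 2)).real
    {z | ∀ i, z i ≤ t}

lemma boxProb_mono {ι : Type*} [Fintype ι] [DecidableEq ι] (lam : ℝ) (f : ι → 𝒳 → ℝ) {s t : ℝ}
    (h : s ≤ t) : boxProb Pa Pb lam f s ≤ boxProb Pa Pb lam f t :=
  measureReal_mono fun _ hz i => (hz i).trans h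

lemma memLp_stdFun {ι : Type*} (lam : ℝ) (f : ι → 𝒳 → ℝ) {P : Measure 𝒳} [IsProbabilityMeasure P]
    {i : ι} (hf : MemLp (f i) 2 P) : MemLp (stdFun Pa Pb lam f P i) 2 P := by
  have := (hf.sub (memLp_const (∫ z, f i z ∂P))).const_mul
    (Real.sqrt (sigmaSq Pa Pb lam (f i)))⁻¹
  refine this.congr_norm (this.1.congr (.of_forall fun y => ?_)) (.of_forall fun y => ?_)
  all_goals simp [stdFun, inv_mul_eq_div]

lemma measurable_stdFun {ι : Type*} (lam : ℝ) (f : ι → 𝒳 → ℝ) (P : Measure 𝒳)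
    {i : ι} (hf : Measurable (f i)) : Measurable (stdFun Pa Pb lam f P i) :=
  (hf.sub_const _).div_const _

lemma integral_stdFun {ι : Type*} (lam : ℝ) (f : ι → 𝒳 → ℝ) {P : Measure 𝒳}
    [IsProbabilityMeasure P] {i : ι} (hf : MemLp (f i) 2 P) :
    ∫ y, stdFun Pa Pb lam f P i y ∂P = 0 := by
  simp only [stdFun]
  rw [integral_div, integral_sub (hf.integrable (by norm_num)) (integrable_const _)]
  simp

lemma limCov_stdFun {ι : Type*} [Fintype ι] (lam : ℝ) (f : ι → 𝒳 → ℝ) (i j : ι) :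
    limCov Pa Pb (stdFun Pa Pb lam f Pa) (stdFun Pa Pb lam f Pb) 1 (lam ^ 2) i j
      = sigmaCov Pa Pb lam (f i) (f j)
        / (Real.sqrt (sigmaSq Pa Pb lam (f i)) * Real.sqrt (sigmaSq Pa Pb lam (f j))) := by
  have h : ∀ P : Measure 𝒳, gramMat P (stdFun Pa Pb lam f P) i j = cov[f i, f j; P]
      / (Real.sqrt (sigmaSq Pa Pb lam (f i)) * Real.sqrt (sigmaSq Pa Pb lam (f j))) := fun P => by
    simp only [gramMat, Matrix.of_apply, stdFun, covariance]
    rw [← integral_div]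
    congr 1
    ext y
    ring
  simp only [limCov, Matrix.add_apply, Matrix.smul_apply, h, smul_eq_mul, sigmaCov]
  ring

/-! ### Consequences of the Donsker property for the two-sample process -/

/-- The assumptions on the class of functions and on the sample sizes. -/
structure TwoSample (Pa Pb : Measure 𝒳) (F : Set (𝒳 → ℝ)) (na nb : ℕ → ℕ) (lam : ℝ) :
    Prop where
  donsker_a : IsDonsker Pa F
  donsker_b : IsDonsker Pb F
  tendsto_a : Tendsto na atTop atTop
  tendsto_b : Tendsto nb atTop atTop
  tendsto_ratio : Tendsto (fun k => Real.sqrt ((na k : ℝ) / (nb k : ℝ))) atTop (𝓝 lam)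
  sigma : ∃ η : ℝ, 0 < η ∧ ∀ f ∈ F, η ≤ sigmaSq Pa Pb lam f

variable {F : Set (𝒳 → ℝ)} {na nb : ℕ → ℕ} {lam : ℝ}

lemma samplesLaw_union_le [IsProbabilityMeasure Pa] [IsProbabilityMeasure Pb] {n m : ℕ}
    (A : Set (Fin n → 𝒳)) (B : Set (Fin m → 𝒳)) {η : ℝ≥0∞}
    (hA : (Measure.pi fun _ => Pa) A ≤ η) (hB : (Measure.pi fun _ => Pb) B ≤ η) :
    samplesLaw Pa Pb n m {x | x.1 ∈ A ∨ x.2 ∈ B} ≤ 2 * η := by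
  have : {x : (Fin n → 𝒳) × (Fin m → 𝒳) | x.1 ∈ A ∨ x.2 ∈ B}
      ⊆ (A ×ˢ Set.univ) ∪ (Set.univ ×ˢ B) := by
    rintro x (h | h)
    · exact Or.inl ⟨h, trivial⟩
    · exact Or.inr ⟨trivial, h⟩
  refine (measure_mono this).trans ((measure_union_le _ _).trans ?_)
  rw [two_mul]
  refine add_le_add ?_ ?_
  · rw [Measure.prod_prod]
    simpa using hA
  · rw [Measure.prod_prod]
    simpa using hB

namespace TwoSample

variable (h : TwoSample Pa Pb F na nb lam)
include h

lemma lam_nonneg : 0 ≤ lam :=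
  ge_of_tendsto h.tendsto_ratio (.of_forall fun _ => Real.sqrt_nonneg _)

lemma eventually_ratio_lt : ∀ᶠ k in atTop, Real.sqrt ((na k : ℝ) / (nb k : ℝ)) < lam + 1 :=
  h.tendsto_ratio.eventually (gt_mem_nhds (by linarith))

lemma sigma_pos {f : 𝒳 → ℝ} (hf : f ∈ F) : 0 < sigmaSq Pa Pb lam f := by
  obtain ⟨η, hη, hle⟩ := h.sigma
  exact hη.trans_le (hle f hf)

lemma measurable_stdProc {ι : Type*} {f : ι → 𝒳 → ℝ} (hf : ∀ i, f i ∈ F) (n m : ℕ) :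
    Measurable fun x : (Fin n → 𝒳) × (Fin m → 𝒳) => stdProc Pa Pb lam f x.1 x.2 := by
  refine (WithLp.measurable_toLp 2 _).comp (measurable_pi_lambda _ fun i => ?_)
  have hm := h.donsker_a.measurable _ (hf i)
  unfold twoProc empMean
  fun_prop

lemma measurable_stdBoot {ι : Type*} {f : ι → 𝒳 → ℝ} (hf : ∀ i, f i ∈ F) (c : ℝ) (n m : ℕ) :
    Measurable fun z : ((Fin n → 𝒳) × (Fin m → 𝒳)) × ((Fin n → ℝ) × (Fin m → ℝ)) =>
      stdBoot Pa Pb lam c f z.1.1 z.1.2 z.2 := by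
  refine (WithLp.measurable_toLp 2 _).comp (measurable_pi_lambda _ fun i => ?_)
  have hm := h.donsker_a.measurable _ (hf i)
  unfold bootProcess empMean bootMean wBar
  fun_prop

variable [IsProbabilityMeasure Pa] [IsProbabilityMeasure Pb]

lemma exists_bound {η : ℝ≥0∞} (hη : 0 < η) :
    ∃ M : ℝ, ∀ᶠ k in atTop, samplesLaw Pa Pb (na k) (nb k)
      {x | ∃ f ∈ F, M < |twoProc Pa Pb x.1 x.2 f|} ≤ 2 * η := by
  obtain ⟨Ma, ha⟩ := h.donsker_a.exists_bound hη
  obtain ⟨Mb, hb⟩ := h.donsker_b.exists_bound hη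
  refine ⟨Ma + (lam + 1) * |Mb|, ?_⟩
  filter_upwards [h.tendsto_a.eventually ha, h.tendsto_b.eventually hb, h.eventually_ratio_lt,
    h.tendsto_b.eventually_gt_atTop 0] with k h1 h2 h3 h4
  refine (measure_mono ?_).trans (samplesLaw_union_le _ _ h1 h2)
  rintro x ⟨f, hf, hlt⟩
  by_contra hcon
  simp only [Set.mem_ofPred_eq, not_or, not_exists, not_and, not_lt] at hcon
  have k1 := hcon.1 f hf
  have k2 := (hcon.2 f hf).trans (le_abs_self Mb)
  rw [twoProc_eq h4] at hlt
  have k3 := abs_sub (empProcess Pa x.1 f)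
    (Real.sqrt ((na k : ℝ) / nb k) * empProcess Pb x.2 f)
  rw [abs_mul, abs_of_nonneg (Real.sqrt_nonneg _)] at k3
  have k4 := mul_le_mul h3.le k2 (abs_nonneg _) (by linarith [h.lam_nonneg])
  linarith

/-- The two-sample process is asymptotically nearly constant on the cells of a finite partition,
and so are the limiting variances. -/
lemma exists_partition {η : ℝ≥0∞} (hη : 0 < η) (hη8 : η ≤ ENNReal.ofReal (1 / 8)) {ε : ℝ}
    (hε : 0 < ε) : ∃ (N : ℕ) (κ : F → Fin N),
      (∀ f g : F, κ f = κ g → sigmaSq Pa Pb lam (f.1 - g.1) ≤ (1 + lam ^ 2) * (5 * ε ^ 2)) ∧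
      ∀ᶠ k in atTop, samplesLaw Pa Pb (na k) (nb k) {x | ∃ f g : F, κ f = κ g ∧
        (lam + 2) * ε < |twoProc Pa Pb x.1 x.2 f.1 - twoProc Pa Pb x.1 x.2 g.1|} ≤ 2 * η := by
  obtain ⟨Na, κa, ha⟩ := h.donsker_a.exists_partition hη hε
  obtain ⟨Nb, κb, hb⟩ := h.donsker_b.exists_partition hη hε
  -- The common refinement of the one-sample partitions. The requirement `η ≤ 1 / 8` is what turns
  -- closeness of the processes into closeness in variance.
  refine ⟨Na * Nb, fun f => finProdFinEquiv (κa f, κb f), fun f g hfg => ?_, ?_⟩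
  · have hfg' := finProdFinEquiv.injective hfg
    have va : Var[f.1 - g.1; Pa] ≤ 5 * ε ^ 2 := by
      refine variance_sub_le_of_eventually (h.donsker_a.measurable _ f.2)
        (h.donsker_a.measurable _ g.2) (h.donsker_a.sq_integrable _ f.2)
        (h.donsker_a.sq_integrable _ g.2) hε ?_
      filter_upwards [ha] with n hn
      refine le_trans (measure_mono ?_) (hn.trans hη8)
      exact fun x hx => ⟨f, g, congrArg Prod.fst hfg', hx⟩
    have vb : Var[f.1 - g.1; Pb] ≤ 5 * ε ^ 2 := by
      refine variance_sub_le_of_eventually (h.donsker_b.measurable _ f.2)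
        (h.donsker_b.measurable _ g.2) (h.donsker_b.sq_integrable _ f.2)
        (h.donsker_b.sq_integrable _ g.2) hε ?_
      filter_upwards [hb] with n hn
      refine le_trans (measure_mono ?_) (hn.trans hη8)
      exact fun x hx => ⟨f, g, congrArg Prod.snd hfg', hx⟩
    rw [sigmaSq, add_mul, one_mul]
    exact add_le_add va (mul_le_mul_of_nonneg_left vb (sq_nonneg _))
  · filter_upwards [h.tendsto_a.eventually ha, h.tendsto_b.eventually hb, h.eventually_ratio_lt,
      h.tendsto_b.eventually_gt_atTop 0] with k h1 h2 h3 h4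
    refine (measure_mono ?_).trans (samplesLaw_union_le _ _ h1 h2)
    rintro x ⟨f, g, hfg, hlt⟩
    have hfg' := finProdFinEquiv.injective hfg
    by_contra hcon
    simp only [Set.mem_ofPred_eq, not_or, not_exists, not_and, not_lt] at hcon
    have k1 := hcon.1 f g (congrArg Prod.fst hfg')
    have k2 := hcon.2 f g (congrArg Prod.snd hfg')
    rw [twoProc_eq h4, twoProc_eq h4] at hlt
    set r := Real.sqrt ((na k : ℝ) / nb k)
    have k3 : empProcess Pa x.1 f.1 - r * empProcess Pb x.2 f.1
        - (empProcess Pa x.1 g.1 - r * empProcess Pb x.2 g.1)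
        = (empProcess Pa x.1 f.1 - empProcess Pa x.1 g.1)
          - r * (empProcess Pb x.2 f.1 - empProcess Pb x.2 g.1) := by ring
    rw [k3] at hlt
    have k4 := abs_sub (empProcess Pa x.1 f.1 - empProcess Pa x.1 g.1)
      (r * (empProcess Pb x.2 f.1 - empProcess Pb x.2 g.1))
    rw [abs_mul, abs_of_nonneg (Real.sqrt_nonneg _ : 0 ≤ r)] at k4
    have k5 := mul_le_mul h3.le k2 (abs_nonneg _) (by linarith [h.lam_nonneg])
    linarith

lemma tendsto_integral_stdProc {ι : Type*} [Fintype ι] [DecidableEq ι] {f : ι → 𝒳 → ℝ}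
    (hf : ∀ i, f i ∈ F) (φ : EuclideanSpace ℝ ι →ᵇ ℝ) :
    Tendsto (fun k => ∫ x, φ (stdProc Pa Pb lam f x.1 x.2) ∂(samplesLaw Pa Pb (na k) (nb k)))
      atTop (𝓝 (∫ z, φ z ∂(limLaw Pa Pb (stdFun Pa Pb lam f Pa) (stdFun Pa Pb lam f Pb) 1
        (lam ^ 2)))) := by
  refine (tendsto_integral_empirical Pa Pb
    (fun i => measurable_stdFun lam f Pa (h.donsker_a.measurable _ (hf i)))
    (fun i => measurable_stdFun lam f Pb (h.donsker_a.measurable _ (hf i)))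
    (fun i => memLp_stdFun lam f (h.donsker_a.sq_integrable _ (hf i)))
    (fun i => memLp_stdFun lam f (h.donsker_b.sq_integrable _ (hf i)))
    (fun i => integral_stdFun lam f (h.donsker_a.sq_integrable _ (hf i)))
    (fun i => integral_stdFun lam f (h.donsker_b.sq_integrable _ (hf i)))
    h.tendsto_a h.tendsto_b h.tendsto_ratio φ).congr' ?_
  filter_upwards [h.tendsto_b.eventually_gt_atTop 0] with k hk
  simp only [stdProc_eq_vecSum lam f hk]

lemma tendsto_integral_stdBoot_sq {ι : Type*} [Fintype ι] [DecidableEq ι] {f : ι → 𝒳 → ℝ}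
    (hf : ∀ i, f i ∈ F) {c : ℝ} (hc : 0 < c) {νa νb : ∀ n : ℕ, Measure (Fin n → ℝ)}
    (hνa : IsWeightLaw νa c) (hνb : IsWeightLaw νb c) (φ : EuclideanSpace ℝ ι →ᵇ ℝ) :
    Tendsto (fun k => ∫ x, (∫ w, φ (stdBoot Pa Pb lam c f x.1 x.2 w)
        ∂((νa (na k)).prod (νb (nb k))) - ∫ z, φ z ∂(limLaw Pa Pb (stdFun Pa Pb lam f Pa)
          (stdFun Pa Pb lam f Pb) 1 (lam ^ 2))) ^ 2
        ∂(samplesLaw Pa Pb (na k) (nb k))) atTop (𝓝 0) := by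
  refine (tendsto_integral_bootstrap_sq Pa Pb (ga := stdFun Pa Pb lam f Pa)
    (gb := stdFun Pa Pb lam f Pb)
    (fun i => measurable_stdFun lam f Pa (h.donsker_a.measurable _ (hf i)))
    (fun i => measurable_stdFun lam f Pb (h.donsker_a.measurable _ (hf i)))
    (fun i => memLp_stdFun lam f (h.donsker_a.sq_integrable _ (hf i)))
    (fun i => memLp_stdFun lam f (h.donsker_b.sq_integrable _ (hf i)))
    (fun i => integral_stdFun lam f (h.donsker_a.sq_integrable _ (hf i)))
    (fun i => integral_stdFun lam f (h.donsker_b.sq_integrable _ (hf i)))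
    h.tendsto_a h.tendsto_b h.tendsto_ratio hc hνa hνb φ).congr' ?_
  filter_upwards [h.tendsto_b.eventually_gt_atTop 0] with k hk
  simp only [stdBoot_eq_vecSum lam c f hk]

end TwoSample

end

section

variable {𝒳 : Type*} [MeasurableSpace 𝒳] {Pa Pb : Measure 𝒳}

/-! ### The limiting distribution functions on finite subclasses -/

lemma exists_boxProb_lt (lam : ℝ) (f : Fin 1 → 𝒳 → ℝ) {p : ℝ} (hp : 0 < p) :
    ∃ t : ℝ, boxProb Pa Pb lam f t < p := by
  set γ := limLaw Pa Pb (stdFun Pa Pb lam f Pa) (stdFun Pa Pb lam f Pb) 1 (lam ^ 2)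
  have mev : Measurable fun z : EuclideanSpace ℝ (Fin 1) => z 0 := by fun_prop
  have : IsProbabilityMeasure (γ.map fun z => z 0) :=
    Measure.isProbabilityMeasure_map mev.aemeasurable
  obtain ⟨t, ht⟩ := ((tendsto_cdf_atBot (γ.map fun z => z 0)).eventually (gt_mem_nhds hp)).exists
  refine ⟨t, ?_⟩
  rw [cdf_eq_real, map_measureReal_apply mev measurableSet_Iic] at ht
  refine lt_of_le_of_lt (measureReal_mono ?_) ht
  exact fun z hz => hz 0

variable [IsProbabilityMeasure Pa] [IsProbabilityMeasure Pb]
  {F : Set (𝒳 → ℝ)} {na nb : ℕ → ℕ} {lam : ℝ}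

namespace TwoSample

/-- The whole two-sample process is stochastically bounded and the standard deviations are bounded
below; passing to the weak limit gives one level for all finite subclasses. It bounds the thresholds
above. -/
lemma exists_boxProb_ge (h : TwoSample Pa Pb F na nb lam) {α : ℝ} (hα : 0 < α) :
    ∃ t : ℝ, ∀ (m : ℕ) (f : Fin m → 𝒳 → ℝ), (∀ i, f i ∈ F) → 1 - α ≤ boxProb Pa Pb lam f t := by
  obtain ⟨M, hM⟩ := h.exists_bound (η := ENNReal.ofReal (α / 2)) (by simpa using hα)
  obtain ⟨η₀, hη₀, hle⟩ := h.sigma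
  have hs0 : 0 < Real.sqrt η₀ := Real.sqrt_pos.2 hη₀
  refine ⟨|M| / Real.sqrt η₀ + 1, fun m f hf => ?_⟩
  refine le_trans ?_ (integral_boxTest_le _ _ one_pos)
  refine ge_of_tendsto (h.tendsto_integral_stdProc hf _) ?_
  filter_upwards [hM] with k hk
  set S := {x : (Fin (na k) → 𝒳) × (Fin (nb k) → 𝒳) |
    ∀ i, stdProc Pa Pb lam f x.1 x.2 i ≤ |M| / Real.sqrt η₀} with hS
  have mS : MeasurableSet S :=
    (h.measurable_stdProc hf (na k) (nb k)) (measurableSet_box (|M| / Real.sqrt η₀))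
  have h1 : (samplesLaw Pa Pb (na k) (nb k)).real Sᶜ ≤ α := by
    refine ENNReal.toReal_le_of_le_ofReal hα.le ((measure_mono ?_).trans (hk.trans ?_))
    · intro x hx
      simp only [hS, Set.mem_compl_iff, Set.mem_ofPred_eq, not_forall, not_le] at hx
      obtain ⟨i, hi⟩ := hx
      refine ⟨f i, hf i, ?_⟩
      have hsi : Real.sqrt η₀ ≤ Real.sqrt (sigmaSq Pa Pb lam (f i)) :=
        Real.sqrt_le_sqrt (hle _ (hf i))
      change _ < twoProc Pa Pb x.1 x.2 (f i) / Real.sqrt (sigmaSq Pa Pb lam (f i)) at hi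
      rw [lt_div_iff₀ (hs0.trans_le hsi)] at hi
      have h2 : |M| ≤ |M| / Real.sqrt η₀ * Real.sqrt (sigmaSq Pa Pb lam (f i)) := by
        rw [div_mul_eq_mul_div, le_div_iff₀ hs0]
        exact mul_le_mul_of_nonneg_left hsi (abs_nonneg _)
      exact (le_abs_self M).trans_lt (h2.trans_lt (hi.trans_le (le_abs_self _)))
    · rw [← ENNReal.ofReal_ofNat, ← ENNReal.ofReal_mul (by norm_num)]
      exact ENNReal.ofReal_le_ofReal (by linarith)
  have h3 : (samplesLaw Pa Pb (na k) (nb k)).real S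
      ≤ ∫ x, boxTest (Fin m) (|M| / Real.sqrt η₀) 1 (stdProc Pa Pb lam f x.1 x.2)
        ∂(samplesLaw Pa Pb (na k) (nb k)) := by
    rw [← integral_indicator_one mS]
    refine integral_mono ((integrable_const (1 : ℝ)).indicator mS)
      (Integrable.of_bound (C := 1) ((BoundedContinuousFunction.continuous _).measurable.comp
        (h.measurable_stdProc hf _ _)).aestronglyMeasurable (.of_forall fun x => ?_)) fun x => ?_
    · rw [Real.norm_eq_abs, abs_of_nonneg (boxTest_nonneg _ _ _)]
      exact boxTest_le_one _ _ _
    · by_cases hx : x ∈ S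
      · rw [Set.indicator_of_mem hx]
        simp only
        rw [boxTest_eq_one one_pos hx]
        rfl
      · rw [Set.indicator_of_notMem hx]
        exact boxTest_nonneg _ _ _
  rw [probReal_compl_eq_one_sub mS] at h1
  linarith

/-- If `σ²` of `f - g` is at most the lower bound `η₀` of the variances, then twice the covariance
is at least `2 σ_f σ_g - η₀ ≥ σ_f σ_g`, so the correlation is at least `1 / 2`. One partition of `F`
into such cells serves every finite subclass, which makes the constant uniform. -/
lemma exists_boxProb_le_add (h : TwoSample Pa Pb F na nb lam) :
    ∃ L : ℝ, 0 < L ∧ ∀ (m : ℕ) (f : Fin m → 𝒳 → ℝ), (∀ i, f i ∈ F) → ∀ a b : ℝ, a ≤ b →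
      boxProb Pa Pb lam f b ≤ boxProb Pa Pb lam f a + L * (b - a) := by
  obtain ⟨η₀, hη₀, hle⟩ := h.sigma
  have hl : 0 < 1 + lam ^ 2 := by positivity
  obtain ⟨N, κ, hκ, -⟩ := h.exists_partition (η := ENNReal.ofReal (1 / 8)) (by simp) le_rfl
    (ε := Real.sqrt (η₀ / (5 * (1 + lam ^ 2)))) (Real.sqrt_pos.2 (by positivity))
  rw [Real.sq_sqrt (by positivity)] at hκ
  have hcell : (1 + lam ^ 2) * (5 * (η₀ / (5 * (1 + lam ^ 2)))) = η₀ := by field_simp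
  rw [hcell] at hκ
  -- The `+ 1` only ensures positivity when there are no cells.
  refine ⟨2 * N + 1, by positivity, fun m f hf a b hab => ?_⟩
  have La := fun i => h.donsker_a.sq_integrable _ (hf i)
  have Lb := fun i => h.donsker_b.sq_integrable _ (hf i)
  have hpos := fun i => h.sigma_pos (hf i)
  have hPSD := posSemidef_limCov (fun i => memLp_stdFun (Pa := Pa) (Pb := Pb) lam f (La i))
    (fun i => memLp_stdFun (Pa := Pa) (Pb := Pb) lam f (Lb i)) zero_le_one (sq_nonneg lam)
  have key := measure_max_le_add hPSD (fun i => κ ⟨f i, hf i⟩) (fun i => ?_) (fun i j hij => ?_) a b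
  · have h1 := ENNReal.toReal_mono (by finiteness) key
    rw [ENNReal.toReal_add (by finiteness) (by finiteness), ENNReal.toReal_mul,
      ENNReal.toReal_ofReal (by linarith), ENNReal.toReal_natCast] at h1
    refine h1.trans ?_
    change boxProb Pa Pb lam f a + _ ≤ _
    nlinarith
  · rw [limCov_stdFun, Real.mul_self_sqrt (hpos i).le]
    have h2 : sigmaCov Pa Pb lam (f i) (f i) = sigmaSq Pa Pb lam (f i) := by
      have hm := h.donsker_a.measurable _ (hf i)
      rw [sigmaCov, covariance_self hm.aemeasurable, covariance_self hm.aemeasurable, sigmaSq]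
    rw [h2, div_self (hpos i).ne']
  · rw [limCov_stdFun, le_div_iff₀ (mul_pos (Real.sqrt_pos.2 (hpos i)) (Real.sqrt_pos.2 (hpos j)))]
    have h3 := hκ _ _ hij
    rw [sigmaSq_sub lam (La i) (Lb i) (La j) (Lb j)] at h3
    have hi2 := Real.sq_sqrt (hpos i).le
    have hj2 := Real.sq_sqrt (hpos j).le
    have hi3 := Real.sqrt_le_sqrt (hle _ (hf i))
    have hj3 := Real.sqrt_le_sqrt (hle _ (hf j))
    have h0 := Real.sqrt_nonneg η₀
    have h4 := mul_le_mul hi3 hj3 h0 (h0.trans hi3)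
    rw [Real.mul_self_sqrt hη₀.le] at h4
    nlinarith [sq_nonneg (Real.sqrt (sigmaSq Pa Pb lam (f i))
      - Real.sqrt (sigmaSq Pa Pb lam (f j)))]

/-- A common approximate quantile of the maxima over finite subclasses. -/
lemma exists_threshold (h : TwoSample Pa Pb F na nb lam) (hF : F.Nonempty) {α : ℝ} (hα0 : 0 < α)
    (hα1 : α < 1) : ∃ τ : ℝ, ∀ ε : ℝ, 0 < ε →
      (∃ (m : ℕ) (f : Fin m → 𝒳 → ℝ), (∀ i, f i ∈ F) ∧ boxProb Pa Pb lam f (τ - ε) < 1 - α) ∧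
      ∀ (m : ℕ) (f : Fin m → 𝒳 → ℝ), (∀ i, f i ∈ F) → 1 - α ≤ boxProb Pa Pb lam f (τ + ε) := by
  -- Levels at which some finite maximum has distribution function below `1 - α`; `A` is downward
  -- closed, and `τ` is its supremum.
  set A : Set ℝ := {t | ∃ (m : ℕ) (f : Fin m → 𝒳 → ℝ), (∀ i, f i ∈ F) ∧
    boxProb Pa Pb lam f t < 1 - α} with hA
  obtain ⟨f₀, hf₀⟩ := hF
  have hne : A.Nonempty := by
    obtain ⟨t, ht⟩ := exists_boxProb_lt (Pa := Pa) (Pb := Pb) lam (fun _ => f₀)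
      (sub_pos.2 hα1)
    exact ⟨t, 1, fun _ => f₀, fun _ => hf₀, ht⟩
  have hbdd : BddAbove A := by
    obtain ⟨t, ht⟩ := h.exists_boxProb_ge hα0
    refine ⟨t, ?_⟩
    rintro s ⟨m, f, hf, hs⟩
    by_contra hcon
    exact absurd (((ht m f hf).trans (boxProb_mono lam f (not_le.1 hcon).le)).trans_lt hs)
      (lt_irrefl _)
  refine ⟨sSup A, fun ε hε => ⟨?_, fun m f hf => ?_⟩⟩
  · obtain ⟨s, ⟨m, f, hf, hs⟩, hlt⟩ := exists_lt_of_lt_csSup hne (sub_lt_self (sSup A) hε)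
    exact ⟨m, f, hf, (boxProb_mono lam f hlt.le).trans_lt hs⟩
  · by_contra hcon
    have := le_csSup hbdd (show sSup A + ε ∈ A from ⟨m, f, hf, not_le.1 hcon⟩)
    linarith

/-- The two-sample process exceeds a threshold with at most the probability that the limit on some
finite subclass does, up to an error. -/
lemma exists_eventually_exceed_le (h : TwoSample Pa Pb F na nb lam) (hF : F.Nonempty) (t : ℝ)
    {ε β : ℝ} (hε : 0 < ε) (hβ : 0 < β) :
    ∃ (m : ℕ) (f : Fin m → 𝒳 → ℝ), (∀ i, f i ∈ F) ∧ ∀ᶠ k in atTop,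
      samplesLaw Pa Pb (na k) (nb k)
        {x | ∃ g ∈ F, Real.sqrt (sigmaSq Pa Pb lam g) * t < twoProc Pa Pb x.1 x.2 g}
      ≤ ENNReal.ofReal (1 - boxProb Pa Pb lam f (t - 2 * ε) + β) := by
  obtain ⟨η₀, hη₀, hle⟩ := h.sigma
  have hs0 : 0 < Real.sqrt η₀ := Real.sqrt_pos.2 hη₀
  have hlam := h.lam_nonneg
  set D := Real.sqrt ((1 + lam ^ 2) * 5) with hD
  have hD0 : 0 ≤ D := Real.sqrt_nonneg _
  -- Moving from a function to the representative of its cell changes the standard deviation by at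
  -- most `D * ε₁`, which is multiplied by `t`, and the process by at most `(lam + 2) * ε₁`. The
  -- choice of `ε₁` makes the total `√η₀ * ε`, at most `ε` after standardization.
  set B := D * |t| + (lam + 2) with hB
  have hB0 : 0 < B := by positivity
  set ε₁ := Real.sqrt η₀ * ε / B with hε₁
  have hε₁0 : 0 < ε₁ := by positivity
  set η := min (ENNReal.ofReal (1 / 8)) (ENNReal.ofReal (β / 4)) with hη
  have hη0 : 0 < η := lt_min (by simp) (by simpa using hβ)
  obtain ⟨N, κ, hκ, hosc⟩ := h.exists_partition hη0 (min_le_left _ _) hε₁0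
  have : Nonempty F := hF.to_subtype
  -- One representative per cell; an empty cell receives an arbitrary member of `F`, which does no
  -- harm.
  set f : Fin N → 𝒳 → ℝ := fun c => (Function.invFun κ c).1 with hf
  have hfF : ∀ c, f c ∈ F := fun c => (Function.invFun κ c).2
  refine ⟨N, f, hfF, ?_⟩
  have hlim := h.tendsto_integral_stdProc hfF (boxTest (Fin N) (t - 2 * ε) ε)
  have hlow := le_integral_boxTest (limLaw Pa Pb (stdFun Pa Pb lam f Pa) (stdFun Pa Pb lam f Pb) 1
        (lam ^ 2)) (t - 2 * ε) hε
  have hev := hlim.eventually (lt_mem_nhds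
    ((sub_lt_self (boxProb Pa Pb lam f (t - 2 * ε)) (half_pos hβ)).trans_le hlow))
  filter_upwards [hosc, hev] with k h1 h2
  set φ : (Fin (na k) → 𝒳) × (Fin (nb k) → 𝒳) → ℝ := fun x =>
    boxTest (Fin N) (t - 2 * ε) ε (stdProc Pa Pb lam f x.1 x.2) with hφ
  have mφ : Measurable φ := (BoundedContinuousFunction.continuous _).measurable.comp
    (h.measurable_stdProc hfF _ _)
  have hφ0 : ∀ x, 0 ≤ φ x := fun x => boxTest_nonneg _ _ _
  have hφ1 : ∀ x, φ x ≤ 1 := fun x => boxTest_le_one _ _ _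
  have iφ : Integrable φ (samplesLaw Pa Pb (na k) (nb k)) :=
    Integrable.of_bound (C := 1) mφ.aestronglyMeasurable (.of_forall fun x => by
      rw [Real.norm_eq_abs, abs_of_nonneg (hφ0 x)]
      exact hφ1 x)
  have hbox : samplesLaw Pa Pb (na k) (nb k) {x | 1 ≤ 1 - φ x}
      ≤ ENNReal.ofReal (1 - boxProb Pa Pb lam f (t - 2 * ε) + β / 2) := by
    have hm := mul_meas_ge_le_integral_of_nonneg (μ := samplesLaw Pa Pb (na k) (nb k))
      (f := fun x => 1 - φ x) (.of_forall fun x => sub_nonneg.2 (hφ1 x))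
      ((integrable_const 1).sub iφ) 1
    rw [integral_sub (integrable_const _) iφ, one_mul] at hm
    simp only [integral_const, probReal_univ, smul_eq_mul, mul_one] at hm
    rw [← ofReal_measureReal]
    exact ENNReal.ofReal_le_ofReal (by linarith)
  have hb1 : boxProb Pa Pb lam f (t - 2 * ε) ≤ 1 := measureReal_le_one
  have hη2 : 2 * η ≤ ENNReal.ofReal (β / 2) := by
    calc 2 * η ≤ 2 * ENNReal.ofReal (β / 4) := mul_le_mul_right (min_le_right _ _) _
      _ = ENNReal.ofReal (β / 2) := by
        rw [← ENNReal.ofReal_ofNat, ← ENNReal.ofReal_mul (by norm_num)]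
        congr 1
        ring
  have hsum : ENNReal.ofReal (1 - boxProb Pa Pb lam f (t - 2 * ε) + β)
      = ENNReal.ofReal (β / 2) + ENNReal.ofReal (1 - boxProb Pa Pb lam f (t - 2 * ε) + β / 2) := by
    rw [← ENNReal.ofReal_add (by linarith) (by linarith)]
    congr 1
    ring
  rw [hsum]
  refine (measure_mono ?_).trans ((measure_union_le _ _).trans
    (add_le_add (h1.trans hη2) hbox))
  rintro x ⟨g, hg, hlt⟩
  by_contra hcon
  simp only [Set.mem_union, Set.mem_ofPred_eq, not_or, not_exists, not_and, not_lt, not_le] at hcon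
  set c := κ ⟨g, hg⟩ with hc
  have hκc : κ (Function.invFun κ c) = c := Function.invFun_eq ⟨⟨g, hg⟩, rfl⟩
  have k1 := hcon.1 ⟨g, hg⟩ (Function.invFun κ c) hκc.symm
  have k2 := hκ ⟨g, hg⟩ (Function.invFun κ c) hκc.symm
  change |twoProc Pa Pb x.1 x.2 g - twoProc Pa Pb x.1 x.2 (f c)| ≤ _ at k1
  change sigmaSq Pa Pb lam (g - f c) ≤ _ at k2
  have k3 := abs_sqrt_sigmaSq_sub_le lam (h.donsker_a.sq_integrable _ hg)
    (h.donsker_b.sq_integrable _ hg) (h.donsker_a.sq_integrable _ (hfF c))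
    (h.donsker_b.sq_integrable _ (hfF c)) (h.sigma_pos (hfF c))
  have k4 : Real.sqrt (sigmaSq Pa Pb lam (g - f c)) ≤ D * ε₁ := by
    refine (Real.sqrt_le_sqrt k2).trans ?_
    rw [← mul_assoc, Real.sqrt_mul (by positivity), Real.sqrt_sq hε₁0.le]
  have k5 : Real.sqrt η₀ ≤ Real.sqrt (sigmaSq Pa Pb lam (f c)) :=
    Real.sqrt_le_sqrt (hle _ (hfF c))
  have k6 : ε₁ * B = Real.sqrt η₀ * ε := by rw [hε₁]; field_simp
  have hσ : 0 < Real.sqrt (sigmaSq Pa Pb lam (f c)) := hs0.trans_le k5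
  have k7 : |(Real.sqrt (sigmaSq Pa Pb lam g) - Real.sqrt (sigmaSq Pa Pb lam (f c))) * t|
      ≤ D * ε₁ * |t| := by
    rw [abs_mul]
    exact mul_le_mul_of_nonneg_right (k3.trans k4) (abs_nonneg _)
  -- An exceedance of `t` somewhere in the cell forces its representative to at least `t - ε`, where
  -- the box test is already `0`.
  have k8 : Real.sqrt (sigmaSq Pa Pb lam (f c)) * (t - ε) ≤ twoProc Pa Pb x.1 x.2 (f c) := by
    have a1 := (abs_le.1 k7).1
    have a2 := (abs_le.1 k1).2
    have a3 := mul_le_mul_of_nonneg_right k5 hε.le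
    have a4 : D * ε₁ * |t| + (lam + 2) * ε₁ = Real.sqrt η₀ * ε := by rw [← k6, hB]; ring
    nlinarith
  have k9 : φ x = 0 := by
    refine boxTest_eq_zero hε (i := c) ?_
    change _ ≤ twoProc Pa Pb x.1 x.2 (f c) / Real.sqrt (sigmaSq Pa Pb lam (f c))
    rw [le_div_iff₀ hσ]
    linarith
  have := hcon.2
  linarith

end TwoSample

end

section

variable {𝒳 : Type*} [MeasurableSpace 𝒳] {Ω : Type*} [MeasurableSpace Ω] {μ : Measure Ω}

/-! ### Laws of the samples -/

section Laws

lemma aemeasurable_sample {Y : ℕ → Ω → 𝒳} {P : Measure 𝒳} (hY : ∀ i, HasLaw (Y i) P μ) (n : ℕ) :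
    AEMeasurable (sample Y n) μ :=
  aemeasurable_pi_lambda _ fun i => (hY i).aemeasurable

variable [IsProbabilityMeasure μ]

lemma map_sample {Y : ℕ → Ω → 𝒳} {P : Measure 𝒳} (hY : ∀ i, HasLaw (Y i) P μ)
    (hind : iIndepFun Y μ) (n : ℕ) : μ.map (sample Y n) = Measure.pi fun _ => P := by
  have h1 : iIndepFun (fun i : Fin n => Y i) μ := hind.precomp Fin.val_injective
  have h2 := (iIndepFun_iff_map_fun_eq_pi_map fun i : Fin n => (hY i).aemeasurable).1 h1
  simp only [(hY _).map_eq] at h2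
  exact h2

lemma map_samples {Ya Yb : ℕ → Ω → 𝒳} {Pa Pb : Measure 𝒳}
    (hYa : ∀ i, HasLaw (Ya i) Pa μ) (hYb : ∀ i, HasLaw (Yb i) Pb μ)
    (hYa_indep : iIndepFun Ya μ) (hYb_indep : iIndepFun Yb μ)
    (hY_indep : IndepFun (fun ω i => Ya i ω) (fun ω i => Yb i ω) μ) (n m : ℕ) :
    μ.map (fun ω => (sample Ya n ω, sample Yb m ω)) = samplesLaw Pa Pb n m := by
  have hr : ∀ n : ℕ, Measurable fun (y : ℕ → 𝒳) (i : Fin n) => y i := fun n =>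
    measurable_pi_lambda _ fun i => measurable_pi_apply _
  have hind : IndepFun (sample Ya n) (sample Yb m) μ := hY_indep.comp (hr n) (hr m)
  rw [(indepFun_iff_map_prod_eq_prod_map_map (aemeasurable_sample hYa n)
    (aemeasurable_sample hYb m)).1 hind, map_sample hYa hYa_indep, map_sample hYb hYb_indep]

end Laws

lemma tendsto_measure_of_tendsto_integral_sq {S : ℕ → Type*}
    [∀ k, MeasurableSpace (S k)] (X : ∀ k, Measure (S k)) [∀ k, IsProbabilityMeasure (X k)]
    (g : ∀ k, Ω → S k) (hg : ∀ k, AEMeasurable (g k) μ) (hX : ∀ k, μ.map (g k) = X k)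
    (q : ∀ k, S k → ℝ) (hq : ∀ k, Measurable (q k)) (hq0 : ∀ k x, 0 ≤ q k x)
    (hq1 : ∀ k x, q k x ≤ 1) {I θ : ℝ} (hθ : I < θ)
    (h : Tendsto (fun k => ∫ x, (q k x - I) ^ 2 ∂(X k)) atTop (𝓝 0)) :
    Tendsto (fun k => μ {ω | θ ≤ q k (g k ω)}) atTop (𝓝 0) := by
  have hd : 0 < (θ - I) ^ 2 := by
    have := sub_pos.2 hθ
    positivity
  have hlim : Tendsto (fun k => ENNReal.ofReal ((∫ x, (q k x - I) ^ 2 ∂(X k)) / (θ - I) ^ 2))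
      atTop (𝓝 0) := by
    rw [← ENNReal.ofReal_zero]
    refine ENNReal.tendsto_ofReal ?_
    simpa using h.div_const ((θ - I) ^ 2)
  refine tendsto_of_tendsto_of_tendsto_of_le_of_le tendsto_const_nhds hlim (fun _ => zero_le)
    fun k => ?_
  have hint : Integrable (fun x => (q k x - I) ^ 2) (X k) := by
    refine Integrable.of_bound (((hq k).sub_const I).pow_const 2).aestronglyMeasurable
      ((1 + |I|) ^ 2) (.of_forall fun x => ?_)
    rw [norm_pow, Real.norm_eq_abs]
    refine pow_le_pow_left₀ (abs_nonneg _) ((abs_sub _ _).trans ?_) 2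
    rw [abs_of_nonneg (hq0 k x)]
    linarith [hq1 k x]
  have hm := mul_meas_ge_le_integral_of_nonneg (μ := X k) (f := fun x => (q k x - I) ^ 2)
    (.of_forall fun x => sq_nonneg _) hint ((θ - I) ^ 2)
  calc μ {ω | θ ≤ q k (g k ω)} ≤ μ.map (g k) {x | θ ≤ q k x} :=
        Measure.le_map_apply (hg k) {x | θ ≤ q k x}
    _ ≤ X k {x | (θ - I) ^ 2 ≤ (q k x - I) ^ 2} := by
        rw [hX k]
        refine measure_mono fun x hx => ?_
        have hx' : θ ≤ q k x := hx
        exact pow_le_pow_left₀ (sub_nonneg.2 hθ.le) (by linarith) 2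
    _ ≤ _ := by
        rw [← ofReal_measureReal]
        refine ENNReal.ofReal_le_ofReal ?_
        rw [le_div_iff₀ hd, mul_comm]
        exact hm

lemma measurable_average {S V : Type*} [MeasurableSpace S] [MeasurableSpace V] (b : S → V → ℝ)
    (hb : Measurable (Function.uncurry b)) (R : ℕ) :
    Measurable fun z : S × (Fin R → V) => (R : ℝ)⁻¹ * ∑ r, b z.1 (z.2 r) := by
  refine Measurable.const_mul (Finset.measurable_fun_sum _ fun r _ => ?_) _
  exact hb.comp (measurable_fst.prodMk ((measurable_pi_apply r).comp measurable_snd))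

/-! ### Plugging in the estimated standard deviations -/

/-- Replacing an estimated by a true standard deviation shifts a fixed level by at most `ε`,
uniformly over `σ ≥ σ₀`. One inequality serves the bootstrap supremum, the other the test statistic.
-/
lemma exists_scale {σ₀ : ℝ} (hσ₀ : 0 < σ₀) (u : ℝ) {ε : ℝ} (hε : 0 < ε) :
    ∃ κ : ℝ, 0 < κ ∧ ∀ σ s : ℝ, σ₀ ≤ σ → |s - σ| ≤ κ →
      0 < s ∧ s * u ≤ σ * (u + ε) ∧ σ * (u - ε) ≤ s * u := by
  refine ⟨min (σ₀ / 2) (σ₀ * ε / (|u| + 1)), by positivity, fun σ s hσ hs => ?_⟩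
  have h1 := hs.trans (min_le_left _ _)
  have h2 := hs.trans (min_le_right _ _)
  rw [le_div_iff₀ (by positivity)] at h2
  have h3 : |(s - σ) * u| ≤ σ * ε := by
    rw [abs_mul]
    have := mul_le_mul_of_nonneg_right hσ hε.le
    nlinarith [abs_nonneg (s - σ)]
  have h4 := abs_le.1 h1
  have h5 := abs_le.1 h3
  refine ⟨by linarith [h4.1], by nlinarith [h5.2], by nlinarith [h5.1]⟩

namespace TwoSample

variable {Pa Pb : Measure 𝒳}
  {F : Set (𝒳 → ℝ)} {na nb : ℕ → ℕ} {lam : ℝ}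

/-- When the estimated standard deviations are accurate, a bootstrap supremum below a threshold
forces the standardized bootstrap process on a finite subclass below a slightly larger one. -/
lemma exists_forall_boxTest_eq_one (h : TwoSample Pa Pb F na nb lam) (c u : ℝ) {ε : ℝ}
    (hε : 0 < ε) : ∃ κ : ℝ, 0 < κ ∧ ∀ (m : ℕ) (f : Fin m → 𝒳 → ℝ), (∀ i, f i ∈ F) →
      ∀ (s : (𝒳 → ℝ) → ℝ), (∀ g ∈ F, |s g - Real.sqrt (sigmaSq Pa Pb lam g)| ≤ κ) →
      ∀ (n l : ℕ) (xa : Fin n → 𝒳) (xb : Fin l → 𝒳) (w : (Fin n → ℝ) × (Fin l → ℝ)),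
        bootSup F c s xa xb w ≤ (u : EReal) →
        boxTest (Fin m) (u + ε) ε (stdBoot Pa Pb lam c f xa xb w) = 1 := by
  obtain ⟨η₀, hη₀, hle⟩ := h.sigma
  obtain ⟨κ, hκ, H⟩ := exists_scale (Real.sqrt_pos.2 hη₀) u hε
  refine ⟨κ, hκ, fun m f hf s hs n l xa xb w hsup => boxTest_eq_one hε fun i => ?_⟩
  obtain ⟨hs0, hsu, -⟩ := H _ _ (Real.sqrt_le_sqrt (hle _ (hf i))) (hs _ (hf i))
  -- The supremum over `F` enters only as an upper bound for its value on the finite subclass.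
  have h1 : ((bootProcess c xa xb w (f i) / s (f i) : ℝ) : EReal) ≤ (u : EReal) :=
    (le_iSup₂ (f := fun g (_ : g ∈ F) => ((bootProcess c xa xb w g / s g : ℝ) : EReal))
      (f i) (hf i)).trans hsup
  rw [EReal.coe_le_coe_iff, div_le_iff₀ hs0] at h1
  change bootProcess c xa xb w (f i) / Real.sqrt (sigmaSq Pa Pb lam (f i)) ≤ u + ε
  rw [div_le_iff₀ (Real.sqrt_pos.2 (h.sigma_pos (hf i)))]
  linarith

variable [IsProbabilityMeasure Pa] [IsProbabilityMeasure Pb]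

/-! ### Asymptotic lower bounds for the bootstrap and simulated critical values. -/

section Critical

variable [IsProbabilityMeasure μ] {Ya Yb : ℕ → Ω → 𝒳}
  (hYa : ∀ i, HasLaw (Ya i) Pa μ) (hYb : ∀ i, HasLaw (Yb i) Pb μ)
  (hYa_indep : iIndepFun Ya μ) (hYb_indep : iIndepFun Yb μ)
  (hY_indep : IndepFun (fun ω i => Ya i ω) (fun ω i => Yb i ω) μ)
  {sigmaHat : ℕ → Ω → (𝒳 → ℝ) → ℝ}
  (hsigmaHat : ∀ ε : ℝ, 0 < ε → Tendsto
      (fun k => μ {ω | ∃ f ∈ F,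
        ε < |sigmaHat k ω f - Real.sqrt (sigmaSq Pa Pb lam f)|}) atTop (𝓝 0))
  {c : ℝ} (hc : 0 < c) {νa νb : ∀ n : ℕ, Measure (Fin n → ℝ)}
  (hνa : IsWeightLaw νa c) (hνb : IsWeightLaw νb c)

include hYa hYb hYa_indep hYb_indep hY_indep hsigmaHat hc hνa hνb

/-- The bootstrap critical value is not much smaller than any number that the limit on some finite
subclass exceeds with probability larger than `α`. -/
lemma tendsto_measure_bootCrit_lt (h : TwoSample Pa Pb F na nb lam) {m : ℕ}
    {f : Fin m → 𝒳 → ℝ} (hf : ∀ i, f i ∈ F) {t p : ℝ} (ht : boxProb Pa Pb lam f t < p) {ε : ℝ}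
    (hε : 0 < ε) :
    Tendsto (fun k => μ {ω | bootCrit νa νb F c (sigmaHat k ω) (sample Ya (na k) ω)
      (sample Yb (nb k) ω) p < ((t - 2 * ε : ℝ) : EReal)}) atTop (𝓝 0) := by
  have := hνa.prob
  have := hνb.prob
  obtain ⟨κ, hκ, H⟩ := h.exists_forall_boxTest_eq_one c (t - 2 * ε) hε
  set φ := boxTest (Fin m) (t - 2 * ε + ε) ε with hφ
  have hI : ∫ z, φ z ∂(limLaw Pa Pb (stdFun Pa Pb lam f Pa) (stdFun Pa Pb lam f Pb) 1 (lam ^ 2))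
      < p := by
    refine (integral_boxTest_le _ _ hε).trans_lt ?_
    have : t - 2 * ε + ε + ε = t := by ring
    rw [this]
    exact ht
  set b : ∀ k, ((Fin (na k) → 𝒳) × (Fin (nb k) → 𝒳)) → ((Fin (na k) → ℝ) × (Fin (nb k) → ℝ)) → ℝ :=
    fun k x w => φ (stdBoot Pa Pb lam c f x.1 x.2 w) with hb
  have mb : ∀ k, Measurable (Function.uncurry (b k)) := fun k =>
    φ.continuous.measurable.comp (h.measurable_stdBoot hf c _ _)
  have ib : ∀ k x, Integrable (b k x) ((νa (na k)).prod (νb (nb k))) := fun k x =>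
    Integrable.of_bound (C := 1) ((mb k).comp measurable_prodMk_left).aestronglyMeasurable
      (.of_forall fun w => by
        rw [Real.norm_eq_abs, abs_of_nonneg (boxTest_nonneg _ _ _)]
        exact boxTest_le_one _ _ _)
  have hψ1 : ∀ k x, ∫ w, b k x w ∂((νa (na k)).prod (νb (nb k))) ≤ 1 := fun k x => by
    have := integral_mono (ib k x) (integrable_const (1 : ℝ)) fun w => boxTest_le_one _ _ _
    simpa using this
  have hT := tendsto_measure_of_tendsto_integral_sq (μ := μ)
    (fun k => samplesLaw Pa Pb (na k) (nb k))
    (fun k ω => (sample Ya (na k) ω, sample Yb (nb k) ω))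
    (fun k => (aemeasurable_sample hYa _).prodMk (aemeasurable_sample hYb _))
    (fun k => map_samples hYa hYb hYa_indep hYb_indep hY_indep _ _)
    (fun k x => ∫ w, b k x w ∂((νa (na k)).prod (νb (nb k))))
    (fun k => (mb k).stronglyMeasurable.integral_prod_right.measurable)
    (fun k x => integral_nonneg fun w => boxTest_nonneg _ _ _) hψ1 hI
    (h.tendsto_integral_stdBoot_sq hf hc hνa hνb φ)
  have hsum := (hsigmaHat κ hκ).add hT
  rw [add_zero] at hsum
  refine tendsto_of_tendsto_of_tendsto_of_le_of_le tendsto_const_nhds hsum (fun _ => zero_le)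
    fun k => (measure_mono fun ω hω => ?_).trans (measure_union_le _ _)
  by_contra hcon
  simp only [Set.mem_union, Set.mem_ofPred_eq, not_or, not_exists, not_and, not_lt, not_le]
    at hcon hω
  obtain ⟨hs, hlt⟩ := hcon
  rw [bootCrit, quantile, sInf_lt_iff] at hω
  -- A quantile below `t - 2 * ε` means that the bootstrap supremum stays below this level with
  -- conditional probability at least `p`. The conditional mean of the box test is then at least
  -- `p`, although it converges in mean square to a number smaller than `p`.
  obtain ⟨t', ht', htu⟩ := hω
  have hsub : {w | bootSup F c (sigmaHat k ω) (sample Ya (na k) ω) (sample Yb (nb k) ω) w ≤ t'}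
      ⊆ {w | 1 ≤ b k (sample Ya (na k) ω, sample Yb (nb k) ω) w} := fun w hw =>
    (H m f hf _ hs _ _ _ _ w ((show _ ≤ t' from hw).trans htu.le)).ge
  have h1 := (show ENNReal.ofReal p ≤ _ from ht').trans (measure_mono hsub)
  have h2 := mul_meas_ge_le_integral_of_nonneg
    (.of_forall fun w => boxTest_nonneg _ _ _)
    (ib k (sample Ya (na k) ω, sample Yb (nb k) ω)) 1
  rw [one_mul] at h2
  rw [ENNReal.ofReal_le_iff_le_toReal (measure_ne_top _ _)] at h1
  exact absurd (h1.trans h2) (not_le.2 hlt)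

/-- The analogue of `tendsto_measure_bootCrit_lt` for the simulated critical value. -/
lemma tendsto_measure_simCrit_lt (h : TwoSample Pa Pb F na nb lam) {R : ℕ → ℕ}
    (hR : Tendsto R atTop atTop)
    (W : ∀ k : ℕ, Ω → Fin (R k) → (Fin (na k) → ℝ) × (Fin (nb k) → ℝ))
    (hW : ∀ k, HasLaw (W k) (Measure.pi fun _ => (νa (na k)).prod (νb (nb k))) μ)
    (hW_indep : ∀ k, IndepFun (fun ω => (sample Ya (na k) ω, sample Yb (nb k) ω)) (W k) μ)
    {m : ℕ} {f : Fin m → 𝒳 → ℝ} (hf : ∀ i, f i ∈ F) {t p : ℝ}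
    (ht : boxProb Pa Pb lam f t < p) {ε : ℝ} (hε : 0 < ε) :
    Tendsto (fun k => μ {ω | simCrit F c (sigmaHat k ω) (sample Ya (na k) ω)
      (sample Yb (nb k) ω) (W k ω) p < ((t - 2 * ε : ℝ) : EReal)}) atTop (𝓝 0) := by
  have := hνa.prob
  have := hνb.prob
  obtain ⟨κ, hκ, H⟩ := h.exists_forall_boxTest_eq_one c (t - 2 * ε) hε
  let φ := boxTest (Fin m) (t - 2 * ε + ε) ε
  have hI : ∫ z, φ z ∂(limLaw Pa Pb (stdFun Pa Pb lam f Pa) (stdFun Pa Pb lam f Pb) 1 (lam ^ 2))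
      < p := by
    refine (integral_boxTest_le _ _ hε).trans_lt ?_
    have : t - 2 * ε + ε + ε = t := by ring
    rw [this]
    exact ht
  let I := ∫ z, φ z ∂(limLaw Pa Pb (stdFun Pa Pb lam f Pa) (stdFun Pa Pb lam f Pb) 1 (lam ^ 2))
  let b : ∀ k, ((Fin (na k) → 𝒳) × (Fin (nb k) → 𝒳)) → ((Fin (na k) → ℝ) × (Fin (nb k) → ℝ)) → ℝ :=
    fun k x w => φ (stdBoot Pa Pb lam c f x.1 x.2 w)
  have mb : ∀ k, Measurable (Function.uncurry (b k)) := fun k =>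
    φ.continuous.measurable.comp (h.measurable_stdBoot hf c _ _)
  have hb0 : ∀ k x w, 0 ≤ b k x w := fun k x w => boxTest_nonneg _ _ _
  have hb1 : ∀ k x w, b k x w ≤ 1 := fun k x w => boxTest_le_one _ _ _
  let A : ∀ k, ((Fin (na k) → 𝒳) × (Fin (nb k) → 𝒳)) ×
      (Fin (R k) → (Fin (na k) → ℝ) × (Fin (nb k) → ℝ)) → ℝ :=
    fun k z => (R k : ℝ)⁻¹ * ∑ r, b k z.1 (z.2 r)
  have mA : ∀ k, Measurable (A k) := fun k => measurable_average (b k) (mb k) (R k)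
  have hA1 : ∀ k z, A k z ≤ 1 := fun k z => by
    refine (inv_mul_le_one_of_le₀ ?_ (Nat.cast_nonneg _))
    calc _ ≤ ∑ _ : Fin (R k), (1 : ℝ) := Finset.sum_le_sum fun r _ => hb1 _ _ _
      _ = R k := by simp
  have hlim : Tendsto (fun k => ∫ z, (A k z - I) ^ 2 ∂((samplesLaw Pa Pb (na k) (nb k)).prod
      (Measure.pi fun _ : Fin (R k) => (νa (na k)).prod (νb (nb k))))) atTop (𝓝 0) := by
    have h1 := (tendsto_inv_atTop_zero.comp (tendsto_natCast_atTop_atTop (R := ℝ) |>.comp hR)).add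
      (h.tendsto_integral_stdBoot_sq hf hc hνa hνb φ)
    rw [add_zero] at h1
    refine tendsto_of_tendsto_of_tendsto_of_le_of_le' tendsto_const_nhds h1
      (.of_forall fun k => integral_nonneg fun z => sq_nonneg _) ?_
    filter_upwards [hR.eventually_gt_atTop 0] with k hk
    exact integral_average_sub_sq_le _ _ (b k) (mb k) (hb0 k) (hb1 k) I hk
  have hs2 : ∀ k, AEMeasurable (fun ω => (sample Ya (na k) ω, sample Yb (nb k) ω)) μ := fun k =>
    (aemeasurable_sample hYa _).prodMk (aemeasurable_sample hYb _)
  have hT := tendsto_measure_of_tendsto_integral_sq (μ := μ)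
    (fun k => (samplesLaw Pa Pb (na k) (nb k)).prod
      (Measure.pi fun _ : Fin (R k) => (νa (na k)).prod (νb (nb k))))
    (fun k ω => ((sample Ya (na k) ω, sample Yb (nb k) ω), W k ω))
    (fun k => (hs2 k).prodMk (hW k).aemeasurable)
    (fun k => by
      rw [(indepFun_iff_map_prod_eq_prod_map_map (hs2 k) (hW k).aemeasurable).1 (hW_indep k),
        (hW k).map_eq, map_samples hYa hYb hYa_indep hYb_indep hY_indep])
    A mA (fun k z => mul_nonneg (by positivity) (Finset.sum_nonneg fun r _ => hb0 _ _ _)) hA1 hI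
    hlim
  have hsum := (hsigmaHat κ hκ).add hT
  rw [add_zero] at hsum
  refine tendsto_of_tendsto_of_tendsto_of_le_of_le' tendsto_const_nhds hsum
    (.of_forall fun _ => zero_le) ?_
  filter_upwards [hR.eventually_gt_atTop 0] with k hk
  -- Accuracy of the estimated standard deviations is used pathwise, and the averaged box test
  -- involves only the true ones; the estimator may therefore depend on the draws.
  refine (measure_mono fun ω hω => ?_).trans (measure_union_le _ _)
  have hk' : (0 : ℝ) < R k := by exact_mod_cast hk
  by_contra hcon
  simp only [Set.mem_union, Set.mem_ofPred_eq, not_or, not_exists, not_and, not_lt, not_le]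
    at hcon hω
  obtain ⟨hs, hlt⟩ := hcon
  rw [simCrit, sampleQuantile, sInf_lt_iff] at hω
  obtain ⟨t', ht', htu⟩ := hω
  set D : Set (Fin (R k)) := {r | bootSup F c (sigmaHat k ω) (sample Ya (na k) ω)
    (sample Yb (nb k) ω) (W k ω r) ≤ t'} with hD
  have h1 : p * R k ≤ (D.ncard : ℝ) := ht'
  have h2 : (D.ncard : ℝ)
      ≤ ∑ r, b k (sample Ya (na k) ω, sample Yb (nb k) ω) (W k ω r) := by
    classical
    rw [Set.ncard_eq_toFinset_card', Finset.cast_card]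
    refine (Finset.sum_le_sum fun r hr => ?_).trans
      (Finset.sum_le_sum_of_subset_of_nonneg (Finset.subset_univ D.toFinset)
        fun r _ _ => hb0 _ _ _)
    have hr' : r ∈ D := Set.mem_toFinset.1 hr
    exact (H m f hf _ hs _ _ _ _ _ (le_trans hr' htu.le)).ge
  exact absurd ((inv_mul_lt_iff₀ hk').1 hlt) (by linarith)

end Critical

/-- Asymptotic control of the familywise error rate, for critical values that are asymptotically at
least the quantiles of the maxima of the limit over finite subclasses. -/
theorem limsup_fwer_le [IsProbabilityMeasure μ] (h : TwoSample Pa Pb F na nb lam)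
    {Ya Yb : ℕ → Ω → 𝒳}
    (hYa : ∀ i, HasLaw (Ya i) Pa μ) (hYb : ∀ i, HasLaw (Yb i) Pb μ)
    (hYa_indep : iIndepFun Ya μ) (hYb_indep : iIndepFun Yb μ)
    (hY_indep : IndepFun (fun ω i => Ya i ω) (fun ω i => Yb i ω) μ)
    {sigmaHat : ℕ → Ω → (𝒳 → ℝ) → ℝ}
    (hsigmaHat : ∀ ε : ℝ, 0 < ε → Tendsto
      (fun k => μ {ω | ∃ f ∈ F,
        ε < |sigmaHat k ω f - Real.sqrt (sigmaSq Pa Pb lam f)|}) atTop (𝓝 0))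
    {α : ℝ} (hα0 : 0 < α) (hα1 : α < 1) (crit : ℕ → Ω → EReal)
    (hcrit : ∀ (m : ℕ) (f : Fin m → 𝒳 → ℝ), (∀ i, f i ∈ F) → ∀ t : ℝ,
      boxProb Pa Pb lam f t < 1 - α → ∀ ε : ℝ, 0 < ε →
      Tendsto (fun k => μ {ω | crit k ω < ((t - 2 * ε : ℝ) : EReal)}) atTop (𝓝 0))
    (T : ℕ → Ω → (𝒳 → ℝ) → ℝ)
    (hT : ∀ k ω, ∀ f ∈ trueNulls Pa Pb F, 0 < sigmaHat k ω f → T k ω f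
      ≤ tStat Pa Pb (sample Ya (na k) ω) (sample Yb (nb k) ω) (sigmaHat k ω f) f) :
    limsup (fun k => fwer μ (trueNulls Pa Pb F) (T k) (crit k)) atTop ≤ ENNReal.ofReal α := by
  rcases F.eq_empty_or_nonempty with rfl | hF
  · simp [fwer, trueNulls]
  refine ENNReal.le_of_forall_pos_le_add fun δ hδ _ => ?_
  have hδ' : (0 : ℝ) < δ := by exact_mod_cast hδ
  obtain ⟨L, hL, hLip⟩ := h.exists_boxProb_le_add
  obtain ⟨τ, hτ⟩ := h.exists_threshold hF hα0 hα1
  -- The lowest level reached below is `τ - 6 * ε`, at distance `7 * ε` from `τ + ε`; the Lipschitz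
  -- bound turns this gap into `7 * L * ε = δ / 4`.
  set ε : ℝ := δ / (28 * L) with hε
  have hε0 : 0 < ε := by positivity
  obtain ⟨⟨m, f, hf, hfτ⟩, hge⟩ := hτ ε hε0
  obtain ⟨η₀, hη₀, hle⟩ := h.sigma
  obtain ⟨κ, hκ, H⟩ := exists_scale (Real.sqrt_pos.2 hη₀) (τ - ε - 2 * ε) hε0
  obtain ⟨N, f', hf', hex⟩ := h.exists_eventually_exceed_le hF (τ - ε - 2 * ε - ε) hε0
    (β := δ / 4) (by positivity)
  have h1 := (ENNReal.tendsto_nhds_zero.1 (hcrit m f hf _ hfτ ε hε0)) (ENNReal.ofReal (δ / 4))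
    (by simpa using hδ)
  have h2 := (ENNReal.tendsto_nhds_zero.1 (hsigmaHat κ hκ)) (ENNReal.ofReal (δ / 4))
    (by simpa using hδ)
  have hα' : ENNReal.ofReal (1 - boxProb Pa Pb lam f' (τ - ε - 2 * ε - ε - 2 * ε) + δ / 4)
      ≤ ENNReal.ofReal (α + δ / 2) := by
    refine ENNReal.ofReal_le_ofReal ?_
    have h3 := hge N f' hf'
    have h4 := hLip N f' hf' (τ - ε - 2 * ε - ε - 2 * ε) (τ + ε) (by linarith)
    have h5 : L * (τ + ε - (τ - ε - 2 * ε - ε - 2 * ε)) = δ / 4 := by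
      rw [hε]
      field_simp
      ring
    linarith
  refine limsup_le_of_le (by isBoundedDefault) ?_
  filter_upwards [h1, h2, hex] with k k1 k2 k3
  have k4 : μ {ω | (sample Ya (na k) ω, sample Yb (nb k) ω) ∈ {x : (Fin (na k) → 𝒳) × _ |
      ∃ g ∈ F, Real.sqrt (sigmaSq Pa Pb lam g) * (τ - ε - 2 * ε - ε)
        < twoProc Pa Pb x.1 x.2 g}} ≤ ENNReal.ofReal (α + δ / 2) := by
    refine le_trans (Measure.le_map_apply
      ((aemeasurable_sample hYa _).prodMk (aemeasurable_sample hYb _)) _) ?_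
    rw [map_samples hYa hYb hYa_indep hYb_indep hY_indep]
    exact k3.trans hα'
  -- The budget: a low critical value, inaccurate standard deviations, and an exceedance by the
  -- process itself.
  have htot : ENNReal.ofReal (δ / 4) + ENNReal.ofReal (δ / 4) + ENNReal.ofReal (α + δ / 2)
      = ENNReal.ofReal α + δ := by
    rw [← ENNReal.ofReal_coe_nnreal, ← ENNReal.ofReal_add (by positivity) (by positivity),
      ← ENNReal.ofReal_add (by positivity) (by positivity),
      ← ENNReal.ofReal_add (by positivity) (by positivity)]
    congr 1
    ring
  rw [← htot]
  refine (measure_mono ?_).trans ((measure_union_le _ _).trans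
    (add_le_add ((measure_union_le _ _).trans (add_le_add k1 k2)) k4))
  rintro ω ⟨g, hg, hlt⟩
  by_contra hcon
  simp only [Set.mem_union, Set.mem_ofPred_eq, not_or, not_exists, not_and, not_lt] at hcon
  obtain ⟨⟨c1, c2⟩, c3⟩ := hcon
  have hgF : g ∈ F := hg.1
  obtain ⟨hs0, -, hsu⟩ := H _ _ (Real.sqrt_le_sqrt (hle _ hgF)) (c2 g hgF)
  have c4 := EReal.coe_lt_coe_iff.1 (c1.trans_lt hlt)
  have c5 := c4.trans_le (hT k ω g hg hs0)
  change _ < twoProc Pa Pb (sample Ya (na k) ω) (sample Yb (nb k) ω) g / sigmaHat k ω g at c5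
  rw [lt_div_iff₀ hs0] at c5
  have c6 := c3 g hgF
  linarith

end TwoSample

/-- Under a true null the omitted centering is nonpositive, so leaving it out can only lower the
statistic. -/
lemma tStatZero_le_tStat {Pa Pb : Measure 𝒳} {F : Set (𝒳 → ℝ)} {f : 𝒳 → ℝ}
    (hf : f ∈ trueNulls Pa Pb F) {n m : ℕ} (xa : Fin n → 𝒳) (xb : Fin m → 𝒳) {s : ℝ} (hs : 0 < s) :
    tStatZero xa xb s f ≤ tStat Pa Pb xa xb s f := by
  refine div_le_div_of_nonneg_right ?_ hs.le
  exact mul_le_mul_of_nonneg_left (by linarith [hf.2]) (Real.sqrt_nonneg _)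

end

end UtilityMTP

end

theorem mainTheorem2
    {𝒳 : Type*} [MeasurableSpace 𝒳] {Ω : Type*} [MeasurableSpace Ω]
    (μ : Measure Ω) [IsProbabilityMeasure μ]
    (Pa Pb : Measure 𝒳) [IsProbabilityMeasure Pa] [IsProbabilityMeasure Pb]
    -- the class of utility functions
    (F : Set (𝒳 → ℝ))
    (hFa : UtilityMTP.IsDonsker Pa F) (hFb : UtilityMTP.IsDonsker Pb F)
    (hMa : ∀ δ : ℝ, 0 < δ → UtilityMTP.IsMeasurableClass Pa (UtilityMTP.diffClass Pa F δ))
    (hMb : ∀ δ : ℝ, 0 < δ → UtilityMTP.IsMeasurableClass Pb (UtilityMTP.diffClass Pb F δ))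
    -- two independent iid samples
    (Ya Yb : ℕ → Ω → 𝒳)
    (hYa : ∀ i, HasLaw (Ya i) Pa μ) (hYb : ∀ i, HasLaw (Yb i) Pb μ)
    (hYa_indep : iIndepFun Ya μ) (hYb_indep : iIndepFun Yb μ)
    (hY_indep : IndepFun (fun ω i => Ya i ω) (fun ω i => Yb i ω) μ)
    -- sample sizes of similar magnitude
    (na nb : ℕ → ℕ) (hna : Tendsto na atTop atTop) (hnb : Tendsto nb atTop atTop)
    (lam : ℝ)
    (hlam : Tendsto (fun k => Real.sqrt ((na k : ℝ) / (nb k : ℝ))) atTop (𝓝 lam))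
    -- variances bounded away from zero, and a uniformly consistent estimator
    (hsigma : ∃ η : ℝ, 0 < η ∧ ∀ f ∈ F, η ≤ UtilityMTP.sigmaSq Pa Pb lam f)
    (sigmaHat : ℕ → Ω → (𝒳 → ℝ) → ℝ)
    (hsigmaHat : ∀ ε : ℝ, 0 < ε → Tendsto
      (fun k => μ {ω | ∃ f ∈ F,
        ε < |sigmaHat k ω f - Real.sqrt (UtilityMTP.sigmaSq Pa Pb lam f)|}) atTop (𝓝 0))
    -- bootstrap weights, with the same constant for both samples
    (c : ℝ) (hc : 0 < c) (νa νb : ∀ n : ℕ, Measure (Fin n → ℝ))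
    (hνa : UtilityMTP.IsWeightLaw νa c) (hνb : UtilityMTP.IsWeightLaw νb c)
    (α : ℝ) (hα0 : 0 < α) (hα1 : α < 1) :
    -- critical value: the conditional quantile of the bootstrap supremum given the data
    (limsup (fun k => UtilityMTP.fwer μ (UtilityMTP.trueNulls Pa Pb F)
        (fun ω f => UtilityMTP.tStat Pa Pb (UtilityMTP.sample Ya (na k) ω)
          (UtilityMTP.sample Yb (nb k) ω) (sigmaHat k ω f) f)
        (fun ω => UtilityMTP.bootCrit νa νb F c (sigmaHat k ω)
          (UtilityMTP.sample Ya (na k) ω) (UtilityMTP.sample Yb (nb k) ω) (1 - α)))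
        atTop ≤ ENNReal.ofReal α ∧
      limsup (fun k => UtilityMTP.fwer μ (UtilityMTP.trueNulls Pa Pb F)
        (fun ω f => UtilityMTP.tStatZero (UtilityMTP.sample Ya (na k) ω)
          (UtilityMTP.sample Yb (nb k) ω) (sigmaHat k ω f) f)
        (fun ω => UtilityMTP.bootCrit νa νb F c (sigmaHat k ω)
          (UtilityMTP.sample Ya (na k) ω) (UtilityMTP.sample Yb (nb k) ω) (1 - α)))
        atTop ≤ ENNReal.ofReal α) ∧
    -- critical value: the sample quantile over `R k` simulated draws of the weights
    (∀ (R : ℕ → ℕ), Tendsto R atTop atTop →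
      ∀ (W : ∀ k : ℕ, Ω → Fin (R k) → (Fin (na k) → ℝ) × (Fin (nb k) → ℝ)),
      (∀ k, HasLaw (W k) (Measure.pi fun _ => (νa (na k)).prod (νb (nb k))) μ) →
      (∀ k, IndepFun (fun ω => (UtilityMTP.sample Ya (na k) ω, UtilityMTP.sample Yb (nb k) ω))
        (W k) μ) →
      limsup (fun k => UtilityMTP.fwer μ (UtilityMTP.trueNulls Pa Pb F)
        (fun ω f => UtilityMTP.tStat Pa Pb (UtilityMTP.sample Ya (na k) ω)
          (UtilityMTP.sample Yb (nb k) ω) (sigmaHat k ω f) f)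
        (fun ω => UtilityMTP.simCrit F c (sigmaHat k ω)
          (UtilityMTP.sample Ya (na k) ω) (UtilityMTP.sample Yb (nb k) ω) (W k ω) (1 - α)))
        atTop ≤ ENNReal.ofReal α ∧
      limsup (fun k => UtilityMTP.fwer μ (UtilityMTP.trueNulls Pa Pb F)
        (fun ω f => UtilityMTP.tStatZero (UtilityMTP.sample Ya (na k) ω)
          (UtilityMTP.sample Yb (nb k) ω) (sigmaHat k ω f) f)
        (fun ω => UtilityMTP.simCrit F c (sigmaHat k ω)
          (UtilityMTP.sample Ya (na k) ω) (UtilityMTP.sample Yb (nb k) ω) (W k ω) (1 - α)))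
        atTop ≤ ENNReal.ofReal α) := by
  have h : UtilityMTP.TwoSample Pa Pb F na nb lam := ⟨hFa, hFb, hna, hnb, hlam, hsigma⟩
  refine ⟨⟨?_, ?_⟩, fun R hR W hW hWi => ⟨?_, ?_⟩⟩
  · exact h.limsup_fwer_le hYa hYb hYa_indep hYb_indep hY_indep hsigmaHat hα0 hα1 _
      (fun m f hf t ht ε hε => h.tendsto_measure_bootCrit_lt hYa hYb hYa_indep hYb_indep hY_indep hsigmaHat hc hνa
        hνb hf ht hε)
      _ fun k ω f hf hs => le_rfl
  · exact h.limsup_fwer_le hYa hYb hYa_indep hYb_indep hY_indep hsigmaHat hα0 hα1 _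
      (fun m f hf t ht ε hε => h.tendsto_measure_bootCrit_lt hYa hYb hYa_indep hYb_indep hY_indep hsigmaHat hc hνa
        hνb hf ht hε)
      _ fun k ω f hf hs => UtilityMTP.tStatZero_le_tStat hf _ _ hs
  · exact h.limsup_fwer_le hYa hYb hYa_indep hYb_indep hY_indep hsigmaHat hα0 hα1 _
      (fun m f hf t ht ε hε => h.tendsto_measure_simCrit_lt hYa hYb hYa_indep hYb_indep hY_indep hsigmaHat hc hνa
        hνb hR W hW hWi hf ht hε)
      _ fun k ω f hf hs => le_rfl
  · exact h.limsup_fwer_le hYa hYb hYa_indep hYb_indep hY_indep hsigmaHat hα0 hα1 _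
      (fun m f hf t ht ε hε => h.tendsto_measure_simCrit_lt hYa hYb hYa_indep hYb_indep hY_indep hsigmaHat hc hνa
        hνb hR W hW hWi hf ht hε)
      _ fun k ω f hf hs => UtilityMTP.tStatZero_le_tStat hf _ _ hs
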